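/- Let $y_t$ denote the tritronquée solution of the Painlevé equation $y''=6y^2+z$ characterised by $y(z)=i\sqrt{z/6}\,\bigl(1+O(z^{-5/2})\bigr)$ as $z\to\infty$ along the ray $e^{i\pi/5}\mathbb R^+$. It exists, is unique, and continues analytically to a neighbourhood of $\{re^{i\pi/5}:r\ge 0\}$. For $t\le 0$ put $g(t)=e^{2\pi i/5}\,y_t(-te^{\pi i/5})$, so that $g''=6g^2+t$. Let $t_0=-1.7$, $s=t-t_0$, $$g_0=-\tfrac{280}{519}+\tfrac{150}{1013}s+\tfrac{239}{10331}s^2+\tfrac{110}{14779}s^3-\tfrac{32}{9853}s^4+\tfrac{9}{4397}s^5-\tfrac{16}{39505}s^6+\tfrac{8}{49105}s^7,$$ $$J_1=1-\tfrac{9489}{2932}s^2+\tfrac{1350}{4721}s^3+\tfrac{359}{199}s^4-\tfrac{1526}{3719}s^5-\tfrac{708}{1633}s^6+\tfrac{503}{2201}s^7-\tfrac{211}{6486}s^8,$$ $$J_2=s-\tfrac{48}{659797}s^2-\tfrac{2941}{2730}s^3+\tfrac{675}{4873}s^4+\tfrac{1832}{4745}s^5-\tfrac{2305}{19401}s^6-\tfrac{677}{14054}s^7+\tfrac{1573}{53783}s^8-\tfrac{531}{128216}s^9.$$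 Put $W=J_1J_2'-J_2J_1'$, $A=(J_2J_1''-J_1J_2'')/W$, $B=(J_2''J_1'-J_1''J_2')/W$, $B_1=12g_0+B$, $R=6g_0^2+t-g_0''$, $\mathcal G(s,t)=W(s)^{-1}[J_2(t)J_1(s)-J_1(t)J_2(s)]$, $K_1[f](t)=\int_{t_0}^t\mathcal G(s,t)f(s)\,ds$, $K_2[f](t)=\int_{t_0}^t\partial_t\mathcal G(s,t)f(s)\,ds$ (where $s$ is now an integration variable). For $a_1,a_2\in\mathbb C$ and a pair $\boldsymbol\delta=(\delta,\delta')$ of continuous complex functions on $[t_0,0]$ (the second component $\delta'$ of a general pair is an independent function, not necessarily the derivative of the first) let $$\hat N\boldsymbol\delta=a_1(J_1,J_1')+a_2(J_2,J_2')+(K_1[R+r],K_2[R+r]),\qquad r=A\delta'+B_1\delta+6\delta^2 .$$ Let $\|\cdot\|$ be the sup norm on $[t_0,0]$ and $\|\boldsymbol\delta\|^{(1/2)}=\max\{\|\delta\|,\tfrac12\|\delta'\|\}$. Proposition. (i) If $|a_1|<1/290$ and $|a_2|<1/152$, then $\hat N$ maps the disc $\{\|\boldsymbol\delta\|^{(1/2)}\le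 1/158\}$ into itself and is a contraction there with factor $<1/6$. (ii) For $\delta=g-g_0$, $a_1=\delta(t_0)$, $a_2=\delta'(t_0)$ one has $|a_1|<1/290$, $|a_2|<1/152$; the pair $(\delta,\delta')$ lies in this disc and is a fixed point of $\hat N$; and $\|\delta-a_1J_1-a_2J_2\|<1/1500$, $\|\delta'-a_1J_1'-a_2J_2'\|<1/658$. (iii) $|g(0)+87/469|<1/167$ and $|g'(0)-41/134|<1/108$. Consequently $|y_t(0)+\tfrac{87}{469}e^{-2\pi i/5}|<1/100$ and $|y_t'(0)-\tfrac{41}{134}e^{2\pi i/5}|<1/100$. -/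

import Mathlib

open Complex Filter Asymptotics

noncomputable section

namespace PainleveI

/-! ### The equation `y'' = 6 y² + z` and its tritronquée solution -/

/-- `y` is a holomorphic solution of `y'' = 6 y² + z` on the open set `U`. -/
def IsSolutionOn (U : Set ℂ) (y : ℂ → ℂ) : Prop :=
  IsOpen U ∧ DifferentiableOn ℂ y U ∧ ∀ z ∈ U, deriv (deriv y) z = 6 * y z ^ 2 + z

/-- The point `r e^{iπ/5}` of the anti-Stokes ray. -/
def ray (r : ℝ) : ℂ := (r : ℂ) * exp (I * Real.pi / 5)

/-- `y` is a solution on `U`, the open set `U` contains all sufficiently distant points of the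
ray `e^{iπ/5} ℝ⁺`, and `y(z) = i √(z/6) (1 + O(z^{-5/2}))` as `z → ∞` along this ray (principal
branch of the root). -/
def IsTritronquee (U : Set ℂ) (y : ℂ → ℂ) : Prop :=
  IsSolutionOn U y ∧ (∀ᶠ r : ℝ in atTop, ray r ∈ U) ∧
    (fun r : ℝ => y (ray r) / (I * (ray r / 6) ^ (1 / 2 : ℂ)) - 1)
      =O[atTop] fun r : ℝ => r ^ (-(5 / 2) : ℝ)

/-- The rotated function `g(t) = e^{2πi/5} y(-t e^{πi/5})` of the real variable `t`. -/
def rotated (y : ℂ → ℂ) (t : ℝ) : ℂ :=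
  exp (2 * Real.pi * I / 5) * y (-(t : ℂ) * exp (Real.pi * I / 5))

/-! ### The explicit polynomials, in powers of `t - t₀` -/

/-- The matching point `t₀ = -1.7`. -/
def t₀ : ℝ := -(17 / 10)

/-- The polynomial approximation of `g`. -/
def g₀ (t : ℝ) : ℝ :=
  -(280 / 519) + 150 / 1013 * (t - t₀) + 239 / 10331 * (t - t₀) ^ 2 + 110 / 14779 * (t - t₀) ^ 3
    - 32 / 9853 * (t - t₀) ^ 4 + 9 / 4397 * (t - t₀) ^ 5 - 16 / 39505 * (t - t₀) ^ 6 + 8 / 49105 * (t - t₀) ^ 7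

def J₁ (t : ℝ) : ℝ :=
  1 - 9489 / 2932 * (t - t₀) ^ 2 + 1350 / 4721 * (t - t₀) ^ 3 + 359 / 199 * (t - t₀) ^ 4 - 1526 / 3719 * (t - t₀) ^ 5
    - 708 / 1633 * (t - t₀) ^ 6 + 503 / 2201 * (t - t₀) ^ 7 - 211 / 6486 * (t - t₀) ^ 8

def J₂ (t : ℝ) : ℝ :=
  (t - t₀) - 48 / 659797 * (t - t₀) ^ 2 - 2941 / 2730 * (t - t₀) ^ 3 + 675 / 4873 * (t - t₀) ^ 4 + 1832 / 4745 * (t - t₀) ^ 5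
    - 2305 / 19401 * (t - t₀) ^ 6 - 677 / 14054 * (t - t₀) ^ 7 + 1573 / 53783 * (t - t₀) ^ 8
    - 531 / 128216 * (t - t₀) ^ 9

/-- The remainder `R`, given by `-R = g₀'' - 6 g₀² - t`. -/
def R (t : ℝ) : ℝ := -(deriv (deriv g₀) t - 6 * g₀ t ^ 2 - t)

/-- The Wronskian of `J₁` and `J₂`. -/
def W (t : ℝ) : ℝ := J₁ t * deriv J₂ t - J₂ t * deriv J₁ t

/-! `J₁` and `J₂` satisfy `f'' + A f' + B f = 0`. -/

def A (t : ℝ) : ℝ := (J₂ t * deriv (deriv J₁) t - J₁ t * deriv (deriv J₂) t) / W t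

def B (t : ℝ) : ℝ :=
  (deriv (deriv J₂) t * deriv J₁ t - deriv (deriv J₁) t * deriv J₂ t) / W t

def B₁ (t : ℝ) : ℝ := 12 * g₀ t + B t

/-- The Green's function of `f'' + A f' + B f`. -/
def green (s t : ℝ) : ℝ := (W s)⁻¹ * (J₂ t * J₁ s - J₁ t * J₂ s)

/-! ### The integral operator -/

def K₁ (f : ℝ → ℂ) (t : ℝ) : ℂ := ∫ s in t₀..t, (green s t : ℂ) * f s

def K₂ (f : ℝ → ℂ) (t : ℝ) : ℂ := ∫ s in t₀..t, ((deriv (fun τ => green s τ) t : ℝ) : ℂ) * f s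

/-- `r = A δ' + B₁ δ + 6 δ²`, for a pair `(δ, δ')`. -/
def nonlin (d : (ℝ → ℂ) × (ℝ → ℂ)) (s : ℝ) : ℂ :=
  (A s : ℂ) * d.2 s + (B₁ s : ℂ) * d.1 s + 6 * d.1 s ^ 2

/-- The operator `N` whose fixed-point equation is the integral form of
`δ'' - 12 g₀ δ = 6 δ² + R`, `δ(t₀) = a₁`, `δ'(t₀) = a₂`, written for the pair `(δ, δ')`. -/
def N (a₁ a₂ : ℂ) (d : (ℝ → ℂ) × (ℝ → ℂ)) : (ℝ → ℂ) × (ℝ → ℂ) :=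
  (fun t => a₁ * (J₁ t : ℂ) + a₂ * (J₂ t : ℂ)
      + K₁ (fun s => (R s : ℂ)) t + K₁ (nonlin d) t,
   fun t => a₁ * ((deriv J₁ t : ℝ) : ℂ) + a₂ * ((deriv J₂ t : ℝ) : ℂ)
      + K₂ (fun s => (R s : ℂ)) t + K₂ (nonlin d) t)

/-- The supremum norm on `[t₀, 0]` (used for functions that are continuous there). -/
def supNorm (f : ℝ → ℂ) : ℝ := ⨆ t : Set.Icc t₀ 0, ‖f t‖

/-- The norm `max (‖δ‖, ½ ‖δ'‖)` of a pair. -/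
def halfNorm (d : (ℝ → ℂ) × (ℝ → ℂ)) : ℝ := max (supNorm d.1) (1 / 2 * supNorm d.2)

/-- The disc of radius `1/158` in the space of pairs of continuous functions on `[t₀, 0]`. -/
def disc : Set ((ℝ → ℂ) × (ℝ → ℂ)) :=
  {d | ContinuousOn d.1 (Set.Icc t₀ 0) ∧ ContinuousOn d.2 (Set.Icc t₀ 0) ∧
    halfNorm d ≤ 1 / 158}

/-- `δ = g - g₀`. -/
def delta (y : ℂ → ℂ) (t : ℝ) : ℂ := rotated y t - (g₀ t : ℂ)

end PainleveI

end

/-!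
In the rotated variable `f(x) = e^{2πi/5} y(x e^{iπ/5}) = g(-x)` the equation `y'' = 6 y² + z`
becomes `f'' = 6 f² - x` on the half-line `x ≥ 0`, and the tritronquée condition becomes
`f(x) = -√(x/6) + O(x⁻²)`. So the task is to construct a real solution of the latter, to show that it is the
only one, also among complex solutions, and to control it down to `x = 0`.

*Near infinity.* With `f = -√(x/6) φ(s)` and `s = (24 x)^{5/4} / 30`, the function `φ` satisfies
`φ'' + φ'/s - (4/25) φ/s² = (1 - φ²)/2`. The explicit `φ = 1 + (4/25) / (s² + 5/2)` is nearly a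
solution. Writing the correction as `k / √s` gives `k'' + k = (small)`, which is solved in the space
of bounded functions by contraction with the kernel `sin (τ - s)` integrated from infinity
(`exists_correction`). The bounds on `k` and `k'` are good enough down to `s = 17/5`, that is,
slightly beyond the matching point `x = 17/10 = -t₀`, and give the matching data there
(`exists_solution_near_infinity`).

*From `t₀` to `0`.* `J₁` and `J₂` form a fundamental system of `h'' + A h' + B h = 0`, and `green`
is its Green's function, so that fixed points of `N` are exactly the solutions of
`δ'' - 12 g₀ δ = 6 δ² + R` with the data `a₁`, `a₂` at `t₀`. Since `A`, `B₁` and `R` are tiny, crude bounds on the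
kernels make `N` a contraction of the disc (`mapsTo_N`, `halfNorm_N_sub_le`), and `g₀ + δ` continues
the solution to the origin (`exists_fixedPoint`, `exists_solution_half_line`). All this rests on
bounds for explicit polynomials on an interval, which are verified in exact integer arithmetic by
expanding about the midpoints of small subintervals (`abs_ev_le_of_boundTest`).

*Continuation to the complex domain.* At each point of the half-line the power series with the given
initial data converges, and coincides with the real solution by uniqueness for the initial value
problem; the local series fit together by the identity theorem (`exists_holomorphic_extension`).

*Uniqueness.* The difference `w` of two solutions with the same asymptotics satisfies a linear
equation. A Liouville transformation brings it to `ω'' + ω = κ ω` with `κ = O(s⁻²)` and `ω → 0`,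
which forces `ω = 0` far out, because the Volterra equation from infinity has only the zero solution
(`eventually_eq_of_asymptotic`). The initial value problem does the rest.
-/

noncomputable section

namespace PainleveI

/-! ### Certified bounds for polynomials with rational coefficients -/

/-- Value at `x` of the polynomial with the rational coefficients `p`, lowest degree first. -/
def ev : List ℚ → ℝ → ℝ
  | [], _ => 0
  | a :: p, x => a + x * ev p x

/-- Value at `x` of the polynomial with the integer coefficients `p`, lowest degree first. -/
def evInt : List ℤ → ℝ → ℝ
  | [], _ => 0
  | a :: p, x => a + x * evInt p x

/-- Sum of coefficient lists. -/
def lAdd : List ℚ → List ℚ → List ℚ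
  | [], q => q
  | a :: p, [] => a :: p
  | a :: p, b :: q => (a + b) :: lAdd p q

/-- Scalar multiple of a coefficient list. -/
def lSmul (c : ℚ) : List ℚ → List ℚ
  | [] => []
  | a :: p => (c * a) :: lSmul c p

/-- Product of coefficient lists. -/
def lMul : List ℚ → List ℚ → List ℚ
  | [], _ => []
  | a :: p, q => lAdd (lSmul a q) (0 :: lMul p q)

/-- Coefficients of the derivative. -/
def lDer : List ℚ → List ℚ
  | [] => []
  | _ :: p => lAdd p (0 :: lDer p)

/-- Coefficients of `x ↦ p (c * x)`. -/
def lScale (c : ℚ) : List ℚ → List ℚ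
  | [] => []
  | a :: p => a :: lSmul c (lScale c p)

/-- Sum of integer coefficient lists. -/
def lAddInt : List ℤ → List ℤ → List ℤ
  | [], q => q
  | a :: p, [] => a :: p
  | a :: p, b :: q => (a + b) :: lAddInt p q

/-- Scalar multiple of an integer coefficient list. -/
def lSmulInt (c : ℤ) : List ℤ → List ℤ
  | [] => []
  | a :: p => (c * a) :: lSmulInt c p

/-- Coefficients of the Taylor expansion `x ↦ p (c + x)`. -/
def lShiftInt (c : ℤ) : List ℤ → List ℤ
  | [] => []
  | a :: p => lAddInt (a :: lShiftInt c p) (lSmulInt c (lShiftInt c p))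

/-- The sum of the absolute values of the coefficients, a bound on `[-1, 1]`. -/
def sumAbsInt : List ℤ → ℕ
  | [] => 0
  | a :: p => a.natAbs + sumAbsInt p

/-- A common denominator of the coefficients. -/
def lDen : List ℚ → ℕ
  | [] => 1
  | a :: p => Nat.lcm a.den (lDen p)

/-- The numerators of the coefficients multiplied by `D`. -/
def lNum (D : ℚ) : List ℚ → List ℤ
  | [] => []
  | a :: p => (D * a).num :: lNum D p

/-- The given integers are the coefficients multiplied by `D`. -/
def isMul (D : ℚ) : List ℚ → List ℤ → Bool
  | [], [] => true
  | a :: p, b :: q => decide ((b : ℚ) = D * a) && isMul D p q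
  | _, _ => false

/-- A test for `|p| ≤ M` on `[0, 17/10]`: this interval is cut into `n` equal pieces, and on each of
them the polynomial is expanded, in integer arithmetic, about the midpoint. The unit of length is
half the length of a piece, so that the midpoints are the odd integers `2 * j + 1`. -/
def boundTest (n : ℕ) (p : List ℚ) (M : ℚ) : Bool :=
  let q := lScale (17 / (20 * n)) p
  let D : ℚ := ((M.den * lDen q : ℕ) : ℚ)
  let z := lNum D q
  decide (0 < n) && decide (0 < D) && isMul D q z &&
    (List.range n).all fun j =>
      decide ((sumAbsInt (lShiftInt (2 * j + 1) z) : ℤ) ≤ (M * D).floor)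

@[simp] theorem ev_nil (x : ℝ) : ev [] x = 0 := rfl
@[simp] theorem ev_cons (a : ℚ) (p : List ℚ) (x : ℝ) : ev (a :: p) x = a + x * ev p x := rfl
@[simp] theorem evInt_nil (x : ℝ) : evInt [] x = 0 := rfl
@[simp] theorem evInt_cons (a : ℤ) (p : List ℤ) (x : ℝ) :
    evInt (a :: p) x = a + x * evInt p x := rfl

theorem ev_lAdd (p q : List ℚ) (x : ℝ) : ev (lAdd p q) x = ev p x + ev q x := by
  induction p generalizing q with
  | nil => simp [lAdd]
  | cons a p ih =>
    cases q with
    | nil => simp [lAdd]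
    | cons b q => simp only [lAdd, ev_cons, ih]; push_cast; ring

theorem ev_lSmul (c : ℚ) (p : List ℚ) (x : ℝ) : ev (lSmul c p) x = c * ev p x := by
  induction p with
  | nil => simp [lSmul]
  | cons a p ih => simp only [lSmul, ev_cons, ih]; push_cast; ring

theorem ev_lMul (p q : List ℚ) (x : ℝ) : ev (lMul p q) x = ev p x * ev q x := by
  induction p with
  | nil => simp [lMul]
  | cons a p ih => simp only [lMul, ev_cons, ev_lAdd, ev_lSmul, ih]; push_cast; ring

theorem ev_lScale (c : ℚ) (p : List ℚ) (x : ℝ) : ev (lScale c p) x = ev p (c * x) := by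
  induction p with
  | nil => simp [lScale]
  | cons a p ih => simp only [lScale, ev_cons, ev_lSmul, ih]; ring

theorem hasDerivAt_ev (p : List ℚ) (x : ℝ) : HasDerivAt (ev p) (ev (lDer p) x) x := by
  induction p with
  | nil => exact hasDerivAt_const x (0 : ℝ)
  | cons a p ih =>
    have h := ((hasDerivAt_id x).mul ih).const_add (a : ℝ)
    refine h.congr_deriv ?_
    simp [lDer, ev_lAdd]

theorem evInt_lAddInt (p q : List ℤ) (x : ℝ) : evInt (lAddInt p q) x = evInt p x + evInt q x := by
  induction p generalizing q with
  | nil => simp [lAddInt]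
  | cons a p ih =>
    cases q with
    | nil => simp [lAddInt]
    | cons b q => simp only [lAddInt, evInt_cons, ih]; push_cast; ring

theorem evInt_lSmulInt (c : ℤ) (p : List ℤ) (x : ℝ) : evInt (lSmulInt c p) x = c * evInt p x := by
  induction p with
  | nil => simp [lSmulInt]
  | cons a p ih => simp only [lSmulInt, evInt_cons, ih]; push_cast; ring

theorem evInt_lShiftInt (c : ℤ) (p : List ℤ) (x : ℝ) :
    evInt (lShiftInt c p) x = evInt p (c + x) := by
  induction p with
  | nil => simp [lShiftInt]
  | cons a p ih => simp only [lShiftInt, evInt_cons, evInt_lAddInt, evInt_lSmulInt, ih]; ring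

theorem abs_evInt_le_sumAbsInt (p : List ℤ) {x : ℝ} (hx : |x| ≤ 1) :
    |evInt p x| ≤ sumAbsInt p := by
  induction p with
  | nil => simp [sumAbsInt]
  | cons a p ih =>
    simp only [evInt_cons, sumAbsInt]
    push_cast
    refine (abs_add_le _ _).trans ?_
    rw [abs_mul, Nat.cast_natAbs, Int.cast_abs]
    have := mul_le_mul hx ih (abs_nonneg _) zero_le_one
    linarith

theorem evInt_of_isMul {D : ℚ} {p : List ℚ} {q : List ℤ} (h : isMul D p q = true) (x : ℝ) :
    evInt q x = D * ev p x := by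
  induction p generalizing q with
  | nil =>
    cases q with
    | nil => simp
    | cons b q => simp [isMul] at h
  | cons a p ih =>
    cases q with
    | nil => simp [isMul] at h
    | cons b q =>
      simp only [isMul, Bool.and_eq_true, decide_eq_true_eq] at h
      have h1 : (b : ℝ) = D * a := by exact_mod_cast congrArg (fun q : ℚ => (q : ℝ)) h.1
      simp only [evInt_cons, ev_cons, ih h.2, h1]
      ring

/-- Soundness of the test: on each piece the local variable lies in `[-1, 1]`, where the sum of the
absolute values of the coefficients bounds the polynomial. -/
theorem abs_ev_le_of_boundTest {n : ℕ} {p : List ℚ} {M : ℚ} (h : boundTest n p M = true)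
    {x : ℝ} (h0 : 0 ≤ x) (h1 : x ≤ 17 / 10) : |ev p x| ≤ M := by
  simp only [boundTest, Bool.and_eq_true, decide_eq_true_eq, List.all_eq_true, List.mem_range] at h
  obtain ⟨⟨⟨hn, hD⟩, hz⟩, hall⟩ := h
  set q := lScale (17 / (20 * n)) p
  set D : ℚ := ((M.den * lDen q : ℕ) : ℚ)
  set z := lNum D q
  have hn' : (0 : ℝ) < n := by exact_mod_cast hn
  have hD' : (0 : ℝ) < D := by exact_mod_cast hD
  set y : ℝ := x * (10 * n) / 17 with hy
  have hy0 : 0 ≤ y := by positivity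
  have hyn : y ≤ n := by rw [hy, div_le_iff₀ (by norm_num)]; nlinarith
  -- the piece that contains `y`; the right end point belongs to the last piece
  obtain ⟨j, hj, hj0, hj1⟩ : ∃ j : ℕ, j < n ∧ (j : ℝ) ≤ y ∧ y ≤ j + 1 := by
    rcases hyn.lt_or_eq with h | h
    · exact ⟨⌊y⌋₊, (Nat.floor_lt hy0).2 h, Nat.floor_le hy0, (Nat.lt_floor_add_one y).le⟩
    · refine ⟨n - 1, by omega, ?_, ?_⟩ <;> rw [h] <;> push_cast [Nat.cast_sub hn] <;> linarith
  have hev : D * ev p x = evInt (lShiftInt (2 * j + 1) z) (2 * y - (2 * j + 1)) := by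
    rw [evInt_lShiftInt, evInt_of_isMul hz, ev_lScale]
    congr 2
    push_cast
    rw [hy]
    field_simp
    ring
  have h2 := abs_evInt_le_sumAbsInt (lShiftInt (2 * j + 1) z) (x := 2 * y - (2 * j + 1))
    (abs_le.2 ⟨by linarith, by linarith⟩)
  have h3 : (sumAbsInt (lShiftInt (2 * j + 1) z) : ℚ) ≤ M * D := by
    have := (Int.cast_le (R := ℚ)).2 (hall j hj)
    exact le_trans (by exact_mod_cast this) (Int.floor_le (M * D))
  have h4 : (sumAbsInt (lShiftInt (2 * j + 1) z) : ℝ) ≤ M * D := by exact_mod_cast h3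
  rw [← hev, abs_mul, abs_of_pos hD'] at h2
  nlinarith

/-! ### The polynomials `g₀`, `J₁`, `J₂` -/

/-- Coefficients of `g₀` in powers of `t - t₀`. -/
def cG : List ℚ :=
  [-(280 / 519), 150 / 1013, 239 / 10331, 110 / 14779, -32 / 9853, 9 / 4397, -16 / 39505, 8 / 49105]

/-- Coefficients of `J₁` in powers of `t - t₀`. -/
def cJ₁ : List ℚ :=
  [1, 0, -9489 / 2932, 1350 / 4721, 359 / 199, -1526 / 3719, -708 / 1633, 503 / 2201, -211 / 6486]

/-- Coefficients of `J₂` in powers of `t - t₀`. -/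
def cJ₂ : List ℚ :=
  [0, 1, -48 / 659797, -2941 / 2730, 675 / 4873, 1832 / 4745, -2305 / 19401, -677 / 14054,
    1573 / 53783, -531 / 128216]

theorem g₀_eq : g₀ = fun t => ev cG (t - t₀) := by
  funext t; simp only [g₀, cG, ev_cons, ev_nil]; push_cast; ring

theorem J₁_eq : J₁ = fun t => ev cJ₁ (t - t₀) := by
  funext t; simp only [J₁, cJ₁, ev_cons, ev_nil]; push_cast; ring

theorem J₂_eq : J₂ = fun t => ev cJ₂ (t - t₀) := by
  funext t; simp only [J₂, cJ₂, ev_cons, ev_nil]; push_cast; ring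

theorem hasDerivAt_ev_sub (p : List ℚ) (t : ℝ) :
    HasDerivAt (fun t => ev p (t - t₀)) (ev (lDer p) (t - t₀)) t :=
  (hasDerivAt_ev p (t - t₀)).comp_sub_const t t₀

theorem deriv_ev_sub (p : List ℚ) :
    deriv (fun t => ev p (t - t₀)) = fun t => ev (lDer p) (t - t₀) :=
  funext fun t => (hasDerivAt_ev_sub p t).deriv

theorem continuous_ev_sub (p : List ℚ) : Continuous fun t => ev p (t - t₀) :=
  continuous_iff_continuousAt.2 fun t => (hasDerivAt_ev_sub p t).continuousAt

theorem abs_ev_sub_le {n : ℕ} {p : List ℚ} {M : ℚ} (h : boundTest n p M = true) {t : ℝ}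
    (ht : t ∈ Set.Icc t₀ 0) : |ev p (t - t₀)| ≤ M := by
  have h1 := ht.1
  have h2 := ht.2
  have h3 : t₀ = -(17 / 10) := rfl
  exact abs_ev_le_of_boundTest h (by linarith) (by linarith)

theorem hasDerivAt_g₀ (t : ℝ) : HasDerivAt g₀ (deriv g₀ t) t := by
  rw [g₀_eq, deriv_ev_sub]; exact hasDerivAt_ev_sub _ t

theorem hasDerivAt_deriv_g₀ (t : ℝ) : HasDerivAt (deriv g₀) (deriv (deriv g₀) t) t := by
  rw [g₀_eq, deriv_ev_sub, deriv_ev_sub]; exact hasDerivAt_ev_sub _ t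

theorem hasDerivAt_J₁ (t : ℝ) : HasDerivAt J₁ (deriv J₁ t) t := by
  rw [J₁_eq, deriv_ev_sub]; exact hasDerivAt_ev_sub _ t

theorem hasDerivAt_deriv_J₁ (t : ℝ) : HasDerivAt (deriv J₁) (deriv (deriv J₁) t) t := by
  rw [J₁_eq, deriv_ev_sub, deriv_ev_sub]; exact hasDerivAt_ev_sub _ t

theorem hasDerivAt_J₂ (t : ℝ) : HasDerivAt J₂ (deriv J₂ t) t := by
  rw [J₂_eq, deriv_ev_sub]; exact hasDerivAt_ev_sub _ t

theorem hasDerivAt_deriv_J₂ (t : ℝ) : HasDerivAt (deriv J₂) (deriv (deriv J₂) t) t := by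
  rw [J₂_eq, deriv_ev_sub, deriv_ev_sub]; exact hasDerivAt_ev_sub _ t

theorem continuous_deriv_deriv_g₀ : Continuous (deriv (deriv g₀)) := by
  rw [g₀_eq, deriv_ev_sub, deriv_ev_sub]; exact continuous_ev_sub _

theorem continuous_deriv_deriv_J₁ : Continuous (deriv (deriv J₁)) := by
  rw [J₁_eq, deriv_ev_sub, deriv_ev_sub]; exact continuous_ev_sub _

theorem continuous_deriv_deriv_J₂ : Continuous (deriv (deriv J₂)) := by
  rw [J₂_eq, deriv_ev_sub, deriv_ev_sub]; exact continuous_ev_sub _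

theorem continuous_g₀ : Continuous g₀ := by rw [g₀_eq]; exact continuous_ev_sub _
theorem continuous_J₁ : Continuous J₁ := by rw [J₁_eq]; exact continuous_ev_sub _
theorem continuous_J₂ : Continuous J₂ := by rw [J₂_eq]; exact continuous_ev_sub _
theorem continuous_deriv_J₁ : Continuous (deriv J₁) := by
  rw [J₁_eq, deriv_ev_sub]; exact continuous_ev_sub _
theorem continuous_deriv_J₂ : Continuous (deriv J₂) := by
  rw [J₂_eq, deriv_ev_sub]; exact continuous_ev_sub _
theorem continuous_W : Continuous W :=
  (continuous_J₁.mul continuous_deriv_J₂).sub (continuous_J₂.mul continuous_deriv_J₁)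

theorem continuous_R : Continuous R := by
  have := continuous_g₀
  have := continuous_deriv_deriv_g₀
  unfold R
  fun_prop

/-- Coefficients of the Wronskian. -/
def cW : List ℚ := lAdd (lMul cJ₁ (lDer cJ₂)) (lSmul (-1) (lMul cJ₂ (lDer cJ₁)))

theorem W_eq (t : ℝ) : W t = ev cW (t - t₀) := by
  simp only [W, J₁_eq, J₂_eq, deriv_ev_sub, cW, ev_lAdd, ev_lMul, ev_lSmul]
  push_cast; ring

theorem abs_add_abs_le {a b c : ℝ} (h₁ : |a + b| ≤ c) (h₂ : |a - b| ≤ c) : |a| + |b| ≤ c := by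
  rcases abs_cases a with h | h <;> rcases abs_cases b with h' | h' <;>
    rcases abs_le.1 h₁ with ⟨_, _⟩ <;> rcases abs_le.1 h₂ with ⟨_, _⟩ <;> linarith

theorem abs_W_sub_one_le {t : ℝ} (ht : t ∈ Set.Icc t₀ 0) : |W t - 1| ≤ 1 / 5000 := by
  have h := abs_ev_sub_le (n := 16) (p := lAdd cW [-1]) (M := 1 / 5000) (by decide +kernel) ht
  rw [ev_lAdd] at h
  rw [W_eq]
  convert h using 2 <;> simp [sub_eq_add_neg]

theorem W_pos {t : ℝ} (ht : t ∈ Set.Icc t₀ 0) : 0 < W t := by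
  have := (abs_le.1 (abs_W_sub_one_le ht)).1; linarith

theorem abs_J₁_le {t : ℝ} (ht : t ∈ Set.Icc t₀ 0) : |J₁ t| ≤ 1181 / 1000 := by
  have h := abs_ev_sub_le (n := 24) (p := cJ₁) (M := 1181 / 1000) (by decide +kernel) ht
  rw [J₁_eq]; convert h using 1; norm_num

theorem abs_J₂_le {t : ℝ} (ht : t ∈ Set.Icc t₀ 0) : |J₂ t| ≤ 416 / 1000 := by
  have h := abs_ev_sub_le (n := 24) (p := cJ₂) (M := 416 / 1000) (by decide +kernel) ht
  rw [J₂_eq]; convert h using 1; norm_num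

theorem abs_deriv_J₁_le {t : ℝ} (ht : t ∈ Set.Icc t₀ 0) : |deriv J₁ t| ≤ 2442 / 1000 := by
  have h := abs_ev_sub_le (n := 24) (p := lDer cJ₁) (M := 2442 / 1000) (by decide +kernel) ht
  rw [J₁_eq, deriv_ev_sub]; convert h using 1; norm_num

theorem abs_deriv_J₂_le {t : ℝ} (ht : t ∈ Set.Icc t₀ 0) : |deriv J₂ t| ≤ 1002 / 1000 := by
  have h := abs_ev_sub_le (n := 64) (p := lDer cJ₂) (M := 1002 / 1000) (by decide +kernel) ht
  rw [J₂_eq, deriv_ev_sub]; convert h using 1; norm_num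

/-- The factors `1/290` and `1/152` are the admissible sizes of `a₁` and `a₂`. -/
theorem abs_J₁_add_abs_J₂_le {t : ℝ} (ht : t ∈ Set.Icc t₀ 0) :
    1 / 290 * |J₁ t| + 1 / 152 * |J₂ t| ≤ 5330 / 1000000 := by
  have h₁ := abs_ev_sub_le (n := 24) (p := lAdd (lSmul (1 / 290) cJ₁) (lSmul (1 / 152) cJ₂))
    (M := 5330 / 1000000) (by decide +kernel) ht
  have h₂ := abs_ev_sub_le (n := 24) (p := lAdd (lSmul (1 / 290) cJ₁) (lSmul (-(1 / 152)) cJ₂))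
    (M := 5330 / 1000000) (by decide +kernel) ht
  rw [ev_lAdd, ev_lSmul, ev_lSmul] at h₁ h₂
  have h := abs_add_abs_le (a := 1 / 290 * J₁ t) (b := 1 / 152 * J₂ t) (c := 5330 / 1000000)
    (by rw [J₁_eq, J₂_eq]; convert h₁ using 2 <;> push_cast <;> ring)
    (by rw [J₁_eq, J₂_eq]; convert h₂ using 2 <;> push_cast <;> ring)
  rwa [abs_mul, abs_mul, abs_of_pos (by norm_num : (0 : ℝ) < 1 / 290),
    abs_of_pos (by norm_num : (0 : ℝ) < 1 / 152)] at h

theorem abs_deriv_J₁_add_abs_deriv_J₂_le {t : ℝ} (ht : t ∈ Set.Icc t₀ 0) :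
    1 / 290 * |deriv J₁ t| + 1 / 152 * |deriv J₂ t| ≤ 1092 / 100000 := by
  have h₁ := abs_ev_sub_le (n := 24)
    (p := lAdd (lSmul (1 / 290) (lDer cJ₁)) (lSmul (1 / 152) (lDer cJ₂)))
    (M := 1092 / 100000) (by decide +kernel) ht
  have h₂ := abs_ev_sub_le (n := 24)
    (p := lAdd (lSmul (1 / 290) (lDer cJ₁)) (lSmul (-(1 / 152)) (lDer cJ₂)))
    (M := 1092 / 100000) (by decide +kernel) ht
  rw [ev_lAdd, ev_lSmul, ev_lSmul] at h₁ h₂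
  have h := abs_add_abs_le (a := 1 / 290 * deriv J₁ t) (b := 1 / 152 * deriv J₂ t)
    (c := 1092 / 100000)
    (by rw [J₁_eq, J₂_eq, deriv_ev_sub, deriv_ev_sub]; convert h₁ using 2 <;> push_cast <;> ring)
    (by rw [J₁_eq, J₂_eq, deriv_ev_sub, deriv_ev_sub]; convert h₂ using 2 <;> push_cast <;> ring)
  rwa [abs_mul, abs_mul, abs_of_pos (by norm_num : (0 : ℝ) < 1 / 290),
    abs_of_pos (by norm_num : (0 : ℝ) < 1 / 152)] at h

/-- From a bound for the numerator `f * W` to one for `f`, since `W` is close to `1`. -/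
theorem abs_le_of_abs_mul_W_le {t f c c' : ℝ} (ht : t ∈ Set.Icc t₀ 0) (h : |f * W t| ≤ c)
    (hc : c ≤ c' * (4999 / 5000)) : |f| ≤ c' := by
  have hW := (abs_le.1 (abs_W_sub_one_le ht)).1
  rw [abs_mul, abs_of_pos (W_pos ht)] at h
  nlinarith [abs_nonneg f]

theorem abs_A_le {t : ℝ} (ht : t ∈ Set.Icc t₀ 0) : |A t| ≤ 8 / 10000 := by
  have h := abs_ev_sub_le (n := 64) (p := lAdd (lMul cJ₂ (lDer (lDer cJ₁)))
    (lSmul (-1) (lMul cJ₁ (lDer (lDer cJ₂))))) (M := 79 / 100000) (by decide +kernel) ht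
  rw [ev_lAdd, ev_lSmul, ev_lMul, ev_lMul] at h
  refine abs_le_of_abs_mul_W_le (c := 79 / 100000) ht ?_ (by norm_num)
  rw [A, div_mul_cancel₀ _ (W_pos ht).ne', J₁_eq, J₂_eq]
  simp only [deriv_ev_sub]
  convert h using 2 <;> push_cast <;> ring

theorem abs_B₁_le {t : ℝ} (ht : t ∈ Set.Icc t₀ 0) : |B₁ t| ≤ 205 / 100000 := by
  have h := abs_ev_sub_le (n := 64) (p := lAdd (lSmul 12 (lMul cG cW))
    (lAdd (lMul (lDer (lDer cJ₂)) (lDer cJ₁)) (lSmul (-1) (lMul (lDer (lDer cJ₁)) (lDer cJ₂)))))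
    (M := 204 / 100000) (by decide +kernel) ht
  simp only [ev_lAdd, ev_lSmul, ev_lMul] at h
  refine abs_le_of_abs_mul_W_le (c := 204 / 100000) ht ?_ (by norm_num)
  rw [B₁, B, add_mul, div_mul_cancel₀ _ (W_pos ht).ne', W_eq, J₁_eq, J₂_eq, g₀_eq]
  simp only [deriv_ev_sub]
  convert h using 2 <;> push_cast <;> ring

theorem abs_R_le {t : ℝ} (ht : t ∈ Set.Icc t₀ 0) : |R t| ≤ 116 / 1000000 := by
  have h := abs_ev_sub_le (n := 64) (p := lAdd (lSmul 6 (lMul cG cG))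
    (lAdd [-(17 / 10), 1] (lSmul (-1) (lDer (lDer cG)))))
    (M := 116 / 1000000) (by decide +kernel) ht
  simp only [ev_lAdd, ev_lSmul, ev_lMul, ev_cons, ev_nil] at h
  rw [R, g₀_eq]
  simp only [deriv_ev_sub]
  convert h using 2
  · push_cast [t₀]; ring
  · norm_num

/-! ### The integral operators `K₁` and `K₂` -/

theorem t₀_neg : t₀ < 0 := by norm_num [t₀]

theorem t₀_mem : t₀ ∈ Set.Icc t₀ 0 := ⟨le_rfl, t₀_neg.le⟩

theorem zero_mem_Icc : (0 : ℝ) ∈ Set.Icc t₀ 0 := ⟨t₀_neg.le, le_rfl⟩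

theorem uIcc_subset {t : ℝ} (ht : t ∈ Set.Icc t₀ 0) : Set.uIcc t₀ t ⊆ Set.Icc t₀ 0 := by
  rw [Set.uIcc_of_le ht.1]; exact Set.Icc_subset_Icc_right ht.2

theorem continuousOn_A : ContinuousOn A (Set.Icc t₀ 0) := by
  have := continuous_J₁
  have := continuous_J₂
  have := continuous_deriv_deriv_J₁
  have := continuous_deriv_deriv_J₂
  exact ContinuousOn.div (by fun_prop) continuous_W.continuousOn fun t ht => (W_pos ht).ne'

theorem continuousOn_B₁ : ContinuousOn B₁ (Set.Icc t₀ 0) := by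
  have := continuous_deriv_J₁
  have := continuous_deriv_J₂
  have := continuous_deriv_deriv_J₁
  have := continuous_deriv_deriv_J₂
  refine (continuous_g₀.const_smul (12 : ℝ)).continuousOn.add ?_
  exact ContinuousOn.div (by fun_prop) continuous_W.continuousOn fun t ht => (W_pos ht).ne'

theorem deriv_deriv_J₁ {t : ℝ} (ht : t ∈ Set.Icc t₀ 0) :
    deriv (deriv J₁) t = -A t * deriv J₁ t - B t * J₁ t := by
  have hW := (W_pos ht).ne'
  have h : W t = J₁ t * deriv J₂ t - J₂ t * deriv J₁ t := rfl
  rw [A, B]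
  field_simp
  rw [h]; ring

theorem deriv_deriv_J₂ {t : ℝ} (ht : t ∈ Set.Icc t₀ 0) :
    deriv (deriv J₂) t = -A t * deriv J₂ t - B t * J₂ t := by
  have hW := (W_pos ht).ne'
  have h : W t = J₁ t * deriv J₂ t - J₂ t * deriv J₁ t := rfl
  rw [A, B]
  field_simp
  rw [h]; ring

theorem deriv_green (s t : ℝ) :
    deriv (fun τ => green s τ) t = (W s)⁻¹ * (deriv J₂ t * J₁ s - deriv J₁ t * J₂ s) :=
  ((((hasDerivAt_J₂ t).mul_const (J₁ s)).sub
    ((hasDerivAt_J₁ t).mul_const (J₂ s))).const_mul (W s)⁻¹).deriv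

theorem abs_inv_W_mul_le {s a b c d α β γ δ M : ℝ} (hs : s ∈ Set.Icc t₀ 0) (ha : |a| ≤ α)
    (hb : |b| ≤ β) (hc : |c| ≤ γ) (hd : |d| ≤ δ) (hM : α * β + γ * δ ≤ M * (4999 / 5000)) :
    |(W s)⁻¹ * (a * b - c * d)| ≤ M := by
  have hW := (abs_le.1 (abs_W_sub_one_le hs)).1
  have hpos := W_pos hs
  have h1 : |a * b - c * d| ≤ α * β + γ * δ := by
    refine (abs_sub _ _).trans ?_
    rw [abs_mul, abs_mul]
    exact add_le_add (mul_le_mul ha hb (abs_nonneg _) ((abs_nonneg _).trans ha))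
      (mul_le_mul hc hd (abs_nonneg _) ((abs_nonneg _).trans hc))
  have hM0 : 0 ≤ M := by nlinarith [abs_nonneg (a * b - c * d)]
  rw [abs_mul, abs_inv, abs_of_pos hpos, inv_mul_le_iff₀ hpos]
  nlinarith

theorem abs_green_le {s t : ℝ} (hs : s ∈ Set.Icc t₀ 0) (ht : t ∈ Set.Icc t₀ 0) :
    |green s t| ≤ 983 / 1000 :=
  abs_inv_W_mul_le hs (abs_J₂_le ht) (abs_J₁_le hs) (abs_J₁_le ht) (abs_J₂_le hs) (by norm_num)

theorem abs_deriv_green_le {s t : ℝ} (hs : s ∈ Set.Icc t₀ 0) (ht : t ∈ Set.Icc t₀ 0) :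
    |deriv (fun τ => green s τ) t| ≤ 22 / 10 := by
  rw [deriv_green]
  exact abs_inv_W_mul_le hs (abs_deriv_J₂_le ht) (abs_J₁_le hs) (abs_deriv_J₁_le ht)
    (abs_J₂_le hs) (by norm_num)

theorem continuousOn_green (t : ℝ) : ContinuousOn (fun s => green s t) (Set.Icc t₀ 0) := by
  have := continuous_J₁
  have := continuous_J₂
  exact (continuous_W.continuousOn.inv₀ fun t ht => (W_pos ht).ne').mul (by fun_prop)

theorem continuousOn_deriv_green (t : ℝ) :
    ContinuousOn (fun s => deriv (fun τ => green s τ) t) (Set.Icc t₀ 0) := by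
  have := continuous_J₁
  have := continuous_J₂
  simp only [deriv_green]
  exact (continuous_W.continuousOn.inv₀ fun t ht => (W_pos ht).ne').mul (by fun_prop)

/-- A common estimate for `K₁` and `K₂`, whose kernels are continuous and bounded. -/
theorem norm_integral_sub_integral_le {k : ℝ → ℝ} {f g : ℝ → ℂ} {C c t : ℝ}
    (hk : ContinuousOn k (Set.Icc t₀ 0)) (hkC : ∀ s ∈ Set.Icc t₀ 0, |k s| ≤ C)
    (hf : ContinuousOn f (Set.Icc t₀ 0)) (hg : ContinuousOn g (Set.Icc t₀ 0))
    (hfg : ∀ s ∈ Set.Icc t₀ 0, ‖f s - g s‖ ≤ c) (ht : t ∈ Set.Icc t₀ 0) :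
    ‖(∫ s in t₀..t, (k s : ℂ) * f s) - ∫ s in t₀..t, (k s : ℂ) * g s‖ ≤ C * c * (17 / 10) := by
  have hsub := uIcc_subset ht
  have hk' : ContinuousOn (fun s => (k s : ℂ)) (Set.Icc t₀ 0) :=
    continuous_ofReal.comp_continuousOn hk
  have hi : ∀ f : ℝ → ℂ, ContinuousOn f (Set.Icc t₀ 0) →
      IntervalIntegrable (fun s => (k s : ℂ) * f s) MeasureTheory.volume t₀ t :=
    fun f hf => ((hk'.mul hf).mono hsub).intervalIntegrable
  rw [← intervalIntegral.integral_sub (hi f hf) (hi g hg)]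
  have hC : 0 ≤ C := (abs_nonneg _).trans (hkC _ t₀_mem)
  have hc : 0 ≤ c := (norm_nonneg _).trans (hfg _ t₀_mem)
  refine (intervalIntegral.norm_integral_le_of_norm_le_const (C := C * c) fun s hs => ?_).trans ?_
  · have hs' := hsub (Set.uIoc_subset_uIcc hs)
    rw [← mul_sub, norm_mul, norm_real]
    exact mul_le_mul (hkC s hs') (hfg s hs') (norm_nonneg _) hC
  · have h1 := ht.1
    have h2 := ht.2
    refine mul_le_mul_of_nonneg_left ?_ (mul_nonneg hC hc)
    rw [abs_of_nonneg (by linarith)]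
    norm_num [t₀] at *; linarith

theorem norm_K₁_sub_le {f g : ℝ → ℂ} {c t : ℝ}
    (hf : ContinuousOn f (Set.Icc t₀ 0)) (hg : ContinuousOn g (Set.Icc t₀ 0))
    (hfg : ∀ s ∈ Set.Icc t₀ 0, ‖f s - g s‖ ≤ c) (ht : t ∈ Set.Icc t₀ 0) :
    ‖K₁ f t - K₁ g t‖ ≤ 983 / 1000 * c * (17 / 10) :=
  norm_integral_sub_integral_le (continuousOn_green t) (fun _ hs => abs_green_le hs ht) hf hg hfg ht

theorem norm_K₂_sub_le {f g : ℝ → ℂ} {c t : ℝ}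
    (hf : ContinuousOn f (Set.Icc t₀ 0)) (hg : ContinuousOn g (Set.Icc t₀ 0))
    (hfg : ∀ s ∈ Set.Icc t₀ 0, ‖f s - g s‖ ≤ c) (ht : t ∈ Set.Icc t₀ 0) :
    ‖K₂ f t - K₂ g t‖ ≤ 22 / 10 * c * (17 / 10) :=
  norm_integral_sub_integral_le (continuousOn_deriv_green t)
    (fun _ hs => abs_deriv_green_le hs ht) hf hg hfg ht

theorem norm_K₁_le {f : ℝ → ℂ} {c t : ℝ} (hf : ContinuousOn f (Set.Icc t₀ 0))
    (hfc : ∀ s ∈ Set.Icc t₀ 0, ‖f s‖ ≤ c) (ht : t ∈ Set.Icc t₀ 0) :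
    ‖K₁ f t‖ ≤ 983 / 1000 * c * (17 / 10) := by
  simpa [K₁] using norm_K₁_sub_le (g := fun _ => 0) hf continuousOn_const (by simpa using hfc) ht

theorem norm_K₂_le {f : ℝ → ℂ} {c t : ℝ} (hf : ContinuousOn f (Set.Icc t₀ 0))
    (hfc : ∀ s ∈ Set.Icc t₀ 0, ‖f s‖ ≤ c) (ht : t ∈ Set.Icc t₀ 0) :
    ‖K₂ f t‖ ≤ 22 / 10 * c * (17 / 10) := by
  simpa [K₂] using norm_K₂_sub_le (g := fun _ => 0) hf continuousOn_const (by simpa using hfc) ht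

/-- The integral of `J f / W`; the argument of the integrand is kept in `[t₀, 0]`, which makes the
integrand continuous on the whole line. -/
def primitive (J : ℝ → ℝ) (f : ℝ → ℂ) (t : ℝ) : ℂ :=
  ∫ s in t₀..t, Set.IccExtend t₀_neg.le
    (fun x : Set.Icc t₀ 0 => ((J x / W x : ℝ) : ℂ) * f x) s

theorem hasDerivAt_primitive {J : ℝ → ℝ} {f : ℝ → ℂ} {t : ℝ} (hJ : Continuous J)
    (hf : ContinuousOn f (Set.Icc t₀ 0)) (ht : t ∈ Set.Icc t₀ 0) :
    HasDerivAt (primitive J f) (((J t / W t : ℝ) : ℂ) * f t) t := by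
  have hc : ContinuousOn (fun x : ℝ => ((J x / W x : ℝ) : ℂ) * f x) (Set.Icc t₀ 0) :=
    (continuous_ofReal.comp_continuousOn (hJ.continuousOn.div continuous_W.continuousOn
      fun t ht => (W_pos ht).ne')).mul hf
  have hc' := (continuousOn_iff_continuous_domRestrict.1 hc).Icc_extend' (h := t₀_neg.le)
  have := hc'.integral_hasStrictDerivAt t₀ t
  refine this.hasDerivAt.congr_deriv ?_
  rw [Set.IccExtend_of_mem _ _ ht]
  rfl

theorem primitive_eq {J : ℝ → ℝ} {f : ℝ → ℂ} {t : ℝ} (ht : t ∈ Set.Icc t₀ 0) :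
    primitive J f t = ∫ s in t₀..t, ((J s / W s : ℝ) : ℂ) * f s :=
  intervalIntegral.integral_congr fun s hs => by
    rw [Set.IccExtend_of_mem _ _ (uIcc_subset ht hs)]

theorem K₁_eq {f : ℝ → ℂ} {t : ℝ} (hf : ContinuousOn f (Set.Icc t₀ 0)) (ht : t ∈ Set.Icc t₀ 0) :
    K₁ f t = J₂ t * primitive J₁ f t - J₁ t * primitive J₂ f t := by
  have hint : ∀ J : ℝ → ℝ, Continuous J →
      IntervalIntegrable (fun s => ((J s / W s : ℝ) : ℂ) * f s) MeasureTheory.volume t₀ t :=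
    fun J hJ => (((continuous_ofReal.comp_continuousOn (hJ.continuousOn.div
      continuous_W.continuousOn fun t ht => (W_pos ht).ne')).mul hf).mono
        (uIcc_subset ht)).intervalIntegrable
  rw [primitive_eq ht, primitive_eq ht, ← intervalIntegral.integral_const_mul,
    ← intervalIntegral.integral_const_mul, ← intervalIntegral.integral_sub
      ((hint J₁ continuous_J₁).const_mul _) ((hint J₂ continuous_J₂).const_mul _)]
  refine intervalIntegral.integral_congr fun s _ => ?_
  simp only [green]
  push_cast
  ring

theorem K₂_eq {f : ℝ → ℂ} {t : ℝ} (hf : ContinuousOn f (Set.Icc t₀ 0)) (ht : t ∈ Set.Icc t₀ 0) :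
    K₂ f t = (deriv J₂ t : ℝ) * primitive J₁ f t - (deriv J₁ t : ℝ) * primitive J₂ f t := by
  have hint : ∀ J : ℝ → ℝ, Continuous J →
      IntervalIntegrable (fun s => ((J s / W s : ℝ) : ℂ) * f s) MeasureTheory.volume t₀ t :=
    fun J hJ => (((continuous_ofReal.comp_continuousOn (hJ.continuousOn.div
      continuous_W.continuousOn fun t ht => (W_pos ht).ne')).mul hf).mono
        (uIcc_subset ht)).intervalIntegrable
  rw [primitive_eq ht, primitive_eq ht, ← intervalIntegral.integral_const_mul,
    ← intervalIntegral.integral_const_mul, ← intervalIntegral.integral_sub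
      ((hint J₁ continuous_J₁).const_mul _) ((hint J₂ continuous_J₂).const_mul _)]
  refine intervalIntegral.integral_congr fun s _ => ?_
  simp only [deriv_green]
  push_cast
  ring

/-- The boundary term of `K₁` vanishes because the Green's function vanishes on the diagonal. -/
theorem hasDerivWithinAt_K₁ {f : ℝ → ℂ} {t : ℝ} (hf : ContinuousOn f (Set.Icc t₀ 0))
    (ht : t ∈ Set.Icc t₀ 0) : HasDerivWithinAt (K₁ f) (K₂ f t) (Set.Icc t₀ 0) t := by
  have h := ((hasDerivAt_J₂ t).ofReal_comp.mul (hasDerivAt_primitive continuous_J₁ hf ht)).sub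
    ((hasDerivAt_J₁ t).ofReal_comp.mul (hasDerivAt_primitive continuous_J₂ hf ht))
  refine (h.hasDerivWithinAt.congr (fun s hs => K₁_eq hf hs) (K₁_eq hf ht)).congr_deriv ?_
  rw [K₂_eq hf ht]
  push_cast
  ring

/-- Together with `hasDerivWithinAt_K₁`: `K₁ f` solves `w'' + A w' + B w = f`. -/
theorem hasDerivWithinAt_K₂ {f : ℝ → ℂ} {t : ℝ} (hf : ContinuousOn f (Set.Icc t₀ 0))
    (ht : t ∈ Set.Icc t₀ 0) :
    HasDerivWithinAt (K₂ f) (f t - A t * K₂ f t - B t * K₁ f t) (Set.Icc t₀ 0) t := by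
  have h := ((hasDerivAt_deriv_J₂ t).ofReal_comp.mul
    (hasDerivAt_primitive continuous_J₁ hf ht)).sub
    ((hasDerivAt_deriv_J₁ t).ofReal_comp.mul (hasDerivAt_primitive continuous_J₂ hf ht))
  refine (h.hasDerivWithinAt.congr (fun s hs => K₂_eq hf hs) (K₂_eq hf ht)).congr_deriv ?_
  have hW : ((deriv J₂ t : ℝ) : ℂ) * ((J₁ t / W t : ℝ) : ℂ)
      - (deriv J₁ t : ℝ) * ((J₂ t / W t : ℝ) : ℂ) = 1 := by
    norm_cast
    have := (W_pos ht).ne'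
    field_simp
    rw [W]; ring
  rw [K₂_eq hf ht, K₁_eq hf ht, deriv_deriv_J₁ ht, deriv_deriv_J₂ ht]
  push_cast at hW ⊢
  linear_combination f t * hW

/-! ### The operator `N` on the disc -/

theorem le_supNorm {f : ℝ → ℂ} (hf : ContinuousOn f (Set.Icc t₀ 0)) {t : ℝ}
    (ht : t ∈ Set.Icc t₀ 0) : ‖f t‖ ≤ supNorm f := by
  obtain ⟨C, hC⟩ := isCompact_Icc.exists_bound_of_continuousOn hf
  exact le_ciSup (f := fun t : Set.Icc t₀ 0 => ‖f t‖)
    ⟨C, by rintro _ ⟨s, rfl⟩; exact hC s s.2⟩ ⟨t, ht⟩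

theorem supNorm_le {f : ℝ → ℂ} {c : ℝ} (h : ∀ t ∈ Set.Icc t₀ 0, ‖f t‖ ≤ c) : supNorm f ≤ c :=
  haveI : Nonempty (Set.Icc t₀ 0) := ⟨⟨t₀, t₀_mem⟩⟩
  ciSup_le fun t => h t t.2

theorem halfNorm_le {d : (ℝ → ℂ) × (ℝ → ℂ)} {c : ℝ} (h₁ : ∀ t ∈ Set.Icc t₀ 0, ‖d.1 t‖ ≤ c)
    (h₂ : ∀ t ∈ Set.Icc t₀ 0, ‖d.2 t‖ ≤ 2 * c) : halfNorm d ≤ c :=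
  max_le (supNorm_le h₁) (by have := supNorm_le h₂; linarith)

theorem norm_fst_le_halfNorm {d : (ℝ → ℂ) × (ℝ → ℂ)} (hd : ContinuousOn d.1 (Set.Icc t₀ 0))
    {t : ℝ} (ht : t ∈ Set.Icc t₀ 0) : ‖d.1 t‖ ≤ halfNorm d :=
  (le_supNorm hd ht).trans (le_max_left _ _)

theorem norm_snd_le_halfNorm {d : (ℝ → ℂ) × (ℝ → ℂ)} (hd : ContinuousOn d.2 (Set.Icc t₀ 0))
    {t : ℝ} (ht : t ∈ Set.Icc t₀ 0) : ‖d.2 t‖ ≤ 2 * halfNorm d := by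
  have h1 := le_supNorm hd ht
  have h2 : 1 / 2 * supNorm d.2 ≤ halfNorm d := le_max_right _ _
  linarith

theorem continuousOn_nonlin {d : (ℝ → ℂ) × (ℝ → ℂ)} (h₁ : ContinuousOn d.1 (Set.Icc t₀ 0))
    (h₂ : ContinuousOn d.2 (Set.Icc t₀ 0)) : ContinuousOn (nonlin d) (Set.Icc t₀ 0) := by
  have hA := continuous_ofReal.comp_continuousOn continuousOn_A
  have hB := continuous_ofReal.comp_continuousOn continuousOn_B₁
  exact ((hA.mul h₂).add (hB.mul h₁)).add (continuousOn_const.mul (h₁.pow 2))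

theorem continuousOn_ofReal_R : ContinuousOn (fun s => (R s : ℂ)) (Set.Icc t₀ 0) :=
  (continuous_ofReal.comp continuous_R).continuousOn

theorem norm_nonlin_sub_le {p q : (ℝ → ℂ) × (ℝ → ℂ)} {s ρ h : ℝ} (hs : s ∈ Set.Icc t₀ 0)
    (hp : ‖p.1 s‖ ≤ ρ) (hq : ‖q.1 s‖ ≤ ρ) (h₁ : ‖p.1 s - q.1 s‖ ≤ h)
    (h₂ : ‖p.2 s - q.2 s‖ ≤ 2 * h) :
    ‖nonlin p s - nonlin q s‖ ≤ (365 / 100000 + 12 * ρ) * h := by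
  have hh : 0 ≤ h := (norm_nonneg _).trans h₁
  have e : nonlin p s - nonlin q s = (A s : ℂ) * (p.2 s - q.2 s) + (B₁ s : ℂ) * (p.1 s - q.1 s)
      + 6 * (p.1 s + q.1 s) * (p.1 s - q.1 s) := by
    simp only [nonlin]; ring
  rw [e]
  refine (norm_add₃_le).trans ?_
  simp only [norm_mul, norm_real, Real.norm_eq_abs]
  have e1 := mul_le_mul (abs_A_le hs) h₂ (norm_nonneg _) (by norm_num)
  have e2 := mul_le_mul (abs_B₁_le hs) h₁ (norm_nonneg _) (by norm_num)
  have e3 := mul_le_mul ((norm_add_le (p.1 s) (q.1 s)).trans (add_le_add hp hq)) h₁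
    (norm_nonneg _) (by linarith [norm_nonneg (p.1 s)])
  have e4 : ‖(6 : ℂ)‖ = 6 := by norm_num
  rw [e4]
  linarith

theorem norm_nonlin_le {d : (ℝ → ℂ) × (ℝ → ℂ)} (hd : d ∈ disc) {s : ℝ} (hs : s ∈ Set.Icc t₀ 0) :
    ‖nonlin d s‖ ≤ 2635 / 10000000 := by
  have h1 := (norm_fst_le_halfNorm hd.1 hs).trans hd.2.2
  have h2 := norm_snd_le_halfNorm hd.2.1 hs
  have h3 := hd.2.2
  simp only [nonlin]
  refine (norm_add₃_le).trans ?_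
  simp only [norm_mul, norm_real, Real.norm_eq_abs, norm_pow]
  have e1 := mul_le_mul (abs_A_le hs) (h2.trans (by linarith : _ ≤ 2 * (1 / 158 : ℝ)))
    (norm_nonneg _) (by norm_num)
  have e2 := mul_le_mul (abs_B₁_le hs) h1 (norm_nonneg _) (by norm_num)
  have e3 := pow_le_pow_left₀ (norm_nonneg _) h1 2
  have e4 : ‖(6 : ℂ)‖ = 6 := by norm_num
  rw [e4]
  linarith

theorem norm_ofReal_R_le {s : ℝ} (hs : s ∈ Set.Icc t₀ 0) : ‖(R s : ℂ)‖ ≤ 116 / 1000000 := by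
  rw [norm_real]; exact abs_R_le hs

theorem norm_K₁_R_add_le {d : (ℝ → ℂ) × (ℝ → ℂ)} (hd : d ∈ disc) {t : ℝ}
    (ht : t ∈ Set.Icc t₀ 0) :
    ‖K₁ (fun s => (R s : ℂ)) t + K₁ (nonlin d) t‖ ≤ 635 / 1000000 := by
  refine (norm_add_le _ _).trans ?_
  have h1 := norm_K₁_le continuousOn_ofReal_R (fun _ hs => norm_ofReal_R_le hs) ht
  have h2 := norm_K₁_le (continuousOn_nonlin hd.1 hd.2.1) (fun _ hs => norm_nonlin_le hd hs) ht
  linarith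

theorem norm_K₂_R_add_le {d : (ℝ → ℂ) × (ℝ → ℂ)} (hd : d ∈ disc) {t : ℝ}
    (ht : t ∈ Set.Icc t₀ 0) :
    ‖K₂ (fun s => (R s : ℂ)) t + K₂ (nonlin d) t‖ ≤ 1420 / 1000000 := by
  refine (norm_add_le _ _).trans ?_
  have h1 := norm_K₂_le continuousOn_ofReal_R (fun _ hs => norm_ofReal_R_le hs) ht
  have h2 := norm_K₂_le (continuousOn_nonlin hd.1 hd.2.1) (fun _ hs => norm_nonlin_le hd hs) ht
  linarith

theorem continuousOn_N_fst (a₁ a₂ : ℂ) {d : (ℝ → ℂ) × (ℝ → ℂ)}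
    (h₁ : ContinuousOn d.1 (Set.Icc t₀ 0)) (h₂ : ContinuousOn d.2 (Set.Icc t₀ 0)) :
    ContinuousOn (N a₁ a₂ d).1 (Set.Icc t₀ 0) := by
  have e1 : Continuous fun t => a₁ * (J₁ t : ℂ) + a₂ * (J₂ t : ℂ) := by
    have := continuous_J₁
    have := continuous_J₂
    fun_prop
  exact (e1.continuousOn.add fun t ht =>
      (hasDerivWithinAt_K₁ continuousOn_ofReal_R ht).continuousWithinAt).add
    fun t ht => (hasDerivWithinAt_K₁ (continuousOn_nonlin h₁ h₂) ht).continuousWithinAt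

theorem continuousOn_N_snd (a₁ a₂ : ℂ) {d : (ℝ → ℂ) × (ℝ → ℂ)}
    (h₁ : ContinuousOn d.1 (Set.Icc t₀ 0)) (h₂ : ContinuousOn d.2 (Set.Icc t₀ 0)) :
    ContinuousOn (N a₁ a₂ d).2 (Set.Icc t₀ 0) := by
  have e1 : Continuous fun t => a₁ * ((deriv J₁ t : ℝ) : ℂ) + a₂ * ((deriv J₂ t : ℝ) : ℂ) := by
    have := continuous_deriv_J₁
    have := continuous_deriv_J₂
    fun_prop
  exact (e1.continuousOn.add fun t ht =>
      (hasDerivWithinAt_K₂ continuousOn_ofReal_R ht).continuousWithinAt).add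
    fun t ht => (hasDerivWithinAt_K₂ (continuousOn_nonlin h₁ h₂) ht).continuousWithinAt

theorem norm_linear_comb_le {a₁ a₂ : ℂ} (h₁ : ‖a₁‖ < 1 / 290) (h₂ : ‖a₂‖ < 1 / 152) {x y c : ℝ}
    (h : 1 / 290 * |x| + 1 / 152 * |y| ≤ c) : ‖a₁ * (x : ℂ) + a₂ * (y : ℂ)‖ ≤ c := by
  refine (norm_add_le _ _).trans (le_trans ?_ h)
  simp only [norm_mul, norm_real, Real.norm_eq_abs]
  exact add_le_add (mul_le_mul_of_nonneg_right h₁.le (abs_nonneg _))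
    (mul_le_mul_of_nonneg_right h₂.le (abs_nonneg _))

/-- The linear part takes up `0.00533` of the radius `1/158 ≈ 0.00633`, the integrals `0.000635`;
for the halved second component the two parts are `0.00546` and `0.00071`. -/
theorem mapsTo_N {a₁ a₂ : ℂ} (h₁ : ‖a₁‖ < 1 / 290) (h₂ : ‖a₂‖ < 1 / 152) :
    Set.MapsTo (N a₁ a₂) disc disc := by
  intro d hd
  refine ⟨continuousOn_N_fst _ _ hd.1 hd.2.1, continuousOn_N_snd _ _ hd.1 hd.2.1,
    halfNorm_le (fun t ht => ?_) fun t ht => ?_⟩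
  · have e1 := norm_linear_comb_le h₁ h₂ (abs_J₁_add_abs_J₂_le ht)
    have e2 := norm_K₁_R_add_le hd ht
    simp only [N, add_assoc (a₁ * _ + _)]
    exact (norm_add_le _ _).trans (by linarith)
  · have e1 := norm_linear_comb_le h₁ h₂ (abs_deriv_J₁_add_abs_deriv_J₂_le ht)
    have e2 := norm_K₂_R_add_le hd ht
    simp only [N, add_assoc (a₁ * _ + _)]
    exact (norm_add_le _ _).trans (by linarith)

theorem halfNorm_N_sub_le (a₁ a₂ : ℂ) {p q : (ℝ → ℂ) × (ℝ → ℂ)} (hp : p ∈ disc) (hq : q ∈ disc) :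
    halfNorm (N a₁ a₂ p - N a₁ a₂ q) ≤ 3 / 20 * halfNorm (p - q) := by
  have c1 : ContinuousOn (p - q).1 (Set.Icc t₀ 0) := hp.1.sub hq.1
  have c2 : ContinuousOn (p - q).2 (Set.Icc t₀ 0) := hp.2.1.sub hq.2.1
  have hn : ∀ s ∈ Set.Icc t₀ 0, ‖nonlin p s - nonlin q s‖ ≤
      (365 / 100000 + 12 * (1 / 158)) * halfNorm (p - q) := fun s hs =>
    norm_nonlin_sub_le hs ((norm_fst_le_halfNorm hp.1 hs).trans hp.2.2)
      ((norm_fst_le_halfNorm hq.1 hs).trans hq.2.2) (norm_fst_le_halfNorm c1 hs)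
      (norm_snd_le_halfNorm c2 hs)
  have np := continuousOn_nonlin hp.1 hp.2.1
  have nq := continuousOn_nonlin hq.1 hq.2.1
  have h0 : 0 ≤ halfNorm (p - q) := (norm_nonneg _).trans (norm_fst_le_halfNorm c1 t₀_mem)
  refine halfNorm_le (fun t ht => ?_) fun t ht => ?_
  · have := norm_K₁_sub_le np nq hn ht
    simp only [N, Prod.mk_sub_mk, Pi.sub_apply, add_sub_add_left_eq_sub]
    linarith
  · have := norm_K₂_sub_le np nq hn ht
    simp only [N, Prod.mk_sub_mk, Pi.sub_apply, add_sub_add_left_eq_sub]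
    linarith

/-- A fixed point of `N` solves the perturbed equation, since
`R + A δ' + B₁ δ + 6 δ² - A δ' - B δ = R + 12 g₀ δ + 6 δ²`. -/
theorem hasDerivWithinAt_of_fixedPoint {a₁ a₂ : ℂ} {d : (ℝ → ℂ) × (ℝ → ℂ)}
    (h₁ : ContinuousOn d.1 (Set.Icc t₀ 0)) (h₂ : ContinuousOn d.2 (Set.Icc t₀ 0))
    (hd₁ : ∀ t ∈ Set.Icc t₀ 0, (N a₁ a₂ d).1 t = d.1 t)
    (hd₂ : ∀ t ∈ Set.Icc t₀ 0, (N a₁ a₂ d).2 t = d.2 t) {t : ℝ} (ht : t ∈ Set.Icc t₀ 0) :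
    HasDerivWithinAt d.1 (d.2 t) (Set.Icc t₀ 0) t ∧
      HasDerivWithinAt d.2 (12 * g₀ t * d.1 t + 6 * d.1 t ^ 2 + R t) (Set.Icc t₀ 0) t := by
  have hn := continuousOn_nonlin h₁ h₂
  constructor
  · have h := (((hasDerivAt_J₁ t).ofReal_comp.const_mul a₁).add
      ((hasDerivAt_J₂ t).ofReal_comp.const_mul a₂)).hasDerivWithinAt (s := Set.Icc t₀ 0)
      |>.add (hasDerivWithinAt_K₁ continuousOn_ofReal_R ht)
      |>.add (hasDerivWithinAt_K₁ hn ht)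
    exact (h.congr (fun s hs => (hd₁ s hs).symm) (hd₁ t ht).symm).congr_deriv (hd₂ t ht)
  · have h := (((hasDerivAt_deriv_J₁ t).ofReal_comp.const_mul a₁).add
      ((hasDerivAt_deriv_J₂ t).ofReal_comp.const_mul a₂)).hasDerivWithinAt (s := Set.Icc t₀ 0)
      |>.add (hasDerivWithinAt_K₂ continuousOn_ofReal_R ht)
      |>.add (hasDerivWithinAt_K₂ hn ht)
    refine (h.congr (fun s hs => (hd₂ s hs).symm) (hd₂ t ht).symm).congr_deriv ?_
    have e1 := hd₁ t ht
    have e2 := hd₂ t ht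
    have e3 : (B₁ t : ℂ) = 12 * g₀ t + B t := by rw [B₁]; push_cast; ring
    simp only [N] at e1 e2
    rw [deriv_deriv_J₁ ht, deriv_deriv_J₂ ht]
    simp only [nonlin] at e1 e2 ⊢
    rw [e3]
    push_cast
    linear_combination -(A t : ℂ) * e2 - (B t : ℂ) * e1

/-- The pair of functions on the line given by a pair of continuous functions on `[t₀, 0]`. The
second component is doubled, so that the maximum norm of the pair corresponds to `halfNorm`. -/
def toPair (d : C(Set.Icc t₀ 0, ℂ) × C(Set.Icc t₀ 0, ℂ)) : (ℝ → ℂ) × (ℝ → ℂ) :=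
  (Set.IccExtend t₀_neg.le d.1, fun t => 2 * Set.IccExtend t₀_neg.le d.2 t)

theorem toPair_fst (d : C(Set.Icc t₀ 0, ℂ) × C(Set.Icc t₀ 0, ℂ)) (t : Set.Icc t₀ 0) :
    (toPair d).1 t = d.1 t := Set.IccExtend_val _ _ t

theorem toPair_snd (d : C(Set.Icc t₀ 0, ℂ) × C(Set.Icc t₀ 0, ℂ)) (t : Set.Icc t₀ 0) :
    (toPair d).2 t = 2 * d.2 t := by
  simp only [toPair]; rw [Set.IccExtend_val]

theorem continuousOn_toPair_fst (d : C(Set.Icc t₀ 0, ℂ) × C(Set.Icc t₀ 0, ℂ)) :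
    ContinuousOn (toPair d).1 (Set.Icc t₀ 0) := (d.1.continuous.Icc_extend').continuousOn

theorem continuousOn_toPair_snd (d : C(Set.Icc t₀ 0, ℂ) × C(Set.Icc t₀ 0, ℂ)) :
    ContinuousOn (toPair d).2 (Set.Icc t₀ 0) :=
  (continuous_const.mul d.2.continuous.Icc_extend').continuousOn

/-- The operator `N` transported to the Banach space of pairs of continuous functions. -/
def opN (a₁ a₂ : ℂ) (d : C(Set.Icc t₀ 0, ℂ) × C(Set.Icc t₀ 0, ℂ)) :
    C(Set.Icc t₀ 0, ℂ) × C(Set.Icc t₀ 0, ℂ) :=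
  (⟨fun t => (N a₁ a₂ (toPair d)).1 t, continuousOn_iff_continuous_domRestrict.1
      (continuousOn_N_fst a₁ a₂ (continuousOn_toPair_fst d) (continuousOn_toPair_snd d))⟩,
   ⟨fun t => 1 / 2 * (N a₁ a₂ (toPair d)).2 t, continuous_const.mul
      (continuousOn_iff_continuous_domRestrict.1
        (continuousOn_N_snd a₁ a₂ (continuousOn_toPair_fst d) (continuousOn_toPair_snd d)))⟩)

theorem toPair_sub (p q : C(Set.Icc t₀ 0, ℂ) × C(Set.Icc t₀ 0, ℂ)) :
    toPair (p - q) = toPair p - toPair q := by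
  refine Prod.ext (funext fun t => ?_) (funext fun t => ?_)
  · simp [toPair, Set.IccExtend]
  · simp [toPair, Set.IccExtend, mul_sub]

theorem halfNorm_toPair_le (d : C(Set.Icc t₀ 0, ℂ) × C(Set.Icc t₀ 0, ℂ)) :
    halfNorm (toPair d) ≤ ‖d‖ := by
  refine halfNorm_le (fun t ht => ?_) fun t ht => ?_
  · rw [toPair_fst d ⟨t, ht⟩]
    exact (d.1.norm_coe_le_norm _).trans (norm_fst_le d)
  · rw [toPair_snd d ⟨t, ht⟩, norm_mul]
    have := (d.2.norm_coe_le_norm ⟨t, ht⟩).trans (norm_snd_le d)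
    norm_num
    exact this

theorem toPair_mem_disc {d : C(Set.Icc t₀ 0, ℂ) × C(Set.Icc t₀ 0, ℂ)} (hd : ‖d‖ ≤ 1 / 158) :
    toPair d ∈ disc :=
  ⟨continuousOn_toPair_fst d, continuousOn_toPair_snd d, (halfNorm_toPair_le d).trans hd⟩

/-- The maximum norm of a pair of continuous functions is bounded by the half norm of any pair of
functions on the line with the corresponding values on `[t₀, 0]`. -/
theorem norm_le_of_halfNorm_le {d : C(Set.Icc t₀ 0, ℂ) × C(Set.Icc t₀ 0, ℂ)}
    {e : (ℝ → ℂ) × (ℝ → ℂ)} {c : ℝ} (h₁ : ContinuousOn e.1 (Set.Icc t₀ 0))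
    (h₂ : ContinuousOn e.2 (Set.Icc t₀ 0)) (he₁ : ∀ t : Set.Icc t₀ 0, d.1 t = e.1 t)
    (he₂ : ∀ t : Set.Icc t₀ 0, d.2 t = 1 / 2 * e.2 t) (h : halfNorm e ≤ c) : ‖d‖ ≤ c := by
  have hc : 0 ≤ c := (norm_nonneg _).trans ((norm_fst_le_halfNorm h₁ t₀_mem).trans h)
  refine max_le ((ContinuousMap.norm_le _ hc).2 fun t => ?_)
    ((ContinuousMap.norm_le _ hc).2 fun t => ?_)
  · rw [he₁]; exact (norm_fst_le_halfNorm h₁ t.2).trans h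
  · rw [he₂, norm_mul]
    have := norm_snd_le_halfNorm h₂ t.2
    norm_num
    linarith

/-- The fixed point is produced by the contraction principle in a closed ball of the Banach space of
pairs of continuous functions. -/
theorem exists_fixedPoint {a₁ a₂ : ℂ} (h₁ : ‖a₁‖ < 1 / 290) (h₂ : ‖a₂‖ < 1 / 152) :
    ∃ d ∈ disc, (∀ t ∈ Set.Icc t₀ 0, (N a₁ a₂ d).1 t = d.1 t) ∧
      ∀ t ∈ Set.Icc t₀ 0, (N a₁ a₂ d).2 t = d.2 t := by
  set s : Set (C(Set.Icc t₀ 0, ℂ) × C(Set.Icc t₀ 0, ℂ)) := Metric.closedBall 0 (1 / 158) with hs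
  have hmem : ∀ d ∈ s, toPair d ∈ disc := fun d hd =>
    toPair_mem_disc (by simpa [hs] using hd)
  have hmaps : Set.MapsTo (opN a₁ a₂) s s := by
    intro d hd
    have h := mapsTo_N h₁ h₂ (hmem d hd)
    rw [hs, mem_closedBall_zero_iff]
    exact norm_le_of_halfNorm_le h.1 h.2.1 (fun _ => rfl) (fun _ => rfl) h.2.2
  have hcontr : ContractingWith (3 / 20) (hmaps.restrict (opN a₁ a₂) s s) := by
    refine ⟨by rw [← NNReal.coe_lt_coe]; norm_num, LipschitzWith.of_dist_le_mul fun p q => ?_⟩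
    rw [Subtype.dist_eq, Subtype.dist_eq, dist_eq_norm, dist_eq_norm]
    have h := halfNorm_N_sub_le a₁ a₂ (hmem p p.2) (hmem q q.2)
    rw [← toPair_sub] at h
    have hp := mapsTo_N h₁ h₂ (hmem p p.2)
    have hq := mapsTo_N h₁ h₂ (hmem q q.2)
    refine norm_le_of_halfNorm_le (e := N a₁ a₂ (toPair p) - N a₁ a₂ (toPair q))
      (hp.1.sub hq.1) (hp.2.1.sub hq.2.1) (fun _ => rfl) (fun t => ?_)
      (h.trans ?_)
    · exact (mul_sub _ _ _).symm
    · push_cast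
      exact mul_le_mul_of_nonneg_left (halfNorm_toPair_le _) (by norm_num)
  obtain ⟨d, hd, hfix, -⟩ := hcontr.exists_fixedPoint' (x := 0)
    Metric.isClosed_closedBall.isComplete hmaps
    (Metric.mem_closedBall_self (by norm_num)) (edist_ne_top _ _)
  refine ⟨toPair d, hmem d hd, fun t ht => ?_, fun t ht => ?_⟩
  · rw [toPair_fst d ⟨t, ht⟩]
    exact congrArg (fun e => e.1 ⟨t, ht⟩) hfix
  · rw [toPair_snd d ⟨t, ht⟩]
    have : 1 / 2 * (N a₁ a₂ (toPair d)).2 t = d.2 ⟨t, ht⟩ := congrArg (fun e => e.2 ⟨t, ht⟩) hfix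
    rw [← this]; ring

/-! ### The Volterra operator from infinity for `w'' + w = f` -/

section Volterra

open MeasureTheory Set

variable {E : Type*} [NormedAddCommGroup E]

theorem integrableOn_Ioi_div_pow (M : ℝ) (n : ℕ) {a : ℝ} (ha : 0 < a) :
    IntegrableOn (fun τ : ℝ => M / τ ^ (n + 2)) (Ioi a) := by
  have h : IntegrableOn (fun τ : ℝ => M * τ ^ (-(n + 2 : ℕ) : ℝ)) (Ioi a) :=
    (integrableOn_Ioi_rpow_of_lt (by push_cast; linarith [n.cast_nonneg (α := ℝ)]) ha).const_mul M
  refine h.congr_fun (fun τ hτ => ?_) measurableSet_Ioi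
  simp only
  rw [Real.rpow_neg (ha.trans hτ).le, Real.rpow_natCast, div_eq_mul_inv]

theorem integral_Ioi_div_pow (M : ℝ) (n : ℕ) {a : ℝ} (ha : 0 < a) :
    ∫ τ in Ioi a, M / τ ^ (n + 2) = M / ((n + 1) * a ^ (n + 1)) := by
  have h : ∫ τ in Ioi a, M / τ ^ (n + 2) = ∫ τ in Ioi a, M * τ ^ (-(n + 2 : ℕ) : ℝ) := by
    refine setIntegral_congr_fun measurableSet_Ioi fun τ hτ => ?_
    rw [Real.rpow_neg (ha.trans hτ).le, Real.rpow_natCast, div_eq_mul_inv]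
  rw [h, integral_const_mul,
    integral_Ioi_rpow_of_lt (by push_cast; linarith [n.cast_nonneg (α := ℝ)]) ha]
  have e : (-(n + 2 : ℕ) : ℝ) + 1 = -((n + 1 : ℕ) : ℝ) := by push_cast; ring
  rw [e, Real.rpow_neg ha.le, Real.rpow_natCast]
  have : (n : ℝ) + 1 ≠ 0 := by positivity
  push_cast
  field_simp

theorem integrableOn_Ioi_of_decay {f : ℝ → E} {M a : ℝ} {n : ℕ} (hf : Continuous f) (ha : 0 < a)
    (h : ∀ τ ≥ a, ‖f τ‖ ≤ M / τ ^ (n + 2)) (b : ℝ) : IntegrableOn f (Ioi b) := by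
  have h1 : IntegrableOn f (Ioi a) :=
    (integrableOn_Ioi_div_pow M n ha).mono' hf.aestronglyMeasurable.restrict
      ((ae_restrict_iff' measurableSet_Ioi).2 (.of_forall fun τ hτ => h τ (le_of_lt hτ)))
  refine ((hf.integrableOn_Icc (a := b) (b := a)).union h1).mono_set fun x hx => ?_
  rcases le_or_gt x a with h | h
  · exact Or.inl ⟨le_of_lt hx, h⟩
  · exact Or.inr h

variable [NormedSpace ℝ E]

/-- The solution `∫_s^∞ sin (τ - s) f(τ) dτ` of `w'' + w = f` that decays at infinity. -/
def volterra (f : ℝ → E) (s : ℝ) : E := ∫ τ in Ioi s, Real.sin (τ - s) • f τ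

/-- The derivative `-∫_s^∞ cos (τ - s) f(τ) dτ` of `volterra f`. -/
def volterraDeriv (f : ℝ → E) (s : ℝ) : E := -∫ τ in Ioi s, Real.cos (τ - s) • f τ

theorem integrableOn_Ioi_smul {f : ℝ → E} {g : ℝ → ℝ} (hf : Continuous f) (hg : Continuous g)
    (hg1 : ∀ x, |g x| ≤ 1) {b : ℝ} (hi : IntegrableOn f (Ioi b)) :
    IntegrableOn (fun τ => g τ • f τ) (Ioi b) :=
  hi.norm.mono' (hg.smul hf).aestronglyMeasurable.restrict (.of_forall fun τ => by
    rw [norm_smul]; exact mul_le_of_le_one_left (norm_nonneg _) (hg1 τ))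

theorem norm_integral_Ioi_smul_le {f : ℝ → E} {g : ℝ → ℝ} {M s : ℝ} {n : ℕ}
    (hg1 : ∀ x, |g x| ≤ 1) (hs : 0 < s) (h : ∀ τ ≥ s, ‖f τ‖ ≤ M / τ ^ (n + 2)) :
    ‖∫ τ in Ioi s, g τ • f τ‖ ≤ M / ((n + 1) * s ^ (n + 1)) := by
  rw [← integral_Ioi_div_pow M n hs]
  refine norm_integral_le_of_norm_le (integrableOn_Ioi_div_pow M n hs)
    ((ae_restrict_iff' measurableSet_Ioi).2 (.of_forall fun τ hτ => ?_))
  rw [norm_smul]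
  exact (mul_le_of_le_one_left (norm_nonneg _) (hg1 τ)).trans (h τ (le_of_lt hτ))

theorem norm_volterra_le {f : ℝ → E} {M s : ℝ} {n : ℕ} (hs : 0 < s)
    (h : ∀ τ ≥ s, ‖f τ‖ ≤ M / τ ^ (n + 2)) : ‖volterra f s‖ ≤ M / ((n + 1) * s ^ (n + 1)) :=
  norm_integral_Ioi_smul_le (fun _ => Real.abs_sin_le_one _) hs h

theorem norm_volterraDeriv_le {f : ℝ → E} {M s : ℝ} {n : ℕ} (hs : 0 < s)
    (h : ∀ τ ≥ s, ‖f τ‖ ≤ M / τ ^ (n + 2)) : ‖volterraDeriv f s‖ ≤ M / ((n + 1) * s ^ (n + 1)) := by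
  rw [volterraDeriv, norm_neg]
  exact norm_integral_Ioi_smul_le (fun _ => Real.abs_cos_le_one _) hs h

theorem volterra_sub {f g : ℝ → E} (hf : Continuous f) (hg : Continuous g)
    (hif : ∀ b, IntegrableOn f (Ioi b)) (hig : ∀ b, IntegrableOn g (Ioi b)) (s : ℝ) :
    volterra f s - volterra g s = volterra (fun τ => f τ - g τ) s := by
  have hc : Continuous fun τ : ℝ => Real.sin (τ - s) := by fun_prop
  simp only [volterra, smul_sub]
  exact (integral_sub
    (integrableOn_Ioi_smul hf hc (fun _ => Real.abs_sin_le_one _) (hif s))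
    (integrableOn_Ioi_smul hg hc (fun _ => Real.abs_sin_le_one _) (hig s))).symm

theorem volterra_eq {f : ℝ → E} (hf : Continuous f) (hi : ∀ b, IntegrableOn f (Ioi b)) (s : ℝ) :
    volterra f s = Real.cos s • (∫ τ in Ioi s, Real.sin τ • f τ)
      - Real.sin s • ∫ τ in Ioi s, Real.cos τ • f τ := by
  have h1 := integrableOn_Ioi_smul hf Real.continuous_sin Real.abs_sin_le_one (hi s)
  have h2 := integrableOn_Ioi_smul hf Real.continuous_cos Real.abs_cos_le_one (hi s)
  have h1' : IntegrableOn (fun τ => Real.cos s • Real.sin τ • f τ) (Ioi s) := h1.smul _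
  have h2' : IntegrableOn (fun τ => Real.sin s • Real.cos τ • f τ) (Ioi s) := h2.smul _
  rw [← integral_smul, ← integral_smul, ← integral_sub h1' h2']
  simp only [volterra, Real.sin_sub, smul_smul, ← sub_smul]
  congr 1; funext τ; congr 1; ring

theorem volterraDeriv_eq {f : ℝ → E} (hf : Continuous f) (hi : ∀ b, IntegrableOn f (Ioi b))
    (s : ℝ) : volterraDeriv f s = -(Real.cos s • (∫ τ in Ioi s, Real.cos τ • f τ)
      + Real.sin s • ∫ τ in Ioi s, Real.sin τ • f τ) := by
  have h1 := integrableOn_Ioi_smul hf Real.continuous_sin Real.abs_sin_le_one (hi s)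
  have h2 := integrableOn_Ioi_smul hf Real.continuous_cos Real.abs_cos_le_one (hi s)
  have h1' : IntegrableOn (fun τ => Real.sin s • Real.sin τ • f τ) (Ioi s) := h1.smul _
  have h2' : IntegrableOn (fun τ => Real.cos s • Real.cos τ • f τ) (Ioi s) := h2.smul _
  rw [← integral_smul, ← integral_smul, ← integral_add h2' h1']
  simp only [volterraDeriv, Real.cos_sub, smul_smul, ← add_smul]
  congr 2; funext τ; congr 1; ring

variable [CompleteSpace E]

theorem hasDerivAt_integral_Ioi {f : ℝ → E} (hf : Continuous f)
    (hi : ∀ b, IntegrableOn f (Ioi b)) (s : ℝ) :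
    HasDerivAt (fun s => ∫ τ in Ioi s, f τ) (-f s) s := by
  have e : (fun s => ∫ τ in Ioi s, f τ) =
      fun s => (∫ τ in Ioi 0, f τ) - ∫ τ in (0 : ℝ)..s, f τ := by
    funext s
    rw [← intervalIntegral.integral_Ioi_sub_Ioi' (hi 0) (hi s)]
    abel
  rw [e]
  exact (hf.integral_hasStrictDerivAt 0 s).hasDerivAt.const_sub _

theorem hasDerivAt_volterra {f : ℝ → E} (hf : Continuous f) (hi : ∀ b, IntegrableOn f (Ioi b))
    (s : ℝ) : HasDerivAt (volterra f) (volterraDeriv f s) s := by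
  have h1 : HasDerivAt (fun s => ∫ τ in Ioi s, Real.sin τ • f τ) (-(Real.sin s • f s)) s :=
    hasDerivAt_integral_Ioi (Real.continuous_sin.smul hf)
    (fun b => integrableOn_Ioi_smul hf Real.continuous_sin Real.abs_sin_le_one (hi b)) s
  have h2 : HasDerivAt (fun s => ∫ τ in Ioi s, Real.cos τ • f τ) (-(Real.cos s • f s)) s :=
    hasDerivAt_integral_Ioi (Real.continuous_cos.smul hf)
    (fun b => integrableOn_Ioi_smul hf Real.continuous_cos Real.abs_cos_le_one (hi b)) s
  rw [funext (volterra_eq hf hi), volterraDeriv_eq hf hi]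
  refine (((Real.hasDerivAt_cos s).smul h1).sub ((Real.hasDerivAt_sin s).smul h2)).congr_deriv ?_
  module

theorem hasDerivAt_volterraDeriv {f : ℝ → E} (hf : Continuous f)
    (hi : ∀ b, IntegrableOn f (Ioi b)) (s : ℝ) :
    HasDerivAt (volterraDeriv f) (f s - volterra f s) s := by
  have h1 : HasDerivAt (fun s => ∫ τ in Ioi s, Real.sin τ • f τ) (-(Real.sin s • f s)) s :=
    hasDerivAt_integral_Ioi (Real.continuous_sin.smul hf)
    (fun b => integrableOn_Ioi_smul hf Real.continuous_sin Real.abs_sin_le_one (hi b)) s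
  have h2 : HasDerivAt (fun s => ∫ τ in Ioi s, Real.cos τ • f τ) (-(Real.cos s • f s)) s :=
    hasDerivAt_integral_Ioi (Real.continuous_cos.smul hf)
    (fun b => integrableOn_Ioi_smul hf Real.continuous_cos Real.abs_cos_le_one (hi b)) s
  rw [funext (volterraDeriv_eq hf hi), volterra_eq hf hi]
  refine ((((Real.hasDerivAt_cos s).smul h2).add
    ((Real.hasDerivAt_sin s).smul h1)).neg).congr_deriv ?_
  have e : (1 : ℝ) • f s = (Real.sin s ^ 2 + Real.cos s ^ 2) • f s := by
    rw [Real.sin_sq_add_cos_sq]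
  rw [one_smul] at e
  rw [eq_sub_iff_add_eq]
  refine Eq.trans ?_ e.symm
  module

end Volterra

/-! ### The decaying correction in the variable `s` -/

/-- With `u = √(x/6) φ(s)` and `s = (24 x)^{5/4} / 30`, the equation `u'' = x - 6 u²` becomes
`φ'' + φ'/s - (4/25) φ/s² = (1 - φ²)/2`; the approximate solution is `φ = 1 + approx`. The constant
`5/2` makes the residual small near the matching point. -/
def approx (s : ℝ) : ℝ := 4 / 25 / (s ^ 2 + 5 / 2)

/-- The derivative of `approx`. -/
def approxDeriv (s : ℝ) : ℝ := -(8 / 25 * s / (s ^ 2 + 5 / 2) ^ 2)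

/-- The residual `φ'' + φ'/s - (4/25) φ/s² - (1 - φ²)/2` of `φ = 1 + approx`. -/
def residual (s : ℝ) : ℝ :=
  (142 / 625 * s ^ 4 - 462 / 125 * s ^ 2 - 133 / 50) / (s ^ 2 * (s ^ 2 + 5 / 2) ^ 3)

theorem hasDerivAt_approx (s : ℝ) : HasDerivAt approx (approxDeriv s) s := by
  have h0 : s ^ 2 + 5 / 2 ≠ 0 := by positivity
  have h := ((hasDerivAt_pow 2 s).add_const (5 / 2)).fun_inv h0 |>.const_mul (4 / 25)
  refine h.congr_deriv ?_
  simp only [approxDeriv]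
  field_simp
  ring

theorem hasDerivAt_approxDeriv {s : ℝ} (hs : 0 < s) :
    HasDerivAt approxDeriv (residual s - approxDeriv s / s + 4 / 25 * (1 + approx s) / s ^ 2
      + (1 - (1 + approx s) ^ 2) / 2) s := by
  have h0 : s ^ 2 + 5 / 2 ≠ 0 := by positivity
  have h := ((hasDerivAt_id s).const_mul (8 / 25)).fun_div
    (((hasDerivAt_pow 2 s).add_const (5 / 2)).fun_pow 2) (pow_ne_zero 2 h0) |>.neg
  refine h.congr_deriv ?_
  simp only [approxDeriv, approx, residual, id]
  field_simp
  ring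

theorem approx_nonneg (s : ℝ) : 0 ≤ approx s := by unfold approx; positivity

theorem approx_add_le {s : ℝ} (hs : 0 < s) : approx s + 9 / 100 / s ^ 2 ≤ 1 / 4 / s ^ 2 := by
  unfold approx
  rw [div_add_div _ _ (by positivity) (by positivity), div_le_div_iff₀ (by positivity)
    (by positivity)]
  nlinarith [pow_pos hs 2, pow_pos hs 4]

theorem sqrt_mul_abs_residual_le {s : ℝ} (hs : 17 / 5 ≤ s) :
    √s * |residual s| ≤ 7 / 100 / s ^ 3 := by
  have hs0 : 0 < s := by linarith
  -- the tangent to the square root at `(10/3)²`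
  have h1 : √s ≤ (9 * s + 100) / 60 := by
    rw [Real.sqrt_le_left (by positivity)]
    nlinarith [sq_nonneg (9 * s - 100)]
  have h2 : |142 / 625 * s ^ 4 - 462 / 125 * s ^ 2 - 133 / 50| * ((9 * s + 100) * s) ≤
      42 / 10 * (s ^ 2 + 5 / 2) ^ 3 := by
    obtain ⟨v, hv, rfl⟩ : ∃ v : ℝ, 0 ≤ v ∧ s = 17 / 5 + v := ⟨s - 17 / 5, by linarith, by ring⟩
    -- after the shift to the end point of the interval all coefficients are positive
    rw [← abs_of_nonneg (by positivity : 0 ≤ (9 * (17 / 5 + v) + 100) * (17 / 5 + v)), ← abs_mul,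
      abs_le]
    constructor <;> rw [← sub_nonneg] <;> ring_nf <;> positivity
  have h3 : |residual s| = |142 / 625 * s ^ 4 - 462 / 125 * s ^ 2 - 133 / 50| /
      (s ^ 2 * (s ^ 2 + 5 / 2) ^ 3) := by
    rw [residual, abs_div, abs_of_pos (by positivity : 0 < s ^ 2 * (s ^ 2 + 5 / 2) ^ 3)]
  refine (mul_le_mul_of_nonneg_right h1 (abs_nonneg _)).trans ?_
  rw [h3, div_mul_div_comm, div_le_div_iff₀ (by positivity) (by positivity)]
  have := mul_le_mul_of_nonneg_right h2 (by positivity : 0 ≤ s ^ 2)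
  linarith

/-- The admissible size `(19/500) / s²` of the correction. It is reproduced by the Volterra
operator: corrections of this size have a right-hand side below `(19/250) / s³`, whose integral over
`[s, ∞)` is again `(19/500) / s²`. -/
def corrBound (s : ℝ) : ℝ := 19 / 500 / s ^ 2

/-- A value cut off at the admissible size. -/
def clamp (s k : ℝ) : ℝ := max (-corrBound s) (min k (corrBound s))

theorem corrBound_nonneg (s : ℝ) : 0 ≤ corrBound s := by unfold corrBound; positivity

theorem abs_clamp_le (s k : ℝ) : |clamp s k| ≤ corrBound s := by
  have := corrBound_nonneg s
  exact abs_le.2 ⟨le_max_left _ _, max_le (by linarith) (min_le_right _ _)⟩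

theorem clamp_of_abs_le {s k : ℝ} (h : |k| ≤ corrBound s) : clamp s k = k := by
  rw [clamp, min_eq_left (abs_le.1 h).2, max_eq_right (abs_le.1 h).1]

theorem abs_clamp_sub_le (s k l : ℝ) : |clamp s k - clamp s l| ≤ |k - l| := by
  refine (abs_max_sub_max_le_max _ _ _ _).trans ?_
  rw [sub_self, abs_zero]
  refine max_le (abs_nonneg _) ((abs_min_sub_min_le_max _ _ _ _).trans ?_)
  rw [sub_self, abs_zero]
  exact max_le le_rfl (abs_nonneg _)

/-- The right-hand side of `k'' + k = …` for `φ = 1 + approx + k / √s`. -/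
def rhs (s k : ℝ) : ℝ :=
  -(approx s + 9 / 100 / s ^ 2) * k - k ^ 2 / (2 * √s) - √s * residual s

theorem abs_rhs_le {s k : ℝ} (hs : 17 / 5 ≤ s) (hk : |k| ≤ corrBound s) :
    |rhs s k| ≤ 19 / 250 / s ^ 3 := by
  have hs0 : 0 < s := by linarith
  have hq : (18 / 10 : ℝ) ≤ √s := Real.le_sqrt_of_sq_le (by linarith)
  have h1 : |-(approx s + 9 / 100 / s ^ 2) * k| ≤ 1 / 4 / s ^ 2 * corrBound s := by
    rw [abs_mul, abs_neg, abs_of_nonneg (add_nonneg (approx_nonneg s) (by positivity))]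
    exact mul_le_mul (approx_add_le hs0) hk (abs_nonneg _) (by positivity)
  have h2 : |k ^ 2 / (2 * √s)| ≤ corrBound s ^ 2 / (36 / 10) := by
    rw [abs_div, abs_pow, abs_of_pos (by positivity : 0 < 2 * √s)]
    exact div_le_div₀ (by positivity) (pow_le_pow_left₀ (abs_nonneg _) hk 2) (by norm_num)
      (by linarith)
  have h3 : |√s * residual s| ≤ 7 / 100 / s ^ 3 := by
    rw [abs_mul, abs_of_nonneg (Real.sqrt_nonneg s)]
    exact sqrt_mul_abs_residual_le hs
  have h4 : |rhs s k| ≤ 1 / 4 / s ^ 2 * corrBound s + corrBound s ^ 2 / (36 / 10)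
      + 7 / 100 / s ^ 3 := by
    unfold rhs
    exact (abs_sub _ _).trans (add_le_add ((abs_sub _ _).trans (add_le_add h1 h2)) h3)
  refine h4.trans ?_
  have e : 1 / 4 / s ^ 2 * corrBound s + corrBound s ^ 2 / (36 / 10)
      + 7 / 100 / s ^ 3
      = (1 / 4 * (19 / 500) / s + (19 / 500) ^ 2 / (36 / 10) / s + 7 / 100) / s ^ 3 := by
    unfold corrBound
    field_simp
  rw [e]
  refine div_le_div_of_nonneg_right ?_ (by positivity)
  have : 1 / s ≤ 5 / 17 := by rw [div_le_div_iff₀ hs0 (by norm_num)]; linarith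
  have e2 : 1 / 4 * (19 / 500) / s + (19 / 500) ^ 2 / (36 / 10) / s + 7 / 100
    = (1 / 4 * (19 / 500) + (19 / 500) ^ 2 / (36 / 10)) * (1 / s) + 7 / 100 := by ring
  rw [e2]
  linarith

theorem abs_rhs_sub_le {s k l : ℝ} (hs : 17 / 5 ≤ s) (hk : |k| ≤ corrBound s)
    (hl : |l| ≤ corrBound s) : |rhs s k - rhs s l| ≤ 3 / 10 / s ^ 2 * |k - l| := by
  have hs0 : 0 < s := by linarith
  have hq : (18 / 10 : ℝ) ≤ √s := Real.le_sqrt_of_sq_le (by linarith)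
  have e : rhs s k - rhs s l = (-(approx s + 9 / 100 / s ^ 2) - (k + l) / (2 * √s)) * (k - l) := by
    unfold rhs; field_simp; ring
  rw [e, abs_mul]
  refine mul_le_mul_of_nonneg_right ?_ (abs_nonneg _)
  refine (abs_sub _ _).trans ?_
  rw [abs_neg, abs_of_nonneg (add_nonneg (approx_nonneg s) (by positivity)), abs_div,
    abs_of_pos (by positivity : 0 < 2 * √s)]
  have h1 : |k + l| / (2 * √s) ≤ (corrBound s + corrBound s) / (36 / 10) :=
    div_le_div₀ (by linarith [corrBound_nonneg s]) ((abs_add_le _ _).trans (add_le_add hk hl))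
      (by norm_num) (by linarith)
  have e2 : (3 / 10 : ℝ) / s ^ 2 = 1 / 4 / s ^ 2 + 1 / 20 / s ^ 2 := by ring
  rw [e2]
  refine add_le_add (approx_add_le hs0) (h1.trans ?_)
  have e3 : (corrBound s + corrBound s) / (36 / 10) = (19 / 900) / s ^ 2 := by
    unfold corrBound; ring
  rw [e3]
  exact div_le_div_of_nonneg_right (by norm_num) (by positivity)

/-- The right-hand side along a function, made continuous on the whole line: the variable is
replaced by `17/5` to the left of that point, and the function is cut off. -/
def source (k : ℝ → ℝ) (s : ℝ) : ℝ :=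
  rhs (max s (17 / 5)) (clamp (max s (17 / 5)) (k s))

theorem continuous_rhs_comp {a b : ℝ → ℝ} (ha : Continuous a) (hb : Continuous b)
    (h : ∀ s, 0 < a s) : Continuous fun s => rhs (a s) (b s) := by
  unfold rhs approx residual
  have h' : ∀ s, 0 < √(a s) := fun s => Real.sqrt_pos.2 (h s)
  fun_prop (disch := intro s; have := h s; have := h' s; positivity)

theorem continuous_source {k : ℝ → ℝ} (hk : Continuous k) : Continuous (source k) := by
  have h1 : Continuous fun s : ℝ => max s (17 / 5 : ℝ) := continuous_id.max continuous_const
  have h0 : ∀ s : ℝ, 0 < max s (17 / 5 : ℝ) := fun s => lt_max_of_lt_right (by norm_num)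
  have h2 : Continuous fun s : ℝ => corrBound (max s (17 / 5 : ℝ)) :=
    continuous_const.div (h1.pow 2) fun s => (pow_pos (h0 s) 2).ne'
  exact continuous_rhs_comp h1 (h2.neg.max (hk.min h2)) h0

theorem abs_source_le (k : ℝ → ℝ) {s : ℝ} (hs : 17 / 5 ≤ s) :
    ‖source k s‖ ≤ 19 / 250 / s ^ (1 + 2) := by
  have := abs_rhs_le hs (abs_clamp_le s (k s))
  rwa [source, max_eq_left hs]

theorem integrableOn_source {k : ℝ → ℝ} (hk : Continuous k) (b : ℝ) :
    MeasureTheory.IntegrableOn (source k) (Set.Ioi b) :=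
  integrableOn_Ioi_of_decay (continuous_source hk) (by norm_num : (0 : ℝ) < 17 / 5)
    (fun _ hs => abs_source_le k hs) b

theorem norm_volterra_source_le (k : ℝ → ℝ) {s : ℝ} (hs : 17 / 5 ≤ s) :
    ‖volterra (source k) s‖ ≤ corrBound s := by
  have := norm_volterra_le (by linarith : 0 < s)
    (fun τ (hτ : τ ≥ s) => abs_source_le k (hs.trans hτ))
  refine this.trans (le_of_eq ?_)
  rw [corrBound]; norm_num; ring

theorem norm_volterraDeriv_source_le (k : ℝ → ℝ) {s : ℝ} (hs : 17 / 5 ≤ s) :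
    ‖volterraDeriv (source k) s‖ ≤ corrBound s := by
  have := norm_volterraDeriv_le (by linarith : 0 < s)
    (fun τ (hτ : τ ≥ s) => abs_source_le k (hs.trans hτ))
  refine this.trans (le_of_eq ?_)
  rw [corrBound]; norm_num; ring

open BoundedContinuousFunction in
/-- The Volterra operator on bounded continuous functions. -/
def opVolterra (k : ℝ →ᵇ ℝ) : ℝ →ᵇ ℝ :=
  ofNormedAddCommGroup (fun s => volterra (source k) (max s (17 / 5)))
    ((continuous_iff_continuousAt.2 fun s => (hasDerivAt_volterra (continuous_source k.continuous)
      (integrableOn_source k.continuous) s).continuousAt).comp (continuous_id.max continuous_const))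
    1 fun s => by
      have hs : (17 / 5 : ℝ) ≤ max s (17 / 5) := le_max_right _ _
      refine (norm_volterra_source_le k hs).trans ?_
      rw [corrBound, div_le_one (by positivity)]
      nlinarith

open BoundedContinuousFunction in
theorem contractingWith_opVolterra : ContractingWith (1 / 2) opVolterra := by
  refine ⟨by rw [← NNReal.coe_lt_coe]; norm_num, LipschitzWith.of_dist_le_mul fun k l => ?_⟩
  refine (dist_le (by positivity)).2 fun s => ?_
  have hs : (17 / 5 : ℝ) ≤ max s (17 / 5) := le_max_right _ _
  set m := max s (17 / 5)
  change dist (volterra (source k) m) (volterra (source l) m) ≤ _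
  rw [dist_eq_norm, volterra_sub (continuous_source k.continuous) (continuous_source l.continuous)
    (integrableOn_source k.continuous) (integrableOn_source l.continuous)]
  refine (norm_volterra_le (n := 0) (M := 3 / 10 * dist k l) (by linarith) fun τ hτ => ?_).trans ?_
  · have hτ' : 17 / 5 ≤ τ := hs.trans hτ
    rw [source, source, max_eq_left hτ', Real.norm_eq_abs]
    refine (abs_rhs_sub_le hτ' (abs_clamp_le _ _) (abs_clamp_le _ _)).trans ?_
    rw [zero_add, mul_div_right_comm]
    refine mul_le_mul_of_nonneg_left ((abs_clamp_sub_le _ _ _).trans ?_) (by positivity)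
    rw [← Real.dist_eq]
    exact dist_coe_le_dist τ
  · have hd : 0 ≤ dist k l := dist_nonneg
    rw [div_le_iff₀ (by positivity)]
    push_cast
    norm_num
    nlinarith

/-- The correction: a solution of `k'' + k = rhs s k` on `[17/5, ∞)` with `k, k' = O(s⁻²)`. -/
theorem exists_correction : ∃ k k' : ℝ → ℝ, (∀ s, HasDerivAt k (k' s) s) ∧
    ∀ s, 17 / 5 ≤ s → HasDerivAt k' (rhs s (k s) - k s) s ∧ |k s| ≤ corrBound s ∧
      |k' s| ≤ corrBound s := by
  set κ := contractingWith_opVolterra.fixedPoint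
  have hfix : opVolterra κ = κ := contractingWith_opVolterra.fixedPoint_isFixedPt
  have hc := continuous_source κ.continuous
  have hi := integrableOn_source κ.continuous
  refine ⟨volterra (source κ), volterraDeriv (source κ), hasDerivAt_volterra hc hi,
    fun s hs => ?_⟩
  have h1 : κ s = volterra (source κ) s := by
    have : (opVolterra κ) s = volterra (source κ) (max s (17 / 5)) := rfl
    rw [max_eq_left hs, hfix] at this
    exact this
  have h2 := norm_volterra_source_le κ hs
  refine ⟨?_, h2, norm_volterraDeriv_source_le κ hs⟩
  have h3 : source κ s = rhs s (volterra (source κ) s) := by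
    rw [← h1] at h2 ⊢
    rw [source, max_eq_left hs, clamp_of_abs_le h2]
  exact h3 ▸ hasDerivAt_volterraDeriv hc hi s

/-! ### The solution of `f'' = 6 f² - x` near infinity -/

/-- A solution `φ` of the equation for the profile, together with its distance from `1 + approx`.
Dividing the correction by `√s` removes the term `φ'/s` from its linearized equation. -/
theorem exists_profile : ∃ φ φ' : ℝ → ℝ, ∀ s, 17 / 5 ≤ s →
    HasDerivAt φ (φ' s) s ∧
    HasDerivAt φ' (-(φ' s / s) + 4 / 25 * φ s / s ^ 2 + (1 - φ s ^ 2) / 2) s ∧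
    |φ s - (1 + approx s)| ≤ corrBound s / √s ∧
    |φ' s - approxDeriv s| ≤ corrBound s / √s * (1 + 1 / (2 * s)) := by
  obtain ⟨k, k', hk, hk'⟩ := exists_correction
  refine ⟨fun s => 1 + approx s + k s / √s,
    fun s => approxDeriv s + (k' s / √s - k s / (2 * s * √s)), fun s hs => ?_⟩
  have hs0 : 0 < s := by linarith
  obtain ⟨hk2, hb, hb'⟩ := hk' s hs
  have hq : 0 < √s := Real.sqrt_pos.2 hs0
  have hqq : √s ^ 2 = s := Real.sq_sqrt hs0.le
  have hsq := Real.hasDerivAt_sqrt hs0.ne'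
  refine ⟨?_, ?_, ?_, ?_⟩
  · have h := ((hasDerivAt_approx s).const_add 1).add ((hk s).fun_div hsq hq.ne')
    refine h.congr_deriv ?_
    rw [hqq]
    field_simp
    rw [hqq]
    ring
  · have h := (hasDerivAt_approxDeriv hs0).add ((hk2.fun_div hsq hq.ne').sub
      ((hk s).fun_div (((hasDerivAt_id s).const_mul 2).fun_mul hsq)
        (by simp only [id]; positivity)))
    refine h.congr_deriv ?_
    simp only [id, rhs]
    generalize √s = w at *
    subst hqq
    field_simp
    ring
  · have e : 1 + approx s + k s / √s - (1 + approx s) = k s / √s := by ring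
    rw [e, abs_div, abs_of_pos hq]
    exact div_le_div_of_nonneg_right hb hq.le
  · have e : approxDeriv s + (k' s / √s - k s / (2 * s * √s)) - approxDeriv s
        = k' s / √s - k s / √s * (1 / (2 * s)) := by field_simp; ring
    rw [e, mul_add, mul_one]
    refine (abs_sub _ _).trans (add_le_add ?_ ?_)
    · rw [abs_div, abs_of_pos hq]
      exact div_le_div_of_nonneg_right hb' hq.le
    · rw [abs_mul, abs_div, abs_of_pos hq, abs_of_pos (by positivity : 0 < 1 / (2 * s))]
      exact mul_le_mul_of_nonneg_right (div_le_div_of_nonneg_right hb hq.le) (by positivity)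

/-- The fourth root of `24 x`. -/
def root (x : ℝ) : ℝ := √√(24 * x)

theorem root_pos {x : ℝ} (hx : 0 < x) : 0 < root x :=
  Real.sqrt_pos.2 (Real.sqrt_pos.2 (by positivity))

theorem root_sq (x : ℝ) : root x ^ 2 = √(24 * x) := Real.sq_sqrt (Real.sqrt_nonneg _)

theorem root_pow_four {x : ℝ} (hx : 0 ≤ x) : root x ^ 4 = 24 * x := by
  rw [show root x ^ 4 = (root x ^ 2) ^ 2 by ring, root_sq, Real.sq_sqrt (by positivity)]

theorem hasDerivAt_root {x : ℝ} (hx : 0 < x) : HasDerivAt root (6 / root x ^ 3) x := by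
  have h1 : 24 * x ≠ 0 := by positivity
  have h2 : √(24 * x) ≠ 0 := (Real.sqrt_pos.2 (by positivity)).ne'
  have h := (((hasDerivAt_id x).const_mul 24).sqrt h1).sqrt h2
  refine h.congr_deriv ?_
  have hp := root_pos hx
  simp only [id]
  rw [← root_sq]
  rw [Real.sqrt_sq hp.le]
  field_simp
  norm_num

/-- The solution `f = -√(x/6) φ(s)`. With `p = root x` one has `√(x/6) = p² / 12` and
`s = p⁵ / 30`. The bound `169/100` is slightly below the matching point `17/10` and still gives
`s ≥ 17/5`; the last two inequalities are the admissible sizes of the matching data. -/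
theorem exists_solution_near_infinity : ∃ f f' : ℝ → ℝ,
    (∀ x, 169 / 100 ≤ x → HasDerivAt f (f' x) x ∧ HasDerivAt f' (6 * f x ^ 2 - x) x ∧
      |f x + √(x / 6)| ≤ 1 / x ^ 2) ∧
    |f (17 / 10) + 280 / 519| < 1 / 290 ∧ |-f' (17 / 10) - 150 / 1013| < 1 / 152 := by
  obtain ⟨φ, φ', hφ⟩ := exists_profile
  refine ⟨fun x => -(root x ^ 2 * φ (root x ^ 5 / 30) / 12),
    fun x => -(φ (root x ^ 5 / 30) / root x ^ 2 + root x ^ 3 * φ' (root x ^ 5 / 30) / 12),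
    fun x hx => ?_, ?_⟩
  · have hx0 : 0 < x := by linarith
    have hp := root_pos hx0
    have hp4 := root_pow_four hx0.le
    have hlow : (2523 / 1000 : ℝ) ≤ root x := by
      by_contra! h
      have := pow_lt_pow_left₀ h hp.le (by norm_num : (4 : ℕ) ≠ 0)
      norm_num [hp4] at this
      linarith
    have hs : 17 / 5 ≤ root x ^ 5 / 30 := by
      have : root x ^ 5 = 24 * x * root x := by rw [← hp4]; ring
      nlinarith
    obtain ⟨d1, d2, hb, -⟩ := hφ _ hs
    have hr := hasDerivAt_root hx0
    have hsx := (hr.fun_pow 5).div_const 30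
    have e1 := d1.comp x hsx
    have e2 := d2.comp x hsx
    refine ⟨?_, ?_, ?_⟩
    · refine ((((hr.fun_pow 2).fun_mul e1).div_const 12).fun_neg).congr_deriv ?_
      simp only [Function.comp]
      field_simp
      norm_num
      ring
    · refine (((e1.fun_div (hr.fun_pow 2) (by positivity)).add
        (((hr.fun_pow 3).fun_mul e2).div_const 12)).fun_neg).congr_deriv ?_
      have : x = root x ^ 4 / 24 := by rw [hp4]; ring
      simp only [Function.comp]
      generalize root x = p at *
      subst this
      field_simp
      norm_num
      ring
    · have hsq : √(x / 6) = root x ^ 2 / 12 := by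
        rw [Real.sqrt_eq_iff_mul_self_eq (by positivity) (by positivity)]
        linear_combination -hp4 / 144
      set s := root x ^ 5 / 30 with hsdef
      have hs0 : 0 < s := by linarith
      have hq : 1 ≤ √s := Real.one_le_sqrt.2 (by linarith)
      have h1 : |φ s - 1| ≤ 1 / 5 / s ^ 2 := by
        have h2 : corrBound s / √s ≤ corrBound s := div_le_self (corrBound_nonneg s) hq
        have h3 : approx s ≤ 4 / 25 / s ^ 2 := by
          unfold approx
          exact div_le_div_of_nonneg_left (by norm_num) (by positivity) (by linarith)
        have h4 : |φ s - 1| ≤ |φ s - (1 + approx s)| + |approx s| := by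
          refine le_trans (le_of_eq ?_) (abs_add_le _ _)
          congr 1; ring
        rw [abs_of_nonneg (approx_nonneg s)] at h4
        have e : (1 : ℝ) / 5 / s ^ 2
            = 4 / 25 / s ^ 2 + 19 / 500 / s ^ 2 + 1 / 500 / s ^ 2 := by ring
        have h5 : 0 ≤ 1 / 500 / s ^ 2 := by positivity
        rw [e]
        unfold corrBound at *
        linarith
      have e : -(root x ^ 2 * φ s / 12) + √(x / 6) = -(root x ^ 2 / 12) * (φ s - 1) := by
        rw [hsq]; ring
      rw [e, abs_mul, abs_neg, abs_of_nonneg (by positivity)]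
      refine (mul_le_mul_of_nonneg_left h1 (by positivity)).trans ?_
      have : x ^ 2 = root x ^ 8 / 576 := by
        rw [show root x ^ 8 = (root x ^ 4) ^ 2 by ring, hp4]; ring
      rw [this, hsdef]
      field_simp
      norm_num
  · have hp := root_pos (by norm_num : (0 : ℝ) < 17 / 10)
    have hp4 := root_pow_four (by norm_num : (0 : ℝ) ≤ 17 / 10)
    beta_reduce
    generalize root (17 / 10) = p at *
    have hp4' : p ^ 4 = 204 / 5 := by rw [hp4]; norm_num
    -- the rest is interval arithmetic for `p` between `2.5273` and `2.5274`
    have hlow : (25273 / 10000 : ℝ) < p :=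
      lt_of_pow_lt_pow_left₀ 4 hp.le (by rw [hp4']; norm_num)
    have hup : p < 25274 / 10000 :=
      lt_of_pow_lt_pow_left₀ 4 (by norm_num) (by rw [hp4']; norm_num)
    have hs : p ^ 5 / 30 = 34 / 25 * p := by
      rw [show p ^ 5 = p ^ 4 * p by ring, hp4']; ring
    rw [hs]
    obtain ⟨-, -, hb, hb'⟩ := hφ (34 / 25 * p) (by linarith)
    -- `√s ≥ 185/100` and `s ≥ 3.437` bound the corrections
    have hq : (185 / 100 : ℝ) ≤ √(34 / 25 * p) := Real.le_sqrt_of_sq_le (by linarith)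
    have hc : corrBound (34 / 25 * p) / √(34 / 25 * p) ≤ 174 / 100000 := by
      have hs2 : (1181 / 100 : ℝ) ≤ (34 / 25 * p) ^ 2 := by nlinarith
      unfold corrBound
      rw [div_le_iff₀ (by positivity), div_le_iff₀ (by positivity)]
      nlinarith
    have hc' : corrBound (34 / 25 * p) / √(34 / 25 * p) * (1 + 1 / (2 * (34 / 25 * p)))
        ≤ 174 / 100000 * (1146 / 1000) := by
      refine mul_le_mul hc ?_ (by positivity) (by norm_num)
      have : 1 / (2 * (34 / 25 * p)) ≤ 146 / 1000 := by
        rw [div_le_iff₀ (by positivity)]; linarith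
      linarith
    replace hb := hb.trans hc
    replace hb' := hb'.trans hc'
    generalize φ (34 / 25 * p) = a at *
    generalize φ' (34 / 25 * p) = b at *
    have hP : p ^ 2 * p ^ 2 = 204 / 5 := by rw [← hp4']; ring
    have hP1 : (63874 / 10000 : ℝ) < p ^ 2 := by nlinarith [sq_nonneg p]
    have hP2 : p ^ 2 < 63875 / 10000 := by nlinarith [sq_nonneg p]
    have hS1 : (143141 / 10000 : ℝ) < (34 / 25 * p) ^ 2 + 5 / 2 := by linarith
    have hS2 : (34 / 25 * p) ^ 2 + 5 / 2 < 143145 / 10000 := by linarith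
    have ha1 : (1117 / 100000 : ℝ) ≤ approx (34 / 25 * p) := by
      rw [approx, le_div_iff₀ (by positivity)]; linarith
    have ha2 : approx (34 / 25 * p) ≤ 1118 / 100000 := by
      rw [approx, div_le_iff₀ (by positivity)]; linarith
    have hd1 : -(537 / 100000 : ℝ) ≤ approxDeriv (34 / 25 * p) := by
      rw [approxDeriv, neg_le_neg_iff, div_le_iff₀ (by positivity)]; nlinarith
    have hd2 : approxDeriv (34 / 25 * p) ≤ -(536 / 100000) := by
      rw [approxDeriv, neg_le_neg_iff, le_div_iff₀ (by positivity)]; nlinarith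
    obtain ⟨hb1, hb2⟩ := abs_le.1 hb
    obtain ⟨hb3, hb4⟩ := abs_le.1 hb'
    have a1 : (100943 / 100000 : ℝ) ≤ a := by linarith
    have a2 : a ≤ 101292 / 100000 := by linarith
    have b1 : (3365 / 1000000 : ℝ) ≤ -b := by linarith
    have b2 : -b ≤ 7365 / 1000000 := by linarith
    have hp3 : p ^ 3 = p ^ 2 * p := by ring
    have hp31 : (16142 / 1000 : ℝ) ≤ p ^ 3 := by rw [hp3]; nlinarith
    have hp32 : p ^ 3 ≤ 16144 / 1000 := by rw [hp3]; nlinarith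
    have m1 : (63874 / 10000 : ℝ) * (100943 / 100000) ≤ p ^ 2 * a :=
      mul_le_mul hP1.le a1 (by norm_num) (by positivity)
    have m2 : p ^ 2 * a ≤ 63875 / 10000 * (101292 / 100000) :=
      mul_le_mul hP2.le a2 (by linarith) (by norm_num)
    have m3 : (16142 / 1000 : ℝ) * (3365 / 1000000) ≤ p ^ 3 * -b :=
      mul_le_mul hp31 b1 (by norm_num) (by positivity)
    have m4 : p ^ 3 * -b ≤ 16144 / 1000 * (7365 / 1000000) :=
      mul_le_mul hp32 b2 (by linarith) (by norm_num)
    have m5 : (15803 / 100000 : ℝ) ≤ a / p ^ 2 := by rw [le_div_iff₀ (by positivity)]; linarith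
    have m6 : a / p ^ 2 ≤ 15859 / 100000 := by rw [div_le_iff₀ (by positivity)]; linarith
    constructor <;> rw [abs_lt] <;> constructor <;> linarith

/-! ### Local holomorphic solutions -/

section PowerSeries

variable {a : ℕ → ℂ} {M ρ : ℝ}

theorem norm_succ_mul_le (ha : ∀ n, ‖a n‖ ≤ M * ρ ^ n) (n : ℕ) :
    ‖((n : ℂ) + 1) * a (n + 1)‖ ≤ M * ρ * (2 * ρ) ^ n := by
  have h1 : ((n : ℝ) + 1) ≤ 2 ^ n := by exact_mod_cast Nat.lt_two_pow_self (n := n)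
  have h2 : ‖((n : ℂ) + 1)‖ = (n : ℝ) + 1 := by
    rw [← Nat.cast_succ, norm_natCast, Nat.cast_succ]
  rw [norm_mul, h2]
  calc ((n : ℝ) + 1) * ‖a (n + 1)‖ ≤ 2 ^ n * (M * ρ ^ (n + 1)) :=
        mul_le_mul h1 (ha _) (norm_nonneg _) (by positivity)
    _ = _ := by rw [mul_pow]; ring

theorem norm_mul_pow_le (hρ : 0 < ρ) (ha : ∀ n, ‖a n‖ ≤ M * ρ ^ n) {z : ℂ}
    (hz : ‖z‖ ≤ 1 / (2 * ρ)) (n : ℕ) : ‖a n * z ^ n‖ ≤ M * (1 / 2) ^ n := by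
  rw [norm_mul, norm_pow]
  have hM : 0 ≤ M := by simpa using (norm_nonneg _).trans (ha 0)
  calc ‖a n‖ * ‖z‖ ^ n ≤ M * ρ ^ n * (1 / (2 * ρ)) ^ n :=
        mul_le_mul (ha n) (pow_le_pow_left₀ (norm_nonneg _) hz n) (by positivity) (by positivity)
    _ = _ := by rw [mul_assoc, ← mul_pow]; congr 2; field_simp

theorem summable_norm_mul_pow (hρ : 0 < ρ) (ha : ∀ n, ‖a n‖ ≤ M * ρ ^ n) {z : ℂ}
    (hz : ‖z‖ ≤ 1 / (2 * ρ)) : Summable fun n => ‖a n * z ^ n‖ :=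
  Summable.of_nonneg_of_le (fun _ => norm_nonneg _) (norm_mul_pow_le hρ ha hz)
    (summable_geometric_two.mul_left M)

theorem hasDerivAt_tsum_mul_pow (hρ : 0 < ρ) (ha : ∀ n, ‖a n‖ ≤ M * ρ ^ n) {z : ℂ}
    (hz : ‖z‖ < 1 / (4 * ρ)) :
    HasDerivAt (fun z => ∑' n, a n * z ^ n) (∑' n : ℕ, ((n : ℂ) + 1) * a (n + 1) * z ^ n) z := by
  have hz0 : (0 : ℂ) ∈ Metric.ball (0 : ℂ) (1 / (4 * ρ)) := Metric.mem_ball_self (by positivity)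
  have hr : (1 : ℝ) / (4 * ρ) = 1 / (2 * (2 * ρ)) := by ring
  have key : HasDerivAt (fun z => ∑' n, a (n + 1) * z ^ (n + 1))
      (∑' n : ℕ, ((n : ℂ) + 1) * a (n + 1) * z ^ n) z := by
    refine hasDerivAt_tsum_of_isPreconnected (𝕜 := ℂ) (F := ℂ)
      (g := fun n z => a (n + 1) * z ^ (n + 1))
      (g' := fun n z => ((n : ℂ) + 1) * a (n + 1) * z ^ n) (t := Metric.ball (0 : ℂ) (1 / (4 * ρ)))
      (u := fun n => M * ρ * (1 / 2) ^ n) (summable_geometric_two.mul_left _) Metric.isOpen_ball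
      (convex_ball (0 : ℂ) _).isPreconnected (fun n y _ => ?_) (fun n y hy => ?_) hz0 ?_
      (mem_ball_zero_iff.2 hz)
    · refine ((hasDerivAt_pow (n + 1) y).const_mul (a (n + 1))).congr_deriv ?_
      push_cast
      ring
    · exact norm_mul_pow_le (a := fun n => ((n : ℂ) + 1) * a (n + 1)) (by positivity)
        (norm_succ_mul_le ha) (hr ▸ (mem_ball_zero_iff.1 hy).le) n
    · simp
  have hle : (1 : ℝ) / (4 * ρ) ≤ 1 / (2 * ρ) :=
    one_div_le_one_div_of_le (by positivity) (by linarith)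
  refine (key.const_add (a 0)).congr_of_eventuallyEq ?_
  filter_upwards [Metric.isOpen_ball.mem_nhds (mem_ball_zero_iff.2 hz)] with w hw
  have := (summable_norm_mul_pow hρ ha ((mem_ball_zero_iff.1 hw).le.trans hle)).of_norm
  rw [this.tsum_eq_zero_add]
  simp

end PowerSeries

/-- The Taylor coefficients at `c` of the solution of `F'' = 6 F² - z` with `F c = a`,
`F' c = b`. -/
def coeff (c a b : ℂ) : ℕ → ℂ
  | 0 => a
  | 1 => b
  | n + 2 => (6 * ∑ k : Fin (n + 1), coeff c a b k * coeff c a b (n - k)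
      - if n = 0 then c else if n = 1 then 1 else 0) / ((n + 1) * (n + 2))

theorem coeff_succ_succ (c a b : ℂ) (n : ℕ) :
    ((n : ℂ) + 1) * ((n + 1 : ℂ) + 1) * coeff c a b (n + 2)
    = 6 * ∑ k ∈ Finset.range (n + 1), coeff c a b k * coeff c a b (n - k)
      - if n = 0 then c else if n = 1 then 1 else 0 := by
  rw [coeff, Finset.sum_range]
  have h1 : (n : ℂ) + 1 ≠ 0 := by exact_mod_cast n.succ_ne_zero
  have h2 : (n : ℂ) + 2 ≠ 0 := by exact_mod_cast (n + 1).succ_ne_zero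
  have h3 : (n : ℂ) + 1 + 1 = n + 2 := by ring
  rw [h3, mul_div_cancel₀ _ (mul_ne_zero h1 h2)]

/-- A majorant for the Taylor coefficients. In the recursion the `n + 1` terms of the convolution
have the common bound `M² ρⁿ`, and the factor `n + 1` is absorbed by the denominator. -/
theorem norm_coeff_le (c a b : ℂ) {M ρ : ℝ} (hM : 1 ≤ M) (hρ : 1 ≤ ρ) (ha : ‖a‖ ≤ M)
    (hb : ‖b‖ ≤ M) (h : 3 * M ^ 2 + ‖c‖ + 1 ≤ M * ρ ^ 2) (n : ℕ) :
    ‖coeff c a b n‖ ≤ M * ρ ^ n := by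
  induction n using Nat.strong_induction_on with
  | _ n ih =>
    match n with
    | 0 => simpa [coeff] using ha
    | 1 =>
      simp only [coeff, pow_one]
      exact hb.trans (le_mul_of_one_le_right (by linarith) hρ)
    | n + 2 =>
      have e := coeff_succ_succ c a b n
      have hpos : (0 : ℝ) < ((n : ℝ) + 1) * (n + 2) := by positivity
      have hn : ‖((n : ℂ) + 1) * ((n + 1 : ℂ) + 1)‖ = ((n : ℝ) + 1) * (n + 2) := by
        have : ((n : ℂ) + 1) * ((n + 1 : ℂ) + 1) = (((n + 1) * (n + 2) : ℕ) : ℂ) := by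
          push_cast; ring
        rw [this, norm_natCast]; push_cast; ring
      have hsum : ‖∑ k ∈ Finset.range (n + 1), coeff c a b k * coeff c a b (n - k)‖
          ≤ (n + 1) * (M ^ 2 * ρ ^ n) := by
        refine (norm_sum_le_of_le _ (f := fun k => coeff c a b k * coeff c a b (n - k))
          (n := fun _ => M ^ 2 * ρ ^ n) fun k hk => ?_).trans ?_
        · have hk' : k ≤ n := Nat.lt_succ_iff.1 (Finset.mem_range.1 hk)
          rw [norm_mul]
          refine (mul_le_mul (ih k (by omega)) (ih (n - k) (by omega)) (norm_nonneg _)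
            (by positivity)).trans (le_of_eq ?_)
          rw [show M * ρ ^ k * (M * ρ ^ (n - k)) = M ^ 2 * (ρ ^ k * ρ ^ (n - k)) by ring,
            ← pow_add, Nat.add_sub_cancel' hk']
        · rw [Finset.sum_const, Finset.card_range, nsmul_eq_mul]
          push_cast
          exact le_rfl
      have hite : ‖(if n = 0 then c else if n = 1 then 1 else 0 : ℂ)‖ ≤ ‖c‖ + 1 := by
        split_ifs
        · linarith
        · rw [norm_one]; linarith [norm_nonneg c]
        · rw [norm_zero]; linarith [norm_nonneg c]
      have h6 : ‖((n : ℂ) + 1) * ((n + 1 : ℂ) + 1) * coeff c a b (n + 2)‖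
          ≤ 6 * ((n + 1) * (M ^ 2 * ρ ^ n)) + (‖c‖ + 1) := by
        rw [e]
        refine (norm_sub_le _ _).trans (add_le_add ?_ hite)
        rw [norm_mul]
        have : ‖(6 : ℂ)‖ = 6 := by norm_num
        rw [this]
        exact mul_le_mul_of_nonneg_left hsum (by norm_num)
      rw [norm_mul, hn] at h6
      have hρn : 1 ≤ ρ ^ n := one_le_pow₀ hρ
      have hn0 : (0 : ℝ) ≤ n := n.cast_nonneg
      -- `6 / (n + 2) ≤ 3` and `1 / ((n + 1) (n + 2)) ≤ 1`
      have h7 : 6 * ((n + 1) * (M ^ 2 * ρ ^ n)) + (‖c‖ + 1)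
          ≤ ((n : ℝ) + 1) * (n + 2) * (M * ρ ^ (n + 2)) := by
        have h8 : ρ ^ n * (3 * M ^ 2 + ‖c‖ + 1) ≤ M * ρ ^ (n + 2) := by
          rw [pow_add]
          nlinarith
        have h9 : ((n : ℝ) + 1) * (n + 2) * (ρ ^ n * (3 * M ^ 2 + ‖c‖ + 1))
            ≤ ((n : ℝ) + 1) * (n + 2) * (M * ρ ^ (n + 2)) :=
          mul_le_mul_of_nonneg_left h8 hpos.le
        have h10 : 0 ≤ ((n : ℝ) + 1) * n * (3 * (M ^ 2 * ρ ^ n)) := by positivity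
        have h11 : (1 : ℝ) * (‖c‖ + 1) ≤ ((n : ℝ) + 1) * (n + 2) * (ρ ^ n) * (‖c‖ + 1) := by
          refine mul_le_mul_of_nonneg_right ?_ (by positivity)
          nlinarith [mul_nonneg hn0 hn0]
        linarith
      exact le_of_mul_le_mul_left (h6.trans h7) hpos

/-- The initial value problem for `F'' = 6 F² - z` has a holomorphic solution near `c`. -/
theorem exists_local_solution (c a b : ℂ) : ∃ r > 0, ∃ F F' : ℂ → ℂ, F c = a ∧ F' c = b ∧
    ∀ z ∈ Metric.ball c r, HasDerivAt F (F' z) z ∧ HasDerivAt F' (6 * F z ^ 2 - z) z := by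
  set M : ℝ := 1 + ‖a‖ + ‖b‖
  set ρ : ℝ := 3 * M + ‖c‖ + 1
  have hM : 1 ≤ M := by simp only [M]; linarith [norm_nonneg a, norm_nonneg b]
  have hρ : 1 ≤ ρ := by simp only [ρ]; linarith [norm_nonneg c]
  have hρ0 : 0 < ρ := by linarith
  have hbound : 3 * M ^ 2 + ‖c‖ + 1 ≤ M * ρ ^ 2 := by
    have h1 : ρ ≤ ρ ^ 2 := by nlinarith
    have h2 : M * ρ ≤ M * ρ ^ 2 := mul_le_mul_of_nonneg_left h1 (by linarith)
    have h3 : M * ρ = 3 * M ^ 2 + M * (‖c‖ + 1) := by simp only [ρ]; ring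
    nlinarith [norm_nonneg c]
  have hco := norm_coeff_le c a b hM hρ (by simp only [M]; linarith [norm_nonneg b])
    (by simp only [M]; linarith [norm_nonneg a]) hbound
  set α := coeff c a b
  set β : ℕ → ℂ := fun n => ((n : ℂ) + 1) * α (n + 1)
  have hβ : ∀ n, ‖β n‖ ≤ M * ρ * (2 * ρ) ^ n := norm_succ_mul_le hco
  refine ⟨1 / (8 * ρ), by positivity, fun z => ∑' n, α n * (z - c) ^ n,
    fun z => ∑' n, β n * (z - c) ^ n, ?_, ?_, fun z hz => ?_⟩
  · simp only [sub_self]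
    rw [tsum_eq_single 0 fun n hn => by rw [zero_pow hn, mul_zero]]
    simp [α, coeff]
  · simp only [sub_self]
    rw [tsum_eq_single 0 fun n hn => by rw [zero_pow hn, mul_zero]]
    simp [α, β, coeff]
  · have hz' : ‖z - c‖ < 1 / (8 * ρ) := mem_ball_iff_norm.1 hz
    have hz4 : ‖z - c‖ < 1 / (4 * ρ) :=
      hz'.trans_le (one_div_le_one_div_of_le (by positivity) (by linarith))
    have hz2 : ‖z - c‖ ≤ 1 / (2 * ρ) :=
      hz'.le.trans (one_div_le_one_div_of_le (by positivity) (by linarith))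
    refine ⟨(hasDerivAt_tsum_mul_pow hρ0 hco hz4).comp_sub_const z c, ?_⟩
    have h2 := (hasDerivAt_tsum_mul_pow (by positivity) hβ
      (by rw [show 4 * (2 * ρ) = 8 * ρ by ring]; exact hz')).comp_sub_const z c
    refine h2.congr_deriv ?_
    set w := z - c
    have hs := summable_norm_mul_pow hρ0 hco hz2
    have hprod := tsum_mul_tsum_eq_tsum_sum_range_of_summable_norm hs hs
    have hsum := summable_norm_sum_mul_range_of_summable_norm hs hs
    have hite : HasSum (fun n : ℕ => (if n = 0 then c else if n = 1 then 1 else 0) * w ^ n)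
        (c + w) := by
      have := hasSum_sum_of_ne_finset_zero (L := SummationFilter.unconditional ℕ)
        (s := Finset.range 2)
        (f := fun n : ℕ => (if n = 0 then c else if n = 1 then 1 else 0) * w ^ n) fun n hn => by
          have : n ≠ 0 ∧ n ≠ 1 := by
            constructor <;> rintro rfl <;> simp at hn
          simp [this.1, this.2]
      simpa [Finset.sum_range_succ] using this
    have hz : z = c + w := by simp [w]
    rw [pow_two, hprod, hz, ← ((hsum.of_norm.hasSum.mul_left 6).sub hite).tsum_eq]
    refine tsum_congr fun n => ?_
    have e := coeff_succ_succ c a b n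
    have e1 : ((n : ℂ) + 1) * β (n + 1) = ((n : ℂ) + 1) * ((n + 1 : ℂ) + 1) * α (n + 2) := by
      simp only [β]; push_cast; ring
    rw [e1, e, sub_mul, mul_assoc, Finset.sum_mul]
    congr 2
    refine Finset.sum_congr rfl fun k hk => ?_
    have hk' : k ≤ n := Nat.lt_succ_iff.1 (Finset.mem_range.1 hk)
    have : w ^ n = w ^ k * w ^ (n - k) := by rw [← pow_add, Nat.add_sub_cancel' hk']
    rw [this]; ring

/-! ### Uniqueness for linear equations and holomorphic extension of real solutions -/

/-- A solution of `w'' = q w` on an interval that vanishes to first order at a point is zero. -/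
theorem eq_zero_of_linear_ode {w w' q : ℝ → ℂ} {a b c : ℝ} (hc : c ∈ Set.Icc a b)
    (hq : ContinuousOn q (Set.Icc a b))
    (hw : ∀ t ∈ Set.Icc a b, HasDerivWithinAt w (w' t) (Set.Icc a b) t)
    (hw' : ∀ t ∈ Set.Icc a b, HasDerivWithinAt w' (q t * w t) (Set.Icc a b) t)
    (h0 : w c = 0) (h0' : w' c = 0) : ∀ t ∈ Set.Icc a b, w t = 0 ∧ w' t = 0 := by
  obtain ⟨C, hC⟩ := isCompact_Icc.exists_bound_of_continuousOn hq
  set K : NNReal := ⟨max 1 C, le_max_of_le_left zero_le_one⟩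
  set v : ℝ → ℂ × ℂ → ℂ × ℂ := fun t p => (p.2, q t * p.1)
  have hv : ∀ t ∈ Set.Icc a b, LipschitzOnWith K (v t) Set.univ := fun t ht => by
    refine LipschitzOnWith.of_dist_le_mul fun p _ r _ => ?_
    have e1 : dist p.2 r.2 ≤ dist p r := le_max_right _ _
    have e2 : dist p.1 r.1 ≤ dist p r := le_max_left _ _
    have e3 : (1 : ℝ) ≤ K := le_max_left _ _
    have e4 : C ≤ K := le_max_right _ _
    refine max_le (e1.trans (le_mul_of_one_le_left dist_nonneg e3)) ?_
    change dist (q t * p.1) (q t * r.1) ≤ _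
    rw [dist_eq_norm, ← mul_sub, norm_mul, ← dist_eq_norm]
    exact mul_le_mul ((hC t ht).trans e4) e2 dist_nonneg K.2
  have hf : ∀ t ∈ Set.Icc a b,
      HasDerivWithinAt (fun t => (w t, w' t)) (v t (w t, w' t)) (Set.Icc a b) t :=
    fun t ht => (hw t ht).prodMk (hw' t ht)
  have hfc : ContinuousOn (fun t => (w t, w' t)) (Set.Icc a b) :=
    fun t ht => (hf t ht).continuousWithinAt
  have hz : ∀ t : ℝ, ∀ s : Set ℝ,
      HasDerivWithinAt (fun _ => ((0, 0) : ℂ × ℂ)) (v t (0, 0)) s t := fun t s => by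
    have : v t (0, 0) = 0 := by simp [v]
    rw [this]
    exact hasDerivWithinAt_const _ _ _
  have hr : Set.EqOn (fun t => (w t, w' t)) (fun _ => (0, 0)) (Set.Icc c b) := by
    refine ODE_solution_unique_of_mem_Icc_right (v := v) (s := fun _ => Set.univ) (K := K)
      (fun t ht => hv t ⟨hc.1.trans ht.1, ht.2.le⟩)
      (hfc.mono (Set.Icc_subset_Icc_left hc.1)) (fun t ht => ?_) (fun _ _ => Set.mem_univ _)
      continuousOn_const (fun t _ => hz t _) (fun _ _ => Set.mem_univ _) (by simp [h0, h0'])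
    refine (hf t ⟨hc.1.trans ht.1, ht.2.le⟩).mono_of_mem_nhdsWithin ?_
    exact mem_of_superset (Icc_mem_nhdsGE ht.2) (Set.Icc_subset_Icc_left (hc.1.trans ht.1))
  have hl : Set.EqOn (fun t => (w t, w' t)) (fun _ => (0, 0)) (Set.Icc a c) := by
    refine ODE_solution_unique_of_mem_Icc_left (v := v) (s := fun _ => Set.univ) (K := K)
      (fun t ht => hv t ⟨ht.1.le, ht.2.trans hc.2⟩)
      (hfc.mono (Set.Icc_subset_Icc_right hc.2)) (fun t ht => ?_) (fun _ _ => Set.mem_univ _)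
      continuousOn_const (fun t _ => hz t _) (fun _ _ => Set.mem_univ _) (by simp [h0, h0'])
    refine (hf t ⟨ht.1.le, ht.2.trans hc.2⟩).mono_of_mem_nhdsWithin ?_
    exact mem_of_superset (Icc_mem_nhdsLE ht.1) (Set.Icc_subset_Icc_right (ht.2.trans hc.2))
  intro t ht
  have : (w t, w' t) = ((0, 0) : ℂ × ℂ) := by
    rcases le_total c t with h | h
    · exact hr ⟨h, ht.2⟩
    · exact hl ⟨ht.1, h⟩
  exact ⟨congrArg Prod.fst this, congrArg Prod.snd this⟩

/-- Two solutions of `f'' = 6 f² - x` on an interval with the same data at a point agree: their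
difference `w` satisfies the linear equation `w'' = 6 (f + g) w`. -/
theorem eq_of_painleve_ode {f f' g g' : ℝ → ℂ} {a b c : ℝ} (hc : c ∈ Set.Icc a b)
    (hf : ∀ t ∈ Set.Icc a b, HasDerivWithinAt f (f' t) (Set.Icc a b) t)
    (hf' : ∀ t ∈ Set.Icc a b, HasDerivWithinAt f' (6 * f t ^ 2 - t) (Set.Icc a b) t)
    (hg : ∀ t ∈ Set.Icc a b, HasDerivWithinAt g (g' t) (Set.Icc a b) t)
    (hg' : ∀ t ∈ Set.Icc a b, HasDerivWithinAt g' (6 * g t ^ 2 - t) (Set.Icc a b) t)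
    (h0 : f c = g c) (h0' : f' c = g' c) : ∀ t ∈ Set.Icc a b, f t = g t ∧ f' t = g' t := by
  have hcf : ContinuousOn f (Set.Icc a b) := fun t ht => (hf t ht).continuousWithinAt
  have hcg : ContinuousOn g (Set.Icc a b) := fun t ht => (hg t ht).continuousWithinAt
  have h := eq_zero_of_linear_ode (w := fun t => f t - g t) (w' := fun t => f' t - g' t)
    (q := fun t => 6 * (f t + g t)) hc (continuousOn_const.mul (hcf.add hcg))
    (fun t ht => (hf t ht).sub (hg t ht))
    (fun t ht => ((hf' t ht).sub (hg' t ht)).congr_deriv (by ring))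
    (sub_eq_zero.2 h0) (sub_eq_zero.2 h0')
  exact fun t ht => ⟨sub_eq_zero.1 (h t ht).1, sub_eq_zero.1 (h t ht).2⟩

/-- A solution on `[0, ∞)` extends holomorphically to a neighbourhood. The local power series
solutions centred at points of `[0, ∞)` fit together because the intersection of two discs with
real centres is connected and contains a real interval. -/
theorem exists_holomorphic_extension {f f' : ℝ → ℂ}
    (hf : ∀ x, 0 ≤ x → HasDerivWithinAt f (f' x) (Set.Ici 0) x)
    (hf' : ∀ x, 0 ≤ x → HasDerivWithinAt f' (6 * f x ^ 2 - x) (Set.Ici 0) x) :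
    ∃ (U : Set ℂ) (F F' : ℂ → ℂ), IsOpen U ∧ (∀ x : ℝ, 0 ≤ x → (x : ℂ) ∈ U) ∧
      (∀ z ∈ U, HasDerivAt F (F' z) z ∧ HasDerivAt F' (6 * F z ^ 2 - z) z) ∧
      ∀ x : ℝ, 0 ≤ x → F x = f x ∧ F' x = f' x := by
  choose r hr G G' hG hG' hGd using fun c : ℝ => exists_local_solution c (f c) (f' c)
  -- the local solutions extend `f`
  have hreal : ∀ c : ℝ, 0 ≤ c → ∀ x : ℝ, 0 ≤ x → (x : ℂ) ∈ Metric.ball (c : ℂ) (r c) →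
      G c x = f x ∧ G' c x = f' x := by
    intro c hc x hx hxc
    have hsub : ∀ t ∈ Set.Icc (min c x) (max c x), (t : ℂ) ∈ Metric.ball (c : ℂ) (r c) := by
      intro t ht
      rw [mem_ball_iff_norm, ← ofReal_sub, norm_real, Real.norm_eq_abs] at hxc ⊢
      refine lt_of_le_of_lt ?_ hxc
      rw [← max_sub_min_eq_abs' x c, max_comm, min_comm x c, abs_le]
      have h1 := ht.1
      have h2 := ht.2
      have h3 := min_le_left c x
      have h4 := le_max_left c x
      constructor <;> linarith
    have hpos : ∀ t ∈ Set.Icc (min c x) (max c x), 0 ≤ t := fun t ht => (le_min hc hx).trans ht.1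
    have hsubIci : Set.Icc (min c x) (max c x) ⊆ Set.Ici 0 := hpos
    exact eq_of_painleve_ode (f := fun t => G c t) (f' := fun t => G' c t) (c := c)
      ⟨min_le_left _ _, le_max_left _ _⟩
      (fun t ht => (hGd c t (hsub t ht)).1.comp_ofReal.hasDerivWithinAt)
      (fun t ht => (hGd c t (hsub t ht)).2.comp_ofReal.hasDerivWithinAt)
      (fun t ht => (hf t (hpos t ht)).mono hsubIci)
      (fun t ht => (hf' t (hpos t ht)).mono hsubIci) (hG c) (hG' c) x
      ⟨min_le_right _ _, le_max_right _ _⟩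
  have hcompat : ∀ c : ℝ, 0 ≤ c → ∀ d : ℝ, 0 ≤ d → ∀ z ∈ Metric.ball (c : ℂ) (r c),
      z ∈ Metric.ball (d : ℂ) (r d) → G c z = G d z := by
    intro c hc d hd z hzc hzd
    have han : ∀ c : ℝ, AnalyticOnNhd ℂ (G c) (Metric.ball (c : ℂ) (r c)) := fun c =>
      DifferentiableOn.analyticOnNhd
        (fun z hz => (hGd c z hz).1.differentiableAt.differentiableWithinAt) Metric.isOpen_ball
    -- the nonnegative real number nearest to `z` lies in both discs
    set x := max z.re 0
    have hx : ∀ c : ℝ, 0 ≤ c → z ∈ Metric.ball (c : ℂ) (r c) →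
        (x : ℂ) ∈ Metric.ball (c : ℂ) (r c) := by
      intro c hc hz
      rw [mem_ball_iff_norm] at hz ⊢
      refine lt_of_le_of_lt ?_ hz
      rw [← ofReal_sub, norm_real, Real.norm_eq_abs]
      have h1 := abs_re_le_norm (z - c)
      rw [sub_re, ofReal_re] at h1
      refine le_trans ?_ h1
      have h2 : |max z.re 0 - max c 0| ≤ |z.re - c| := abs_max_sub_max_le_abs _ _ _
      rwa [max_eq_left hc] at h2
    have hconv : Convex ℝ (Metric.ball (c : ℂ) (r c) ∩ Metric.ball (d : ℂ) (r d)) :=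
      (convex_ball _ _).inter (convex_ball _ _)
    have htend : Tendsto (fun t : ℝ => (t : ℂ)) (nhdsWithin x (Set.Ioi x))
        (nhdsWithin (x : ℂ) {(x : ℂ)}ᶜ) := by
      refine tendsto_nhdsWithin_iff.2 ⟨(continuous_ofReal.tendsto x).mono_left nhdsWithin_le_nhds,
        ?_⟩
      filter_upwards [self_mem_nhdsWithin] with t ht
      simpa using ne_of_gt ht
    have hfreq : ∃ᶠ w in nhdsWithin (x : ℂ) {(x : ℂ)}ᶜ, G c w = G d w := by
      refine htend.frequently (Eventually.frequently ?_)
      have hb : ∀ c : ℝ, 0 ≤ c → z ∈ Metric.ball (c : ℂ) (r c) →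
          ∀ᶠ t : ℝ in nhdsWithin x (Set.Ioi x), (t : ℂ) ∈ Metric.ball (c : ℂ) (r c) :=
        fun c hc hz => (htend.mono_right nhdsWithin_le_nhds).eventually
          (Metric.isOpen_ball.mem_nhds (hx c hc hz))
      filter_upwards [hb c hc hzc, hb d hd hzd, self_mem_nhdsWithin] with t h1 h2 h3
      have ht : 0 ≤ t := (le_max_right z.re 0).trans (le_of_lt h3)
      rw [(hreal c hc t ht h1).1, (hreal d hd t ht h2).1]
    exact AnalyticOnNhd.eqOn_of_preconnected_of_frequently_eq
      ((han c).mono Set.inter_subset_left) ((han d).mono Set.inter_subset_right)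
      hconv.isPreconnected ⟨hx c hc hzc, hx d hd hzd⟩ hfreq ⟨hzc, hzd⟩
  classical
  set U : Set ℂ := {z | ∃ c : ℝ, 0 ≤ c ∧ z ∈ Metric.ball (c : ℂ) (r c)}
  set F : ℂ → ℂ := fun z => if h : z ∈ U then G h.choose z else 0
  have hF : ∀ c : ℝ, 0 ≤ c → ∀ z ∈ Metric.ball (c : ℂ) (r c), F z = G c z := by
    intro c hc z hz
    have h : z ∈ U := ⟨c, hc, hz⟩
    simp only [F, dif_pos h]
    exact hcompat _ h.choose_spec.1 c hc z h.choose_spec.2 hz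
  have hFd : ∀ c : ℝ, 0 ≤ c → ∀ z ∈ Metric.ball (c : ℂ) (r c), HasDerivAt F (G' c z) z := by
    intro c hc z hz
    refine (hGd c z hz).1.congr_of_eventuallyEq ?_
    filter_upwards [Metric.isOpen_ball.mem_nhds hz] with w hw using hF c hc w hw
  have hF' : ∀ c : ℝ, 0 ≤ c → ∀ z ∈ Metric.ball (c : ℂ) (r c), deriv F z = G' c z :=
    fun c hc z hz => (hFd c hc z hz).deriv
  have hmem : ∀ c : ℝ, (c : ℂ) ∈ Metric.ball (c : ℂ) (r c) := fun c => Metric.mem_ball_self (hr c)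
  refine ⟨U, F, deriv F, ?_, fun x hx => ⟨x, hx, hmem x⟩, ?_, fun x hx => ⟨?_, ?_⟩⟩
  · have : U = ⋃ c ∈ Set.Ici (0 : ℝ), Metric.ball (c : ℂ) (r c) := by ext; simp [U]
    rw [this]
    exact isOpen_biUnion fun _ _ => Metric.isOpen_ball
  · rintro z ⟨c, hc, hz⟩
    refine ⟨?_, ?_⟩
    · rw [hF' c hc z hz]; exact hFd c hc z hz
    · rw [hF c hc z hz]
      refine (hGd c z hz).2.congr_of_eventuallyEq ?_
      filter_upwards [Metric.isOpen_ball.mem_nhds hz] with w hw using hF' c hc w hw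
  · rw [hF x hx x (hmem x), hG]
  · rw [hF' x hx x (hmem x), hG']

/-! ### Uniqueness of the solution without oscillations -/

/-- A solution of `z'' + z = 0` on a half-line that tends to zero is zero. -/
theorem eq_zero_of_harmonic {z z' : ℝ → ℂ} {a : ℝ} (hz : ∀ s, a ≤ s → HasDerivAt z (z' s) s)
    (hz' : ∀ s, a ≤ s → HasDerivAt z' (-z s) s) (h0 : Tendsto z atTop (nhds 0)) :
    ∀ s, a ≤ s → z s = 0 := by
  have hcos : ∀ s : ℝ, HasDerivAt (fun s : ℝ => (Real.cos s : ℂ)) (-(Real.sin s : ℝ) : ℂ) s :=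
    fun s => by simpa using (Real.hasDerivAt_cos s).ofReal_comp
  have hsin : ∀ s : ℝ, HasDerivAt (fun s : ℝ => (Real.sin s : ℂ)) (Real.cos s : ℝ) s :=
    fun s => (Real.hasDerivAt_sin s).ofReal_comp
  -- the two first integrals are the amplitudes of the oscillation
  have hα : ∀ s, a ≤ s → z s * Real.cos s - z' s * Real.sin s
      = z a * Real.cos a - z' a * Real.sin a := by
    have hd : ∀ s, a ≤ s →
        HasDerivAt (fun s : ℝ => z s * Real.cos s - z' s * Real.sin s) 0 s := fun s hs =>
      (((hz s hs).mul (hcos s)).sub ((hz' s hs).mul (hsin s))).congr_deriv (by ring)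
    intro s hs
    exact constant_of_has_deriv_right_zero (a := a) (b := s)
      (fun t ht => (hd t ht.1).continuousAt.continuousWithinAt)
      (fun t ht => (hd t ht.1).hasDerivWithinAt) s ⟨hs, le_rfl⟩
  have hβ : ∀ s, a ≤ s → z s * Real.sin s + z' s * Real.cos s
      = z a * Real.sin a + z' a * Real.cos a := by
    have hd : ∀ s, a ≤ s →
        HasDerivAt (fun s : ℝ => z s * Real.sin s + z' s * Real.cos s) 0 s := fun s hs =>
      (((hz s hs).mul (hsin s)).add ((hz' s hs).mul (hcos s))).congr_deriv (by ring)
    intro s hs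
    exact constant_of_has_deriv_right_zero (a := a) (b := s)
      (fun t ht => (hd t ht.1).continuousAt.continuousWithinAt)
      (fun t ht => (hd t ht.1).hasDerivWithinAt) s ⟨hs, le_rfl⟩
  set α := z a * Real.cos a - z' a * Real.sin a
  set β := z a * Real.sin a + z' a * Real.cos a
  have hrep : ∀ s, a ≤ s → z s = α * Real.cos s + β * Real.sin s := fun s hs => by
    have e : (Real.sin s : ℂ) ^ 2 + (Real.cos s : ℂ) ^ 2 = 1 := by
      exact_mod_cast Real.sin_sq_add_cos_sq s
    linear_combination Real.cos s * hα s hs + Real.sin s * hβ s hs - z s * e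
  have htend : ∀ θ : ℝ, Tendsto (fun n : ℕ => θ + n * (2 * Real.pi)) atTop atTop := fun θ =>
    tendsto_atTop_add_const_left _ _
      (tendsto_natCast_atTop_atTop.atTop_mul_const (by positivity))
  have hlim : ∀ θ : ℝ, α * Real.cos θ + β * Real.sin θ = 0 := fun θ => by
    refine tendsto_nhds_unique (Tendsto.congr' ?_ tendsto_const_nhds) (h0.comp (htend θ))
    filter_upwards [(htend θ).eventually_ge_atTop a] with n hn
    simp only [Function.comp]
    rw [hrep _ hn, Real.cos_add_nat_mul_two_pi, Real.sin_add_nat_mul_two_pi]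
  intro s hs
  rw [hrep s hs, hlim]

/-- A solution of `ω'' + ω = κ ω` with `κ = O(s⁻²)` that tends to zero at infinity vanishes near
infinity: it is a fixed point of a Volterra operator with small norm. -/
theorem eventually_eq_zero_of_tendsto_zero {ω ω' κ : ℝ → ℂ} {a C : ℝ} (ha : 0 < a)
    (hω : ∀ s, a ≤ s → HasDerivAt ω (ω' s) s)
    (hω' : ∀ s, a ≤ s → HasDerivAt ω' (κ s * ω s - ω s) s)
    (hκ : ContinuousOn κ (Set.Ici a)) (hκC : ∀ s, a ≤ s → ‖κ s‖ ≤ C / s ^ 2)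
    (h0 : Tendsto ω atTop (nhds 0)) : ∃ b, ∀ s, b ≤ s → ω s = 0 := by
  have hC : 0 ≤ C := by
    have := (norm_nonneg _).trans (hκC a le_rfl)
    rwa [le_div_iff₀ (by positivity), zero_mul] at this
  obtain ⟨b₀, hb₀⟩ := eventually_atTop.1 (h0.norm.eventually_le_const
    (show ‖(0 : ℂ)‖ < 1 by simp))
  set b := max (max b₀ a) (2 * C)
  have hab : a ≤ b := (le_max_right _ _).trans (le_max_left _ _)
  have hb0 : 0 < b := ha.trans_le hab
  have h1 : ∀ s, b ≤ s → ‖ω s‖ ≤ 1 := fun s hs =>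
    hb₀ s (((le_max_left _ _).trans (le_max_left _ _)).trans hs)
  set f : ℝ → ℂ := fun s => κ (max s b) * ω (max s b)
  have hmax : Continuous fun s : ℝ => max s b := continuous_id.max continuous_const
  have hωc : ContinuousOn ω (Set.Ici a) := fun s hs => (hω s hs).continuousAt.continuousWithinAt
  have hf : Continuous f := (hκ.mul hωc).comp_continuous hmax fun s => hab.trans (le_max_right _ _)
  have hfb : ∀ ε : ℝ, (∀ s, b ≤ s → ‖ω s‖ ≤ ε) → ∀ s ≥ b, ‖f s‖ ≤ C * ε / s ^ (0 + 2) := by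
    intro ε hε s hs
    simp only [f, max_eq_left hs]
    rw [norm_mul, zero_add, mul_div_right_comm]
    exact mul_le_mul (hκC s (hab.trans hs)) (hε s hs) (norm_nonneg _) (by positivity)
  have hi := integrableOn_Ioi_of_decay hf hb0 (hfb 1 h1)
  have hV : ∀ ε : ℝ, (∀ s, b ≤ s → ‖ω s‖ ≤ ε) → ∀ s, b ≤ s → ‖volterra f s‖ ≤ C * ε / s := by
    intro ε hε s hs
    simpa using norm_volterra_le (hb0.trans_le hs) fun τ hτ => hfb ε hε τ (hs.trans hτ)
  have hV0 : Tendsto (volterra f) atTop (nhds 0) := by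
    refine squeeze_zero_norm' ?_ (tendsto_const_nhds.div_atTop tendsto_id : Tendsto
      (fun s : ℝ => C * 1 / s) atTop (nhds 0))
    filter_upwards [eventually_ge_atTop b] with s hs using hV 1 h1 s hs
  have hz := eq_zero_of_harmonic (z := fun s => ω s - volterra f s)
    (z' := fun s => ω' s - volterraDeriv f s) (a := b)
    (fun s hs => (hω s (hab.trans hs)).sub (hasDerivAt_volterra hf hi s))
    (fun s hs => ((hω' s (hab.trans hs)).sub (hasDerivAt_volterraDeriv hf hi s)).congr_deriv (by
      simp only [f, max_eq_left hs]; ring)) (by simpa using h0.sub hV0)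
  have hiter : ∀ n : ℕ, ∀ s, b ≤ s → ‖ω s‖ ≤ (1 / 2) ^ n := by
    intro n
    induction n with
    | zero => simpa using h1
    | succ n ih =>
      intro s hs
      rw [sub_eq_zero.1 (hz s hs)]
      refine (hV _ ih s hs).trans ?_
      have h2C : 2 * C ≤ s := (le_max_right _ _).trans hs
      rw [div_le_iff₀ (hb0.trans_le hs), pow_succ]
      have : (0 : ℝ) < (1 / 2) ^ n := by positivity
      nlinarith
  refine ⟨b, fun s hs => ?_⟩
  have hlim := tendsto_pow_atTop_nhds_zero_of_lt_one (r := (1 / 2 : ℝ)) (by norm_num) (by norm_num)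
  exact norm_le_zero_iff.1 (ge_of_tendsto' hlim fun n => hiter n s hs)

/-- The tenth root of `30 s`. With `b = tenthRoot s`, the inverse of the change of variable
`s = (24 x)^{5/4} / 30` is `x = b⁸ / 24`. -/
def tenthRoot (s : ℝ) : ℝ := (30 * s) ^ (1 / 10 : ℝ)

theorem tenthRoot_pos {s : ℝ} (hs : 0 < s) : 0 < tenthRoot s :=
  Real.rpow_pos_of_pos (by positivity) _

theorem tenthRoot_pow {s : ℝ} (hs : 0 < s) : tenthRoot s ^ 10 = 30 * s := by
  rw [tenthRoot, ← Real.rpow_natCast, ← Real.rpow_mul (by positivity)]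
  norm_num

theorem tenthRoot_of_pow {b : ℝ} (hb : 0 < b) : tenthRoot (b ^ 10 / 30) = b := by
  rw [tenthRoot, mul_div_cancel₀ _ (by norm_num), ← Real.rpow_natCast, ← Real.rpow_mul hb.le]
  norm_num

theorem hasDerivAt_tenthRoot {s : ℝ} (hs : 0 < s) :
    HasDerivAt tenthRoot (3 / tenthRoot s ^ 9) s := by
  have h := ((hasDerivAt_id s).const_mul 30).rpow_const (p := 1 / 10)
    (Or.inl (by simp only [id]; positivity))
  refine h.congr_deriv ?_
  simp only [id]
  rw [Real.rpow_sub_one (by positivity)]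
  change 30 * 1 * (1 / 10) * (tenthRoot s / (30 * s)) = _
  rw [← tenthRoot_pow hs]
  have := tenthRoot_pos hs
  field_simp
  norm_num

/-- Two solutions of `f'' = 6 f² - x` with the asymptotic behaviour `-√(x/6) + O(x⁻²)` agree near
infinity. -/
theorem eventually_eq_of_asymptotic {f f' g g' : ℝ → ℂ} {R C : ℝ} (hR : 0 < R)
    (hf : ∀ x, R ≤ x → HasDerivAt f (f' x) x)
    (hf' : ∀ x, R ≤ x → HasDerivAt f' (6 * f x ^ 2 - x) x)
    (hg : ∀ x, R ≤ x → HasDerivAt g (g' x) x)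
    (hg' : ∀ x, R ≤ x → HasDerivAt g' (6 * g x ^ 2 - x) x)
    (hfC : ∀ x, R ≤ x → ‖f x + (√(x / 6) : ℝ)‖ ≤ C / x ^ 2)
    (hgC : ∀ x, R ≤ x → ‖g x + (√(x / 6) : ℝ)‖ ≤ C / x ^ 2) :
    ∃ R', ∀ x, R' ≤ x → f x = g x := by
  have hC : 0 ≤ C := by
    have := (norm_nonneg _).trans (hfC R le_rfl)
    rwa [le_div_iff₀ (by positivity), zero_mul] at this
  set a : ℝ := (24 * R + 1) ^ 10 with hadef
  have ha : 0 < a := by positivity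
  set b := tenthRoot
  set X : ℝ → ℝ := fun s => b s ^ 8 / 24
  have hb : ∀ s, a ≤ s → 24 * R + 1 ≤ b s := fun s hs => by
    have hs0 : 0 < s := ha.trans_le hs
    refine le_of_pow_le_pow_left₀ (n := 10) (by norm_num) (tenthRoot_pos hs0).le ?_
    rw [tenthRoot_pow hs0, ← hadef]
    linarith
  have hb0 : ∀ s, a ≤ s → 0 < b s := fun s hs => tenthRoot_pos (ha.trans_le hs)
  have hX : ∀ s, a ≤ s → R ≤ X s := fun s hs => by
    have h1 := hb s hs
    have h2 : b s ^ 1 ≤ b s ^ 8 := pow_le_pow_right₀ (by linarith) (by norm_num)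
    rw [pow_one] at h2
    simp only [X]
    rw [le_div_iff₀ (by norm_num)]
    linarith
  have hbd : ∀ s, a ≤ s → HasDerivAt b (3 / b s ^ 9) s := fun s hs =>
    hasDerivAt_tenthRoot (ha.trans_le hs)
  have hXd : ∀ s, a ≤ s → HasDerivAt X (1 / b s ^ 2) s := fun s hs => by
    have := hb0 s hs
    refine (((hbd s hs).fun_pow 8).div_const 24).congr_deriv ?_
    field_simp
    norm_num
    ring
  have hsqrt : ∀ s, a ≤ s → √(X s / 6) = b s ^ 4 / 12 := fun s hs => by
    have := hb0 s hs
    rw [show X s / 6 = (b s ^ 4 / 12) ^ 2 by simp only [X]; ring, Real.sqrt_sq (by positivity)]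
  set w : ℝ → ℂ := fun x => f x - g x
  set w' : ℝ → ℂ := fun x => f' x - g' x
  -- the Liouville transformation: for `ω = b w(X)` the equation `w'' = 6 (f + g) w` becomes
  -- `ω'' + ω = κ ω`, and `f + g ≈ -√(2 x / 3) = -b⁴ / 6` cancels the constant term of `κ`
  set κ : ℝ → ℂ := fun s => ((1 - 81 / b s ^ 20 : ℝ) : ℂ)
    + 6 * (f (X s) + g (X s)) * ((1 / b s ^ 4 : ℝ) : ℂ)
  have hκ : ContinuousOn κ (Set.Ici a) := by
    intro s hs
    have hb1 : ContinuousAt b s := (hbd s hs).continuousAt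
    have hX1 : ContinuousAt X s := (hXd s hs).continuousAt
    have hf1 : ContinuousAt (fun s => f (X s)) s :=
      ContinuousAt.comp (f := X) (hf _ (hX s hs)).continuousAt hX1
    have hg1 : ContinuousAt (fun s => g (X s)) s :=
      ContinuousAt.comp (f := X) (hg _ (hX s hs)).continuousAt hX1
    have e1 : ContinuousAt (fun s => (1 - 81 / b s ^ 20 : ℝ)) s :=
      continuousAt_const.sub (continuousAt_const.div (hb1.pow 20) (pow_pos (hb0 s hs) 20).ne')
    have e2 : ContinuousAt (fun s => (1 / b s ^ 4 : ℝ)) s :=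
      continuousAt_const.div (hb1.pow 4) (pow_pos (hb0 s hs) 4).ne'
    exact ((continuous_ofReal.continuousAt.comp e1).add
      ((continuousAt_const.mul (hf1.add hg1)).mul
        (continuous_ofReal.continuousAt.comp e2))).continuousWithinAt
  have hκC : ∀ s, a ≤ s → ‖κ s‖ ≤ (81 + 6912 * C) / 900 / s ^ 2 := by
    intro s hs
    have hbp := hb0 s hs
    have h1 := hfC _ (hX s hs)
    have h2 := hgC _ (hX s hs)
    rw [hsqrt s hs] at h1 h2
    have e : κ s = (-(81 / b s ^ 20) : ℝ) + 6 * ((f (X s) + (b s ^ 4 / 12 : ℝ))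
        + (g (X s) + (b s ^ 4 / 12 : ℝ))) * ((1 / b s ^ 4 : ℝ) : ℂ) := by
      have : ((b s ^ 4 / 12 : ℝ) : ℂ) * ((1 / b s ^ 4 : ℝ) : ℂ) = 1 / 12 := by
        rw [← ofReal_mul, show b s ^ 4 / 12 * (1 / b s ^ 4) = 1 / 12 by field_simp]
        push_cast; ring
      simp only [κ]
      push_cast at this ⊢
      linear_combination (-12) * this
    have h3 : b s ^ 20 = 900 * s ^ 2 := by
      rw [show b s ^ 20 = (b s ^ 10) ^ 2 by ring, tenthRoot_pow (ha.trans_le hs)]; ring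
    have h4 : C / X s ^ 2 = 576 * C / b s ^ 16 := by simp only [X]; field_simp; norm_num
    rw [h4] at h1 h2
    have h5 : (81 + 6912 * C) / 900 / s ^ 2 = 81 / b s ^ 20
        + 6 * (576 * C / b s ^ 16 + 576 * C / b s ^ 16) * (1 / b s ^ 4) := by
      have h6 : (81 + 6912 * C) / 900 / s ^ 2 = (81 + 6912 * C) / b s ^ 20 := by
        rw [h3]; field_simp
      rw [h6]
      field_simp
      ring
    rw [e, h5]
    refine (norm_add_le _ _).trans (add_le_add ?_ ?_)
    · rw [norm_real, Real.norm_eq_abs, abs_neg, abs_of_pos (by positivity)]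
    · rw [norm_mul, norm_mul, norm_real, Real.norm_eq_abs,
        abs_of_pos (by positivity : 0 < 1 / b s ^ 4)]
      refine mul_le_mul_of_nonneg_right ?_ (by positivity)
      have : ‖(6 : ℂ)‖ = 6 := by norm_num
      rw [this]
      exact mul_le_mul_of_nonneg_left ((norm_add_le _ _).trans (add_le_add h1 h2)) (by norm_num)
  have hwd : ∀ s, a ≤ s → HasDerivAt (fun s => w (X s)) (((1 / b s ^ 2 : ℝ) : ℂ) * w' (X s)) s :=
    fun s hs => ((((hf _ (hX s hs)).sub (hg _ (hX s hs))).scomp s (hXd s hs))).congr_deriv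
      (by rw [real_smul])
  have hwd' : ∀ s, a ≤ s → HasDerivAt (fun s => w' (X s))
      (((1 / b s ^ 2 : ℝ) : ℂ) * (6 * (f (X s) + g (X s)) * w (X s))) s :=
    fun s hs => ((((hf' _ (hX s hs)).sub (hg' _ (hX s hs))).scomp s (hXd s hs))).congr_deriv
      (by rw [real_smul]; simp only [w]; ring)
  obtain ⟨S, hS⟩ := eventually_eq_zero_of_tendsto_zero (ω := fun s => (b s : ℂ) * w (X s))
    (ω' := fun s => ((3 / b s ^ 9 : ℝ) : ℂ) * w (X s) + ((1 / b s : ℝ) : ℂ) * w' (X s))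
    (κ := κ) (a := a) ha (fun s hs => by
      refine ((hbd s hs).ofReal_comp.mul (hwd s hs)).congr_deriv ?_
      have : (b s : ℂ) ≠ 0 := ofReal_ne_zero.2 (hb0 s hs).ne'
      push_cast
      field_simp) (fun s hs => by
      have hbp := hb0 s hs
      have d1 : HasDerivAt (fun s => 3 / b s ^ 9) (-(81 / b s ^ 19)) s := by
        refine ((hasDerivAt_const s (3 : ℝ)).fun_div ((hbd s hs).fun_pow 9)
          (pow_pos hbp 9).ne').congr_deriv ?_
        field_simp
        norm_num
        ring
      have d2 : HasDerivAt (fun s => 1 / b s) (-(3 / b s ^ 11)) s := by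
        refine ((hasDerivAt_const s (1 : ℝ)).fun_div (hbd s hs) hbp.ne').congr_deriv ?_
        field_simp
        norm_num
      refine ((d1.ofReal_comp.mul (hwd s hs)).add (d2.ofReal_comp.mul (hwd' s hs))).congr_deriv ?_
      have : (b s : ℂ) ≠ 0 := ofReal_ne_zero.2 (hb0 s hs).ne'
      simp only [κ]
      push_cast
      field_simp
      ring) hκ hκC (by
      refine squeeze_zero_norm' (a := fun s => 38400 * C / s) ?_
        (tendsto_const_nhds.div_atTop tendsto_id)
      filter_upwards [eventually_ge_atTop a] with s hs
      have hs0 : 0 < s := ha.trans_le hs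
      have hbp := hb0 s hs
      have h1 : 1 ≤ b s := by have := hb s hs; linarith
      have h4 : C / X s ^ 2 = 576 * C / b s ^ 16 := by simp only [X]; field_simp; norm_num
      have h2 : ‖w (X s)‖ ≤ 1152 * C / b s ^ 16 := by
        have e : w (X s) = (f (X s) + (√(X s / 6) : ℝ)) - (g (X s) + (√(X s / 6) : ℝ)) := by
          simp only [w]; ring
        rw [e]
        refine (norm_sub_le _ _).trans ((add_le_add (hfC _ (hX s hs)) (hgC _ (hX s hs))).trans ?_)
        rw [h4]
        exact le_of_eq (by ring)
      rw [norm_mul, norm_real, Real.norm_eq_abs, abs_of_pos hbp]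
      refine (mul_le_mul_of_nonneg_left h2 hbp.le).trans ?_
      have e : b s * (1152 * C / b s ^ 16) = 1152 * C / (b s ^ 15) := by field_simp
      rw [e, div_le_div_iff₀ (by positivity) hs0]
      have h5 : b s ^ 10 ≤ b s ^ 15 := pow_le_pow_right₀ h1 (by norm_num)
      rw [tenthRoot_pow hs0] at h5
      nlinarith [mul_le_mul_of_nonneg_left h5 hC, mul_nonneg hC hs0.le])
  set S' := max S a
  have hS'0 : 0 < S' := ha.trans_le (le_max_right _ _)
  refine ⟨(30 * S' + 1) ^ 8, fun x hx => ?_⟩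
  have hx0 : 0 < x := lt_of_lt_of_le (by positivity) hx
  set β : ℝ := (24 * x) ^ (1 / 8 : ℝ)
  have hβ0 : 0 < β := Real.rpow_pos_of_pos (by positivity) _
  have hβ8 : β ^ 8 = 24 * x := by
    simp only [β]
    rw [← Real.rpow_natCast, ← Real.rpow_mul (by positivity)]
    norm_num
  have hβ : 30 * S' + 1 ≤ β := by
    refine le_of_pow_le_pow_left₀ (n := 8) (by norm_num) hβ0.le ?_
    rw [hβ8]; linarith
  have hβ10 : β ^ 1 ≤ β ^ 10 := pow_le_pow_right₀ (by linarith) (by norm_num)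
  have hs : S' ≤ β ^ 10 / 30 := by
    rw [le_div_iff₀ (by norm_num)]
    rw [pow_one] at hβ10
    linarith
  have h := hS (β ^ 10 / 30) ((le_max_left _ _).trans hs)
  have hbβ : b (β ^ 10 / 30) = β := tenthRoot_of_pow hβ0
  have hXβ : X (β ^ 10 / 30) = x := by
    simp only [X]
    rw [hbβ, hβ8]; ring
  rw [hbβ, hXβ] at h
  have := (mul_eq_zero.1 h).resolve_left (ofReal_ne_zero.2 hβ0.ne')
  exact sub_eq_zero.1 this

/-! ### The tritronquée solution on the half-line -/

/-- A function on `[0, b]` and one on `[b, ∞)` with the same value and derivative at `b` join to a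
differentiable function on `[0, ∞)`. -/
theorem hasDerivWithinAt_glue {f f' g g' : ℝ → ℂ} {b : ℝ} (hb : 0 ≤ b)
    (hf : ∀ x ∈ Set.Icc 0 b, HasDerivWithinAt f (f' x) (Set.Icc 0 b) x)
    (hg : ∀ x, b ≤ x → HasDerivWithinAt g (g' x) (Set.Ici b) x) (h : f b = g b)
    (h' : f' b = g' b) {x : ℝ} (hx : 0 ≤ x) :
    HasDerivWithinAt (fun x => if x ≤ b then f x else g x) (if x ≤ b then f' x else g' x)
      (Set.Ici 0) x := by
  have hpg : ∀ y ∈ Set.Ici b, (if y ≤ b then f y else g y) = g y := fun y hy => by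
    split_ifs with hyb
    · rw [le_antisymm hyb hy, h]
    · rfl
  have hpg' : ∀ y ∈ Set.Ici b, (if y ≤ b then f' y else g' y) = g' y := fun y hy => by
    split_ifs with hyb
    · rw [le_antisymm hyb hy, h']
    · rfl
  rw [← Set.Icc_union_Ici_eq_Ici hb]
  refine HasDerivWithinAt.union ?_ ?_
  · rcases le_or_gt x b with hxb | hxb
    · rw [if_pos hxb]
      exact (hf x ⟨hx, hxb⟩).congr (fun y hy => if_pos hy.2) (if_pos hxb)
    · exact HasFDerivWithinAt.of_notMem_closure fun hm => by
        rw [isClosed_Icc.closure_eq] at hm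
        exact hxb.not_ge hm.2
  · rcases lt_or_ge x b with hxb | hxb
    · exact HasFDerivWithinAt.of_notMem_closure fun hm => by
        rw [isClosed_Ici.closure_eq] at hm
        exact hxb.not_ge hm
    · rw [hpg' x hxb]
      exact (hg x hxb).congr hpg (hpg x hxb)

theorem g₀_t₀ : g₀ t₀ = -(280 / 519) := by simp [g₀]

theorem deriv_g₀_eq (t : ℝ) : deriv g₀ t = ev (lDer cG) (t - t₀) := by
  rw [g₀_eq, deriv_ev_sub]

theorem deriv_J₁_eq (t : ℝ) : deriv J₁ t = ev (lDer cJ₁) (t - t₀) := by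
  rw [J₁_eq, deriv_ev_sub]

theorem deriv_J₂_eq (t : ℝ) : deriv J₂ t = ev (lDer cJ₂) (t - t₀) := by
  rw [J₂_eq, deriv_ev_sub]

theorem deriv_g₀_t₀ : deriv g₀ t₀ = 150 / 1013 := by
  rw [deriv_g₀_eq]; norm_num [cG, lDer, lAdd]

theorem N_fst_t₀ (a₁ a₂ : ℂ) (d : (ℝ → ℂ) × (ℝ → ℂ)) : (N a₁ a₂ d).1 t₀ = a₁ := by
  simp [N, K₁, J₁, J₂]

theorem N_snd_t₀ (a₁ a₂ : ℂ) (d : (ℝ → ℂ) × (ℝ → ℂ)) : (N a₁ a₂ d).2 t₀ = a₂ := by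
  have h₁ : deriv J₁ t₀ = 0 := by rw [deriv_J₁_eq]; norm_num [cJ₁, lDer, lAdd]
  have h₂ : deriv J₂ t₀ = 1 := by rw [deriv_J₂_eq]; norm_num [cJ₂, lDer, lAdd]
  simp [N, K₂, h₁, h₂]

/-- The solution with the asymptotics of the tritronquée exists on the whole half-line: the
solution near infinity is continued from `17 / 10 = -t₀` to `0` by the fixed point of `N`. -/
theorem exists_solution_half_line : ∃ (f f' : ℝ → ℂ) (d : (ℝ → ℂ) × (ℝ → ℂ)),
    (∀ x, 0 ≤ x → HasDerivWithinAt f (f' x) (Set.Ici 0) x) ∧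
    (∀ x, 0 ≤ x → HasDerivWithinAt f' (6 * f x ^ 2 - x) (Set.Ici 0) x) ∧
    (∀ x, 2 ≤ x → ‖f x + (√(x / 6) : ℝ)‖ ≤ 1 / x ^ 2) ∧
    d ∈ disc ∧ ‖d.1 t₀‖ < 1 / 290 ∧ ‖d.2 t₀‖ < 1 / 152 ∧
    (∀ t ∈ Set.Icc t₀ 0, (N (d.1 t₀) (d.2 t₀) d).1 t = d.1 t) ∧
    (∀ t ∈ Set.Icc t₀ 0, (N (d.1 t₀) (d.2 t₀) d).2 t = d.2 t) ∧
    ∀ t ∈ Set.Icc t₀ 0, f (-t) = g₀ t + d.1 t ∧ f' (-t) = -((deriv g₀ t : ℝ) + d.2 t) := by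
  obtain ⟨p, p', hp, hp₁, hp₂⟩ := exists_solution_near_infinity
  obtain ⟨a₁, ha₁⟩ : ∃ a : ℂ, a = ((p (17 / 10) + 280 / 519 : ℝ) : ℂ) := ⟨_, rfl⟩
  obtain ⟨a₂, ha₂⟩ : ∃ a : ℂ, a = ((-p' (17 / 10) - 150 / 1013 : ℝ) : ℂ) := ⟨_, rfl⟩
  have ha₁n : ‖a₁‖ < 1 / 290 := by rw [ha₁, norm_real]; exact hp₁
  have ha₂n : ‖a₂‖ < 1 / 152 := by rw [ha₂, norm_real]; exact hp₂
  obtain ⟨d, hd, hd₁, hd₂⟩ := exists_fixedPoint ha₁n ha₂n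
  have e₁ : d.1 t₀ = a₁ := by rw [← hd₁ t₀ t₀_mem, N_fst_t₀]
  have e₂ : d.2 t₀ = a₂ := by rw [← hd₂ t₀ t₀_mem, N_snd_t₀]
  have ht : -t₀ = 17 / 10 := by norm_num [t₀]
  have hm : ∀ x ∈ Set.Icc (0 : ℝ) (17 / 10), -x ∈ Set.Icc t₀ 0 := fun x hx => by
    constructor <;> linarith [hx.1, hx.2]
  have hneg : ∀ x ∈ Set.Icc (0 : ℝ) (17 / 10),
      HasDerivWithinAt (fun x : ℝ => -x) (-1) (Set.Icc (0 : ℝ) (17 / 10)) x := fun x _ =>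
    (hasDerivAt_neg x).hasDerivWithinAt
  have hode : ∀ x ∈ Set.Icc (0 : ℝ) (17 / 10), _ := fun x hx =>
    hasDerivWithinAt_of_fixedPoint hd.1 hd.2.1 hd₁ hd₂ (hm x hx)
  refine ⟨fun x => if x ≤ 17 / 10 then g₀ (-x) + d.1 (-x) else p x,
    fun x => if x ≤ 17 / 10 then -((deriv g₀ (-x) : ℝ) + d.2 (-x)) else p' x, d,
    fun x hx => ?_, fun x hx => ?_, fun x hx => ?_, hd, e₁ ▸ ha₁n, e₂ ▸ ha₂n, ?_, ?_,
    fun t ht' => ?_⟩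
  · refine hasDerivWithinAt_glue (b := 17 / 10) (f := fun x => g₀ (-x) + d.1 (-x))
      (f' := fun x => -((deriv g₀ (-x) : ℝ) + d.2 (-x))) (g := fun x => (p x : ℂ))
      (g' := fun x => (p' x : ℂ)) (by norm_num) (fun x hx => ?_)
      (fun x hx => ((hp x (by linarith)).1.ofReal_comp).hasDerivWithinAt) ?_ ?_ hx
    · have h₁ := (hasDerivAt_g₀ (-x)).ofReal_comp.hasDerivWithinAt.add (hode x hx).1
      refine (h₁.scomp x (hneg x hx) hm).congr_deriv ?_
      rw [neg_smul, one_smul]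
    · rw [← ht, neg_neg, e₁, ha₁, g₀_t₀, ht]
      push_cast; ring
    · rw [← ht, neg_neg, e₂, ha₂, deriv_g₀_t₀, ht]
      push_cast; ring
  · have key := hasDerivWithinAt_glue (b := 17 / 10) (x := x)
      (f := fun x => -((deriv g₀ (-x) : ℝ) + d.2 (-x)))
      (f' := fun x => 6 * (g₀ (-x) + d.1 (-x)) ^ 2 - x) (g := fun x => (p' x : ℂ))
      (g' := fun x => 6 * (p x : ℂ) ^ 2 - x) (by norm_num) (fun x hx => ?_)
      (fun x hx => ?_) ?_ ?_ hx
    · refine key.congr_deriv ?_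
      beta_reduce
      split_ifs <;> rfl
    · have h₁ := (hasDerivAt_deriv_g₀ (-x)).ofReal_comp.hasDerivWithinAt.add (hode x hx).2
      refine (h₁.scomp x (hneg x hx) hm).neg.congr_deriv ?_
      simp only [R]
      push_cast
      rw [neg_smul, one_smul]
      ring
    · refine ((hp x (by linarith)).2.1.ofReal_comp.congr_deriv ?_).hasDerivWithinAt
      push_cast; ring
    · rw [← ht, neg_neg, e₂, ha₂, deriv_g₀_t₀, ht]
      push_cast; ring
    · rw [← ht, neg_neg, e₁, ha₁, g₀_t₀, ht]
      push_cast; ring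
  · simp only
    rw [if_neg (by linarith), ← ofReal_add, norm_real]
    exact (hp x (by linarith)).2.2
  · rw [e₁, e₂]; exact hd₁
  · rw [e₁, e₂]; exact hd₂
  · have : -t ≤ 17 / 10 := by rw [← ht]; linarith [ht'.1]
    simp only
    rw [if_pos this, if_pos this, neg_neg]
    exact ⟨rfl, rfl⟩

/-! ### The operator depends only on the values on the interval -/

theorem N_congr {d e : (ℝ → ℂ) × (ℝ → ℂ)} (h₁ : ∀ t ∈ Set.Icc t₀ 0, d.1 t = e.1 t)
    (h₂ : ∀ t ∈ Set.Icc t₀ 0, d.2 t = e.2 t) (a₁ a₂ : ℂ) {t : ℝ} (ht : t ∈ Set.Icc t₀ 0) :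
    (N a₁ a₂ d).1 t = (N a₁ a₂ e).1 t ∧ (N a₁ a₂ d).2 t = (N a₁ a₂ e).2 t := by
  have h : ∀ s ∈ Set.uIcc t₀ t, nonlin d s = nonlin e s := fun s hs => by
    simp only [nonlin]
    rw [h₁ s (uIcc_subset ht hs), h₂ s (uIcc_subset ht hs)]
  constructor
  · have : K₁ (nonlin d) t = K₁ (nonlin e) t :=
      intervalIntegral.integral_congr fun s hs => congrArg (fun z => (green s t : ℂ) * z) (h s hs)
    simp only [N, this]
  · have : K₂ (nonlin d) t = K₂ (nonlin e) t :=
      intervalIntegral.integral_congr fun s hs =>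
        congrArg (fun z => ((deriv (fun τ => green s τ) t : ℝ) : ℂ) * z) (h s hs)
    simp only [N, this]

theorem mem_disc_congr {d e : (ℝ → ℂ) × (ℝ → ℂ)} (h₁ : ∀ t ∈ Set.Icc t₀ 0, d.1 t = e.1 t)
    (h₂ : ∀ t ∈ Set.Icc t₀ 0, d.2 t = e.2 t) (hd : d ∈ disc) : e ∈ disc :=
  ⟨hd.1.congr fun t ht => (h₁ t ht).symm, hd.2.1.congr fun t ht => (h₂ t ht).symm,
    (halfNorm_le (fun t ht => h₁ t ht ▸ norm_fst_le_halfNorm hd.1 ht)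
      fun t ht => h₂ t ht ▸ norm_snd_le_halfNorm hd.2.1 ht).trans hd.2.2⟩

/-! ### Values at the origin -/

/-- The bound for `g(0) = g₀(0) + δ(0)`: the constant `87/469` approximates `-g₀(0)`, the linear
part of `δ(0)` is at most `0.0053128`, and `k` stands for its integral part. -/
theorem norm_add_g₀_zero_lt {a₁ a₂ k : ℂ} (h₁ : ‖a₁‖ < 1 / 290) (h₂ : ‖a₂‖ < 1 / 152)
    (hk : ‖k‖ ≤ 635 / 1000000) :
    ‖(g₀ 0 : ℂ) + (a₁ * J₁ 0 + a₂ * J₂ 0 + k) + 87 / 469‖ < 1 / 167 := by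
  have b₁ : ‖((g₀ 0 + 87 / 469 : ℝ) : ℂ)‖ ≤ 3 / 100000 := by
    rw [norm_real, Real.norm_eq_abs, abs_le]
    constructor <;> norm_num [g₀, t₀]
  have b₂ : 1 / 290 * |J₁ 0| + 1 / 152 * |J₂ 0| ≤ 53128 / 10000000 := by
    have e₁ : |J₁ 0| ≤ 10637 / 10000 := by rw [abs_le]; constructor <;> norm_num [J₁, t₀]
    have e₂ : |J₂ 0| ≤ 2494 / 10000 := by rw [abs_le]; constructor <;> norm_num [J₂, t₀]
    linarith
  have b₃ := norm_linear_comb_le h₁ h₂ b₂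
  have e : (g₀ 0 : ℂ) + (a₁ * J₁ 0 + a₂ * J₂ 0 + k) + 87 / 469
      = ((g₀ 0 + 87 / 469 : ℝ) : ℂ) + (a₁ * J₁ 0 + a₂ * J₂ 0) + k := by push_cast; ring
  rw [e]
  have := norm_add₃_le (a := ((g₀ 0 + 87 / 469 : ℝ) : ℂ)) (b := a₁ * J₁ 0 + a₂ * J₂ 0) (c := k)
  linarith

/-- The corresponding bound for `g'(0)`, with `41/134` approximating the derivative of `g₀` at `0`.
-/
theorem norm_add_deriv_g₀_zero_lt {a₁ a₂ k : ℂ} (h₁ : ‖a₁‖ < 1 / 290) (h₂ : ‖a₂‖ < 1 / 152)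
    (hk : ‖k‖ ≤ 1420 / 1000000) :
    ‖((deriv g₀ 0 : ℝ) : ℂ) + (a₁ * (deriv J₁ 0 : ℝ) + a₂ * (deriv J₂ 0 : ℝ) + k) - 41 / 134‖
      < 1 / 108 := by
  have b₁ : ‖((deriv g₀ 0 - 41 / 134 : ℝ) : ℂ)‖ ≤ 4 / 100000 := by
    rw [norm_real, Real.norm_eq_abs, abs_le, deriv_g₀_eq]
    constructor <;> norm_num [t₀, cG, lDer, lAdd]
  have b₂ : 1 / 290 * |deriv J₁ 0| + 1 / 152 * |deriv J₂ 0| ≤ 7696 / 1000000 := by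
    have e₁ : |deriv J₁ 0| ≤ 7918 / 10000 := by
      rw [abs_le, deriv_J₁_eq]; constructor <;> norm_num [t₀, cJ₁, lDer, lAdd]
    have e₂ : |deriv J₂ 0| ≤ 7546 / 10000 := by
      rw [abs_le, deriv_J₂_eq]; constructor <;> norm_num [t₀, cJ₂, lDer, lAdd]
    linarith
  have b₃ := norm_linear_comb_le h₁ h₂ b₂
  have e : ((deriv g₀ 0 : ℝ) : ℂ) + (a₁ * (deriv J₁ 0 : ℝ) + a₂ * (deriv J₂ 0 : ℝ) + k) - 41 / 134
      = ((deriv g₀ 0 - 41 / 134 : ℝ) : ℂ)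
        + (a₁ * (deriv J₁ 0 : ℝ) + a₂ * (deriv J₂ 0 : ℝ)) + k := by push_cast; ring
  rw [e]
  have := norm_add₃_le (a := ((deriv g₀ 0 - 41 / 134 : ℝ) : ℂ))
    (b := a₁ * (deriv J₁ 0 : ℝ) + a₂ * (deriv J₂ 0 : ℝ)) (c := k)
  linarith

/-! ### Rotation of the ray to the half-line -/

/-- The direction `e^{iπ/5}` of the ray. -/
def turn : ℂ := exp (I * Real.pi / 5)

theorem turn_ne_zero : turn ≠ 0 := exp_ne_zero _

theorem norm_turn : ‖turn‖ = 1 := by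
  have : I * Real.pi / 5 = ((Real.pi / 5 : ℝ) : ℂ) * I := by push_cast; ring
  rw [turn, this, norm_exp_ofReal_mul_I]

theorem turn_pow_five : turn ^ 5 = -1 := by
  rw [turn, ← exp_nat_mul, ← exp_pi_mul_I]
  congr 1; push_cast; ring

theorem exp_two_fifths : exp (2 * Real.pi * I / 5) = turn ^ 2 := by
  rw [turn, ← exp_nat_mul]
  congr 1; push_cast; ring

theorem ray_eq (r : ℝ) : ray r = r * turn := rfl

theorem rotated_eq (y : ℂ → ℂ) (t : ℝ) : rotated y t = turn ^ 2 * y (ray (-t)) := by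
  have : Real.pi * I / 5 = I * Real.pi / 5 := by ring
  rw [rotated, exp_two_fifths, ray_eq, turn, this]
  push_cast; rfl

/-- In the rotated variable a solution of `y'' = 6 y² + z` satisfies `f'' = 6 f² - r`. -/
theorem IsSolutionOn.hasDerivAt_ray {V : Set ℂ} {v : ℂ → ℂ} (h : IsSolutionOn V v) {r : ℝ}
    (hr : ray r ∈ V) :
    HasDerivAt (fun r : ℝ => turn ^ 2 * v (ray r)) (turn ^ 3 * deriv v (ray r)) r ∧
      HasDerivAt (fun r : ℝ => turn ^ 3 * deriv v (ray r)) (6 * (turn ^ 2 * v (ray r)) ^ 2 - r)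
        r := by
  have hray : HasDerivAt ray turn r := by
    have := (hasDerivAt_id r).ofReal_comp.mul_const turn
    exact this.congr_deriv (by simp)
  have hV := h.1.mem_nhds hr
  have h₁ : HasDerivAt v (deriv v (ray r)) (ray r) :=
    ((h.2.1 _ hr).differentiableAt hV).hasDerivAt
  have h₂ : HasDerivAt (deriv v) (6 * v (ray r) ^ 2 + ray r) (ray r) := by
    rw [← h.2.2 _ hr]
    exact (((h.2.1.deriv h.1) _ hr).differentiableAt hV).hasDerivAt
  constructor
  · refine ((h₁.comp r hray).const_mul (turn ^ 2)).congr_deriv ?_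
    ring
  · refine ((h₂.comp r hray).const_mul (turn ^ 3)).congr_deriv ?_
    rw [ray_eq]
    linear_combination (r : ℂ) * turn_pow_five

/-- In the rotated variable the leading term `i √(z/6)` becomes `-√(r/6)`: on the ray the principal
root is `√(r/6) e^{iπ/10}`. -/
theorem turn_sq_mul_leading {r : ℝ} (hr : 0 < r) :
    turn ^ 2 * (I * (ray r / 6) ^ (1 / 2 : ℂ)) = -(√(r / 6) : ℝ) := by
  have hr6 : 0 < r / 6 := by positivity
  have h₁ : ray r / 6 = exp ((Real.log (r / 6) : ℝ) + I * Real.pi / 5) := by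
    rw [exp_add, ← ofReal_exp, Real.exp_log hr6, ray]
    push_cast; ring
  have h₂ : (ray r / 6) ^ (1 / 2 : ℂ)
      = exp (((Real.log (r / 6) / 2 : ℝ) : ℂ) + I * Real.pi / 10) := by
    have him : ((Real.log (r / 6) : ℝ) + I * Real.pi / 5 : ℂ).im = Real.pi / 5 := by
      have : ((Real.log (r / 6) : ℝ) + I * Real.pi / 5 : ℂ)
          = (Real.log (r / 6) : ℝ) + ((Real.pi / 5 : ℝ) : ℂ) * I := by push_cast; ring
      rw [this]; simp
    rw [cpow_def_of_ne_zero (by rw [h₁]; exact exp_ne_zero _), h₁, log_exp]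
    · congr 1; push_cast; ring
    · rw [him]; linarith [Real.pi_pos]
    · rw [him]; linarith [Real.pi_pos]
  have h₃ : turn ^ 2 * (I * exp (I * Real.pi / 10)) = -1 := by
    have hI : exp (Real.pi / 2 * I) = I := exp_pi_div_two_mul_I
    rw [turn, ← exp_nat_mul, ← hI, ← exp_add, ← exp_add, ← exp_pi_mul_I, hI]
    congr 1; push_cast; ring
  rw [h₂, exp_add, ← ofReal_exp, Real.exp_half, Real.exp_log hr6]
  linear_combination ((√(r / 6) : ℝ) : ℂ) * h₃

theorem norm_relative_error {v : ℂ → ℂ} {r : ℝ} (hr : 0 < r) :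
    ‖turn ^ 2 * v (ray r) + (√(r / 6) : ℝ)‖
      = ‖v (ray r) / (I * (ray r / 6) ^ (1 / 2 : ℂ)) - 1‖ * √(r / 6) := by
  have hs : 0 < √(r / 6) := Real.sqrt_pos.2 (by positivity)
  have h := turn_sq_mul_leading hr
  set w := I * (ray r / 6) ^ (1 / 2 : ℂ)
  have hw : w ≠ 0 := fun h0 => by
    rw [h0, mul_zero, eq_comm, neg_eq_zero, ofReal_eq_zero] at h
    exact hs.ne' h
  have hn : ‖w‖ = √(r / 6) := by
    have := congrArg norm h
    rwa [norm_mul, norm_pow, norm_turn, one_pow, one_mul, norm_neg, norm_real,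
      Real.norm_of_nonneg hs.le] at this
  have e : turn ^ 2 * v (ray r) + (√(r / 6) : ℝ) = turn ^ 2 * ((v (ray r) / w - 1) * w) := by
    rw [sub_mul, div_mul_cancel₀ _ hw]
    linear_combination h
  rw [e, norm_mul, norm_pow, norm_turn, one_pow, one_mul, norm_mul, hn]

theorem rpow_mul_sqrt {r : ℝ} (hr : 0 < r) : r ^ (-(5 / 2) : ℝ) * √(r / 6) = 1 / √6 / r ^ 2 := by
  have : r ^ (-(5 / 2) : ℝ) = (r ^ 2)⁻¹ * (√r)⁻¹ := by
    rw [Real.sqrt_eq_rpow, ← Real.rpow_natCast, ← Real.rpow_neg hr.le, ← Real.rpow_neg hr.le,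
      ← Real.rpow_add hr]
    norm_num
  have hs := (Real.sqrt_pos.2 hr).ne'
  rw [this, Real.sqrt_div hr.le]
  field_simp

/-- The asymptotic condition of the tritronquée, for the rotated solution. -/
theorem isBigO_iff_exists_bound {v : ℂ → ℂ} :
    ((fun r : ℝ => v (ray r) / (I * (ray r / 6) ^ (1 / 2 : ℂ)) - 1)
        =O[atTop] fun r : ℝ => r ^ (-(5 / 2) : ℝ)) ↔
      ∃ C : ℝ, ∀ᶠ r : ℝ in atTop, ‖turn ^ 2 * v (ray r) + (√(r / 6) : ℝ)‖ ≤ C / r ^ 2 := by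
  have h6 : (0 : ℝ) < √6 := Real.sqrt_pos.2 (by norm_num)
  rw [isBigO_iff]
  constructor
  · rintro ⟨c, hc⟩
    refine ⟨c / √6, ?_⟩
    filter_upwards [hc, eventually_gt_atTop 0] with r h hr
    rw [norm_relative_error hr]
    rw [Real.norm_of_nonneg (Real.rpow_nonneg hr.le _)] at h
    calc _ ≤ c * r ^ (-(5 / 2) : ℝ) * √(r / 6) :=
          mul_le_mul_of_nonneg_right h (Real.sqrt_nonneg _)
      _ = c / √6 / r ^ 2 := by rw [mul_assoc, rpow_mul_sqrt hr]; ring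
  · rintro ⟨C, hC⟩
    refine ⟨C * √6, ?_⟩
    filter_upwards [hC, eventually_gt_atTop 0] with r h hr
    have hs : 0 < √(r / 6) := Real.sqrt_pos.2 (by positivity)
    rw [norm_relative_error hr] at h
    rw [Real.norm_of_nonneg (Real.rpow_nonneg hr.le _)]
    refine le_of_mul_le_mul_right (h.trans_eq ?_) hs
    rw [mul_assoc, rpow_mul_sqrt hr]
    field_simp

/-! ### The tritronquée solution -/

/-- The solution on the half-line, extended holomorphically and rotated back, is a tritronquée
solution. -/
theorem exists_tritronquee {f f' : ℝ → ℂ}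
    (hf : ∀ x, 0 ≤ x → HasDerivWithinAt f (f' x) (Set.Ici 0) x)
    (hf' : ∀ x, 0 ≤ x → HasDerivWithinAt f' (6 * f x ^ 2 - x) (Set.Ici 0) x)
    (hfC : ∀ x, 2 ≤ x → ‖f x + (√(x / 6) : ℝ)‖ ≤ 1 / x ^ 2) :
    ∃ (U : Set ℂ) (y : ℂ → ℂ), IsTritronquee U y ∧ (∀ r : ℝ, 0 ≤ r → ray r ∈ U) ∧
      ∀ r : ℝ, 0 ≤ r → turn ^ 2 * y (ray r) = f r ∧ turn ^ 3 * deriv y (ray r) = f' r := by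
  obtain ⟨U, F, F', hU, hmem, hF, hFf⟩ := exists_holomorphic_extension hf hf'
  obtain ⟨p, hp⟩ : ∃ p : ℂ, p = turn⁻¹ := ⟨_, rfl⟩
  have hpt : turn * p = 1 := by rw [hp, mul_inv_cancel₀ turn_ne_zero]
  have hp5 : p ^ 5 = -1 := by rw [hp, inv_pow, turn_pow_five]; norm_num
  have hrp : ∀ r : ℝ, ray r * p = r := fun r => by rw [ray_eq, mul_assoc, hpt, mul_one]
  have hlin : ∀ z : ℂ, HasDerivAt (fun z => z * p) p z := fun z => by
    simpa using (hasDerivAt_id z).mul_const p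
  have h₁ : ∀ z, z * p ∈ U → HasDerivAt (fun z => p ^ 2 * F (z * p)) (p ^ 3 * F' (z * p)) z :=
    fun z hz => by
      refine (((hF _ hz).1.comp z (hlin z)).const_mul (p ^ 2)).congr_deriv ?_
      ring
  have h₂ : ∀ z, z * p ∈ U → HasDerivAt (fun z => p ^ 3 * F' (z * p))
      (6 * (p ^ 2 * F (z * p)) ^ 2 + z) z := fun z hz => by
    refine (((hF _ hz).2.comp z (hlin z)).const_mul (p ^ 3)).congr_deriv ?_
    linear_combination -z * hp5
  have hUo : IsOpen {z | z * p ∈ U} := hU.preimage (continuous_id.mul continuous_const)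
  have hray : ∀ r : ℝ, 0 ≤ r → ray r ∈ {z | z * p ∈ U} := fun r hr => by
    change ray r * p ∈ U
    rw [hrp]; exact hmem r hr
  have hval : ∀ r : ℝ, 0 ≤ r → turn ^ 2 * (p ^ 2 * F (ray r * p)) = f r := fun r hr => by
    rw [hrp, (hFf r hr).1, ← mul_assoc, ← mul_pow, hpt, one_pow, one_mul]
  refine ⟨{z | z * p ∈ U}, fun z => p ^ 2 * F (z * p), ⟨⟨hUo, ?_, fun z hz => ?_⟩, ?_, ?_⟩,
    hray, fun r hr => ⟨hval r hr, ?_⟩⟩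
  · exact fun z hz => (h₁ z hz).differentiableAt.differentiableWithinAt
  · have : deriv (fun z => p ^ 2 * F (z * p)) =ᶠ[nhds z] fun z => p ^ 3 * F' (z * p) := by
      filter_upwards [hUo.mem_nhds hz] with w hw using (h₁ w hw).deriv
    rw [this.deriv_eq, (h₂ z hz).deriv]
  · filter_upwards [eventually_ge_atTop 0] with r hr using hray r hr
  · refine (isBigO_iff_exists_bound (v := fun z => p ^ 2 * F (z * p))).2 ⟨1, ?_⟩
    filter_upwards [eventually_ge_atTop 2] with r hr
    rw [hval r (by linarith)]
    exact hfC r hr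
  · rw [(h₁ _ (hray r hr)).deriv, hrp, (hFf r hr).2, ← mul_assoc, ← mul_pow, hpt, one_pow, one_mul]

/-- Two tritronquée solutions agree on every part `[r₀, ∞)` of the ray on which both are defined:
far out by the asymptotics, and from there by uniqueness for the initial value problem. -/
theorem IsTritronquee.eq_on_ray {U V : Set ℂ} {y v : ℂ → ℂ} (hy : IsTritronquee U y)
    (hv : IsTritronquee V v) {r₀ : ℝ} (hU : ∀ r : ℝ, r₀ ≤ r → ray r ∈ U)
    (hV : ∀ r : ℝ, r₀ ≤ r → ray r ∈ V) {r : ℝ} (hr : r₀ ≤ r) : v (ray r) = y (ray r) := by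
  obtain ⟨C₁, hC₁⟩ := isBigO_iff_exists_bound.1 hy.2.2
  obtain ⟨C₂, hC₂⟩ := isBigO_iff_exists_bound.1 hv.2.2
  obtain ⟨s, hs⟩ := eventually_atTop.1 (hC₁.and hC₂)
  have hmono : ∀ {c : ℝ} (x : ℝ), c ≤ max C₁ C₂ → c / x ^ 2 ≤ max C₁ C₂ / x ^ 2 := fun x h =>
    div_le_div_of_nonneg_right h (sq_nonneg x)
  have hR : ∀ {x}, max (max s r₀) 1 ≤ x → s ≤ x ∧ r₀ ≤ x := fun h =>
    ⟨(le_max_left _ _).trans ((le_max_left _ _).trans h),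
      (le_max_right _ _).trans ((le_max_left _ _).trans h)⟩
  obtain ⟨b, hb⟩ := eventually_eq_of_asymptotic (R := max (max s r₀) 1) (C := max C₁ C₂)
    (lt_of_lt_of_le one_pos (le_max_right _ _))
    (fun x hx => (hv.1.hasDerivAt_ray (hV x (hR hx).2)).1)
    (fun x hx => (hv.1.hasDerivAt_ray (hV x (hR hx).2)).2)
    (fun x hx => (hy.1.hasDerivAt_ray (hU x (hR hx).2)).1)
    (fun x hx => (hy.1.hasDerivAt_ray (hU x (hR hx).2)).2)
    (fun x hx => (hs x (hR hx).1).2.trans (hmono x (le_max_right _ _)))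
    (fun x hx => (hs x (hR hx).1).1.trans (hmono x (le_max_left _ _)))
  have hb₁ : r₀ ≤ max b r₀ + 1 := by linarith [le_max_right b r₀]
  have hev : (fun r : ℝ => turn ^ 2 * v (ray r)) =ᶠ[nhds (max b r₀ + 1)]
      fun r : ℝ => turn ^ 2 * y (ray r) := by
    filter_upwards [Ioi_mem_nhds (lt_add_one (max b r₀))] with x hx
    exact hb x ((le_max_left _ _).trans (le_of_lt hx))
  have hd : turn ^ 3 * deriv v (ray (max b r₀ + 1)) = turn ^ 3 * deriv y (ray (max b r₀ + 1)) :=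
    (hv.1.hasDerivAt_ray (hV _ hb₁)).1.unique
      ((hy.1.hasDerivAt_ray (hU _ hb₁)).1.congr_of_eventuallyEq hev)
  have h := eq_of_painleve_ode (a := r₀) (b := max r (max b r₀ + 1))
    (f' := fun r => turn ^ 3 * deriv v (ray r)) (g' := fun r => turn ^ 3 * deriv y (ray r))
    ⟨hb₁, le_max_right _ _⟩
    (fun t ht => (hv.1.hasDerivAt_ray (hV t ht.1)).1.hasDerivWithinAt)
    (fun t ht => (hv.1.hasDerivAt_ray (hV t ht.1)).2.hasDerivWithinAt)
    (fun t ht => (hy.1.hasDerivAt_ray (hU t ht.1)).1.hasDerivWithinAt)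
    (fun t ht => (hy.1.hasDerivAt_ray (hU t ht.1)).2.hasDerivWithinAt)
    hev.eq_of_nhds hd r ⟨hr, le_max_left _ _⟩
  exact mul_left_cancel₀ (pow_ne_zero 2 turn_ne_zero) h.1

theorem IsSolutionOn.hasDerivAt_rotated {U : Set ℂ} {y : ℂ → ℂ} (h : IsSolutionOn U y) {t : ℝ}
    (ht : ray (-t) ∈ U) :
    HasDerivAt (rotated y) (-(turn ^ 3 * deriv y (ray (-t)))) t := by
  have e : rotated y = fun t => turn ^ 2 * y (ray (-t)) := funext (rotated_eq y)
  rw [e]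
  have := (h.hasDerivAt_ray ht).1.scomp t (hasDerivAt_neg t)
  refine this.congr_deriv ?_
  rw [neg_smul, one_smul]

end PainleveI

end

theorem mainTheorem6 :
    -- the tritronquée exists, extends along the whole ray, and is unique
    ∃ (U : Set ℂ) (y : ℂ → ℂ),
      PainleveI.IsTritronquee U y ∧
      (∀ r : ℝ, 0 ≤ r → PainleveI.ray r ∈ U) ∧
      (∀ (V : Set ℂ) (v : ℂ → ℂ), PainleveI.IsTritronquee V v →
        ∀ r₀ : ℝ, 0 ≤ r₀ → (∀ r : ℝ, r₀ ≤ r → PainleveI.ray r ∈ V) →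
          ∀ r : ℝ, r₀ ≤ r → v (PainleveI.ray r) = y (PainleveI.ray r)) ∧
      -- the matching data at `t₀`
      ‖PainleveI.delta y PainleveI.t₀‖ < 1 / 290 ∧
      ‖deriv (PainleveI.delta y) PainleveI.t₀‖ < 1 / 152 ∧
      -- (i) contraction, with factor less than `1/6`, of the disc into itself
      (∀ a₁ a₂ : ℂ, ‖a₁‖ < 1 / 290 → ‖a₂‖ < 1 / 152 →
        Set.MapsTo (PainleveI.N a₁ a₂) PainleveI.disc PainleveI.disc ∧
        ∃ κ : ℝ, 0 ≤ κ ∧ κ < 1 / 6 ∧ ∀ p ∈ PainleveI.disc, ∀ q ∈ PainleveI.disc,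
          PainleveI.halfNorm (PainleveI.N a₁ a₂ p - PainleveI.N a₁ a₂ q)
            ≤ κ * PainleveI.halfNorm (p - q)) ∧
      -- `(δ, δ')` is in the disc and is a fixed point on `[t₀, 0]`
      (PainleveI.delta y, deriv (PainleveI.delta y)) ∈ PainleveI.disc ∧
      (∀ t ∈ Set.Icc PainleveI.t₀ 0,
        (PainleveI.N (PainleveI.delta y PainleveI.t₀) (deriv (PainleveI.delta y) PainleveI.t₀)
            (PainleveI.delta y, deriv (PainleveI.delta y))).1 t = PainleveI.delta y t ∧
        (PainleveI.N (PainleveI.delta y PainleveI.t₀) (deriv (PainleveI.delta y) PainleveI.t₀)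
            (PainleveI.delta y, deriv (PainleveI.delta y))).2 t
          = deriv (PainleveI.delta y) t) ∧
      -- (ii)
      PainleveI.supNorm (fun t => PainleveI.delta y t
        - PainleveI.delta y PainleveI.t₀ * (PainleveI.J₁ t : ℂ)
        - deriv (PainleveI.delta y) PainleveI.t₀ * (PainleveI.J₂ t : ℂ)) < 1 / 1500 ∧
      PainleveI.supNorm (fun t => deriv (PainleveI.delta y) t
        - PainleveI.delta y PainleveI.t₀ * ((deriv PainleveI.J₁ t : ℝ) : ℂ)
        - deriv (PainleveI.delta y) PainleveI.t₀ * ((deriv PainleveI.J₂ t : ℝ) : ℂ))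
          < 1 / 658 ∧
      -- (iii)
      ‖PainleveI.rotated y 0 + 87 / 469‖ < 1 / 167 ∧
      ‖deriv (PainleveI.rotated y) 0 - 41 / 134‖ < 1 / 108 ∧
      ‖y 0 - -(87 / 469) * exp (-(2 * Real.pi * I / 5))‖ < 1 / 100 ∧
      ‖deriv y 0 - 41 / 134 * exp (2 * Real.pi * I / 5)‖ < 1 / 100 := by
  open PainleveI in
  obtain ⟨f, f', d, hf, hf', hfC, hd, ha₁, ha₂, hd₁, hd₂, hfd⟩ := exists_solution_half_line
  obtain ⟨U, y, hy, hU, hyf⟩ := exists_tritronquee hf hf' hfC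
  have hn : ∀ t ∈ Set.Icc t₀ 0, 0 ≤ -t := fun t ht => neg_nonneg.2 ht.2
  have hrot : ∀ t ∈ Set.Icc t₀ 0, rotated y t = g₀ t + d.1 t := fun t ht => by
    rw [rotated_eq, (hyf _ (hn t ht)).1, (hfd t ht).1]
  have hrot' : ∀ t ∈ Set.Icc t₀ 0,
      HasDerivAt (rotated y) ((deriv g₀ t : ℝ) + d.2 t) t := fun t ht => by
    refine (hy.1.hasDerivAt_rotated (hU _ (hn t ht))).congr_deriv ?_
    rw [(hyf _ (hn t ht)).2, (hfd t ht).2, neg_neg]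
  have e₁ : ∀ t ∈ Set.Icc t₀ 0, d.1 t = delta y t := fun t ht => by
    rw [delta, hrot t ht]; ring
  have e₂ : ∀ t ∈ Set.Icc t₀ 0, d.2 t = deriv (delta y) t := fun t ht => by
    have := (hrot' t ht).sub (hasDerivAt_g₀ t).ofReal_comp
    refine Eq.trans ?_ (HasDerivAt.deriv (f := delta y) this).symm
    ring
  have hk₁ : ∀ t ∈ Set.Icc t₀ 0, d.1 t = d.1 t₀ * J₁ t + d.2 t₀ * J₂ t
      + (K₁ (fun s => (R s : ℂ)) t + K₁ (nonlin d) t) := fun t ht => by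
    rw [← add_assoc]; exact (hd₁ t ht).symm
  have hk₂ : ∀ t ∈ Set.Icc t₀ 0, d.2 t = d.1 t₀ * (deriv J₁ t : ℝ) + d.2 t₀ * (deriv J₂ t : ℝ)
      + (K₂ (fun s => (R s : ℂ)) t + K₂ (nonlin d) t) := fun t ht => by
    rw [← add_assoc]; exact (hd₂ t ht).symm
  have hg : ‖rotated y 0 + 87 / 469‖ < 1 / 167 := by
    rw [hrot 0 zero_mem_Icc, hk₁ 0 zero_mem_Icc]
    exact norm_add_g₀_zero_lt ha₁ ha₂ (norm_K₁_R_add_le hd zero_mem_Icc)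
  have hg' : ‖deriv (rotated y) 0 - 41 / 134‖ < 1 / 108 := by
    rw [(hrot' 0 zero_mem_Icc).deriv, hk₂ 0 zero_mem_Icc]
    exact norm_add_deriv_g₀_zero_lt ha₁ ha₂ (norm_K₂_R_add_le hd zero_mem_Icc)
  have hray : ray (-0) = 0 := by simp [ray]
  refine ⟨U, y, hy, hU, fun V v hv r₀ hr₀ hV r hr =>
      hy.eq_on_ray hv (fun s hs => hU s (hr₀.trans hs)) hV hr,
    ?_, ?_, fun a₁ a₂ h₁ h₂ => ⟨mapsTo_N h₁ h₂, 3 / 20, by norm_num, by norm_num,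
      fun p hp q hq => halfNorm_N_sub_le a₁ a₂ hp hq⟩,
    mem_disc_congr e₁ e₂ hd, fun t ht => ?_, ?_, ?_, hg, hg', ?_, ?_⟩
  · rw [← e₁ _ t₀_mem]; exact ha₁
  · rw [← e₂ _ t₀_mem]; exact ha₂
  · have h := N_congr (e := (delta y, deriv (delta y))) e₁ e₂ (d.1 t₀) (d.2 t₀) ht
    rw [← e₁ _ t₀_mem, ← e₂ _ t₀_mem, ← h.1, ← h.2, hd₁ t ht, hd₂ t ht]
    exact ⟨e₁ t ht, e₂ t ht⟩
  · refine lt_of_le_of_lt (supNorm_le (c := 635 / 1000000) fun t ht => ?_) (by norm_num)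
    rw [← e₁ _ t₀_mem, ← e₂ _ t₀_mem, ← e₁ t ht]
    refine le_of_eq_of_le (congrArg norm ?_) (norm_K₁_R_add_le hd ht)
    linear_combination hk₁ t ht
  · refine lt_of_le_of_lt (supNorm_le (c := 1420 / 1000000) fun t ht => ?_) (by norm_num)
    rw [← e₁ _ t₀_mem, ← e₂ _ t₀_mem, ← e₂ t ht]
    refine le_of_eq_of_le (congrArg norm ?_) (norm_K₂_R_add_le hd ht)
    linear_combination hk₂ t ht
  · refine lt_of_eq_of_lt ?_ (hg.trans (by norm_num))
    -- multiplication by `e^{2πi/5}`, of modulus one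
    rw [rotated_eq, hray, exp_neg, exp_two_fifths, ← one_mul ‖y 0 - _‖,
      ← one_pow (M := ℝ) 2, ← norm_turn, ← norm_pow, ← norm_mul]
    congr 1
    have := turn_ne_zero
    field_simp
    ring
  · refine lt_of_eq_of_lt ?_ (hg'.trans (by norm_num))
    -- multiplication by `-e^{3πi/5}`, of modulus one
    rw [(hy.1.hasDerivAt_rotated (hU _ (by simp))).deriv, hray, exp_two_fifths,
      ← one_mul ‖deriv y 0 - _‖, ← one_pow (M := ℝ) 3, ← norm_turn, ← norm_pow, ← norm_mul,
      ← norm_neg]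
    congr 1
    linear_combination (41 / 134) * turn_pow_five
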